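/- Throughout, $\lambda\in\mathbb N$ is the security parameter, a function $\varepsilon$ is negligible if $\varepsilon(\lambda)=\lambda^{-\omega(1)}$, and QPT machines are (non-uniform) families of quantum circuits of polynomial size, possibly with oracle gates; adversaries and distinguishers may in addition receive an arbitrary quantum advice state $\rho_\lambda$ on polynomially many qubits. **Assumption.** Let $d(\lambda)$, $\ell(\lambda)$ be functions with $d(\lambda)=\omega(\log\lambda)$ and let $\{|\psi_{k,x}\rangle\}$, $k\in\{0,1\}^\lambda$, $x\in\{0,1\}^{d(\lambda)}$, be a family of $\ell(\lambda)$-qubit pure states which is a quantum-accessible pseudorandom function-like state (PRFS) family, that is: (i) polynomial-size quantum circuits implement, given $k$, the isometry $|x\rangle\mapsto|x\rangle|\psi_{k,x}\rangle$; (ii) for every QPT distinguisher $A$ there is a negligible $\varepsilon$ such that for all $\lambda$ $$\Big|\Pr_{k\leftarrow\{0,1\}^\lambda}\big[A_\lambda^{|\mathcal O_{k}\rangle}(\rho_\lambda)=1\big]-\Pr_{\vartheta}\big[A_\lambda^{|\mathcal O_{\vartheta}\rangle}(\rho_\lambda)=1\big]\Big|\le\varepsilon(\lambda),$$ where $\mathcal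 O_k$ is the isometry $|x\rangle\mapsto|x\rangle|\psi_{k,x}\rangle$, $\mathcal O_\vartheta$ is the isometry $|x\rangle\mapsto|x\rangle|\vartheta_x\rangle$ with independent Haar-random $\ell(\lambda)$-qubit states $|\vartheta_x\rangle$, and $A$ may query its oracle in superposition. **Scheme.** Let $n=n(\lambda)$ be polynomially bounded. Consider the following single-bit encryption scheme with quantum public keys and quantum ciphertexts. - $\mathsf{Gen}(1^\lambda)$ outputs a uniformly random $\mathsf{dk}\in\{0,1\}^\lambda$. - $\mathsf{QPKGen}(\mathsf{dk})$ outputs the pure state $|\mathsf{qpk}\rangle=2^{-d/2}\sum_{x\in\{0,1\}^{d}}|x\rangle_R|\psi_{\mathsf{dk},x}\rangle^{\otimes n}_S$. - $\mathsf{Enc}(|\mathsf{qpk}\rangle,m)$, for $m\in\{0,1\}$, measures $R$ in the computational basis, with outcome $x$. If $m=0$ it outputs $x$ together with the residual state of $S$. If $m=1$ it samples a uniformly random key $\mathsf{dk}_1\in\{0,1\}^\lambda$ and outputs $(x,|\psi_{\mathsf{dk}_1,x}\rangle^{\otimes n})$. - $\mathsf{Dec}(\mathsf{dk},(x,\Psi))$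 prepares $|\psi_{\mathsf{dk},x}\rangle^{\otimes n}$ and, for $i=1,\dots,n$, performs a SWAP test between the $i$-th $\ell$-qubit subsystem of $\Psi$ and the $i$-th copy of $|\psi_{\mathsf{dk},x}\rangle$; it outputs $0$ if all outcomes are $0$, and $1$ otherwise. **Theorem.** Under the assumption above the scheme is IND-CCA1 secure: for every QPT adversary $(\mathcal A_1,\mathcal A_2)$ there is a negligible function $\varepsilon$ such that for all $\lambda$ the adversary wins the following game with probability at most $\tfrac12+\varepsilon(\lambda)$. The challenger samples $\mathsf{dk}\leftarrow\mathsf{Gen}(1^\lambda)$. The adversary $\mathcal A_1$ has oracle access to $\mathsf{QPKGen}(\mathsf{dk})$ (each query returns a copy of $|\mathsf{qpk}\rangle$), to encryption (on input a bit $m$ it returns $\mathsf{Enc}(|\mathsf{qpk}\rangle,m)$ for a fresh copy of $|\mathsf{qpk}\rangle$) and to $\mathsf{Dec}(\mathsf{dk},\cdot)$ (on quantum ciphertexts of its choice, possibly entangled with its memory); it outputs messages $m_0,m_1\in\{0,1\}$ and passes its quantum state to $\mathcal A_2$. The challenger samples $b\in\{0,1\}$ uniformly, and $\mathcal A_2$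 receives $\mathsf{Enc}(|\mathsf{qpk}\rangle,m_b)$, for a fresh copy of $|\mathsf{qpk}\rangle$. With oracle access to $\mathsf{QPKGen}(\mathsf{dk})$ and encryption, but no longer to decryption, $\mathcal A_2$ outputs a bit $b'$. The adversary wins iff $b'=b$. -/

import Mathlib

open scoped ComplexOrder

noncomputable section

namespace QCrypto

/-! ### Registers, states and channels

A register is a finite set `W` of wires (qubits); its computational basis is `W → Bool`. -/

/-- Operators on the Hilbert space of the register `W`. -/
abbrev Op (W : Type) : Type := Matrix (W → Bool) (W → Bool) ℂ

/-- Pure states of the register `W`: unit vectors. -/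
abbrev PureState (W : Type) [Fintype W] [DecidableEq W] : Type :=
  Metric.sphere (0 : EuclideanSpace ℂ (W → Bool)) 1

/-- The amplitude of a pure state at a basis string. -/
def amp {W : Type} [Fintype W] [DecidableEq W] (v : PureState W) (s : W → Bool) : ℂ :=
  (v : EuclideanSpace ℂ (W → Bool)) s

/-- Density operators of the register `W`. -/
structure DensityOp (W : Type) [Fintype W] [DecidableEq W] where
  mat : Op W
  posSemidef : mat.PosSemidef
  trace_eq_one : mat.trace = 1

/-- A quantum channel from register `A` to register `B`, given by Kraus operators. -/
structure Channel (A B : Type) [Fintype A] [DecidableEq A] [Fintype B] [DecidableEq B] where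
  ι : Type
  fintypeι : Fintype ι
  kraus : ι → Matrix (B → Bool) (A → Bool) ℂ
  complete : ∑ i, (kraus i).conjTranspose * kraus i = 1

attribute [instance] Channel.fintypeι

lemma kraus_complete {ι A B : Type} [Fintype ι] [Fintype A] [DecidableEq A] [Fintype B]
    [DecidableEq B] {K : ι → Matrix (B → Bool) (A → Bool) ℂ}
    (h : ∀ x x', ∑ i, ∑ s, star (K i s x) * K i s x' = if x = x' then 1 else 0) :
    ∑ i, (K i).conjTranspose * K i = 1 := by
  ext x x'
  simp only [Matrix.sum_apply, Matrix.mul_apply, Matrix.conjTranspose_apply, Matrix.one_apply]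
  exact h x x'

/-- `liftOp e M` is the operator `M` acting on the wires selected by `e`, tensored with the
identity on all other wires. -/
def liftOp {V W : Type} (e : V ↪ W) (M : Op V) : Op W :=
  open Classical in
  Matrix.of fun s t => if ∀ w, w ∉ Set.range e → s w = t w then M (s ∘ e) (t ∘ e) else 0

/-- Kraus operators of a query to a channel `A → B` by a machine holding registers `A` and `B`:
the channel consumes the content of `A` (which is left in the state `|0…0⟩`), the previous content
of `B` is discarded (summation over `b`), and the output of the channel is stored in `B`. -/
def Channel.queryKraus {A B : Type} [Fintype A] [DecidableEq A] [Fintype B] [DecidableEq B]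
    (Φ : Channel A B) (i : Φ.ι) (b : B → Bool) : Op (A ⊕ B) :=
  Matrix.of fun s t => if (∀ a, s (Sum.inl a) = false) ∧ t ∘ Sum.inr = b
    then Φ.kraus i (s ∘ Sum.inr) (t ∘ Sum.inl) else 0

/-- The effect on the memory `W` of a query to the channel `Φ` on the wires selected by `e`. -/
def Channel.query {A B W : Type} [Fintype A] [DecidableEq A] [Fintype B] [DecidableEq B]
    [Fintype W] [DecidableEq W] (Φ : Channel A B) (e : A ⊕ B ↪ W) (ρ : Op W) : Op W :=
  ∑ i : Φ.ι, ∑ b : B → Bool,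
    liftOp e (Φ.queryKraus i b) * ρ * (liftOp e (Φ.queryKraus i b)).conjTranspose

/-! ### Circuits with oracle gates -/

/-- An elementary gate on the wires `W`: an arbitrary unitary on at most three wires.
(Each of them is a product of boundedly many one- and two-qubit gates.) -/
structure Gate (W : Type) where
  arity : ℕ
  arity_le : arity ≤ 3
  wires : Fin arity ↪ W
  unitary : Matrix.unitaryGroup (Fin arity → Bool) ℂ

/-- The unitary operator on all wires performed by a gate. -/
def Gate.op {W : Type} (g : Gate W) : Op W := liftOp g.wires g.unitary.1

/-- The unitary operator performed by a list of gates, the head of the list being applied first. -/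
def circuitOp {W : Type} [Fintype W] [DecidableEq W] : List (Gate W) → Op W
  | [] => 1
  | g :: C => circuitOp C * g.op

/-- An oracle interface: names of the oracles with their input and output registers. -/
structure Interface where
  Q : Type
  inp : Q → Type
  out : Q → Type
  fintypeInp : ∀ q, Fintype (inp q)
  decEqInp : ∀ q, DecidableEq (inp q)
  fintypeOut : ∀ q, Fintype (out q)
  decEqOut : ∀ q, DecidableEq (out q)

attribute [instance] Interface.fintypeInp Interface.decEqInp Interface.fintypeOut
  Interface.decEqOut

/-- One step of an oracle circuit: an elementary gate or an oracle query. -/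
inductive Instr (I : Interface) (W : Type) where
  | gate (g : Gate W)
  | query (q : I.Q) (e : I.inp q ⊕ I.out q ↪ W)

/-- The effect of one step on the state of the memory. -/
def Instr.run {I : Interface} {W : Type} [Fintype W] [DecidableEq W]
    (O : ∀ q, Channel (I.inp q) (I.out q)) : Instr I W → Op W → Op W
  | .gate g, ρ => g.op * ρ * g.op.conjTranspose
  | .query q e, ρ => (O q).query e ρ

/-- The effect of an oracle circuit, the head of the list being executed first. -/
def runProg {I : Interface} {W : Type} [Fintype W] [DecidableEq W]
    (O : ∀ q, Channel (I.inp q) (I.out q)) (P : List (Instr I W)) (ρ : Op W) : Op W :=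
  P.foldl (fun σ c => c.run O σ) ρ

/-- The probability that measuring the wire `w` of a memory in state `ρ` gives `b`. -/
def measProb {W : Type} [Fintype W] [DecidableEq W] (ρ : Op W) (w : W) (b : Bool) : ℝ :=
  ∑ s : W → Bool, if s w = b then (ρ s s).re else 0

/-! ### Asymptotics -/

/-- Negligible functions `f(λ) = λ^{-ω(1)}`. -/
def Negligible (f : ℕ → ℝ) : Prop :=
  Asymptotics.SuperpolynomialDecay Filter.atTop (fun lam : ℕ => (lam : ℝ)) f

/-- Polynomially bounded functions. -/
def PolyBounded (f : ℕ → ℕ) : Prop := ∃ p : Polynomial ℕ, ∀ lam, f lam ≤ p.eval lam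

/-- Super-logarithmic functions `d(λ) = ω(log λ)`. -/
def SuperLog (d : ℕ → ℕ) : Prop :=
  (fun lam : ℕ => Real.log (lam : ℝ)) =o[Filter.atTop] (fun lam : ℕ => (d lam : ℝ))

/-! ### Elementary facts on amplitudes -/

lemma sum_amp {W : Type} [Fintype W] [DecidableEq W] (v : PureState W) :
    ∑ s, star (amp v s) * amp v s = 1 := by
  have h : ‖(v : EuclideanSpace ℂ (W → Bool))‖ = 1 := by simp
  have h2 := EuclideanSpace.norm_sq_eq (v : EuclideanSpace ℂ (W → Bool))
  rw [h] at h2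
  have h3 : ∀ s, star (amp v s) * amp v s
      = ((‖(v : EuclideanSpace ℂ (W → Bool)) s‖ ^ 2 : ℝ) : ℂ) := by
    intro s
    simp only [amp, Complex.star_def]
    rw [mul_comm, Complex.mul_conj, Complex.normSq_eq_norm_sq]
  rw [Finset.sum_congr rfl (fun s _ => h3 s), ← Complex.ofReal_sum, ← h2]
  simp

/-- The pure state with given amplitudes. -/
def mkState {W : Type} [Fintype W] [DecidableEq W] (f : (W → Bool) → ℂ)
    (hf : ∑ s, star (f s) * f s = 1) : PureState W :=
  ⟨WithLp.toLp 2 f, by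
    rw [mem_sphere_zero_iff_norm, ← sq_eq_sq₀ (norm_nonneg _) zero_le_one,
      EuclideanSpace.norm_sq_eq, ← Complex.ofReal_inj, Complex.ofReal_sum]
    simp only [one_pow, Complex.ofReal_one]
    rw [← hf]
    refine Finset.sum_congr rfl fun s _ => ?_
    rw [Complex.star_def, mul_comm (starRingEnd ℂ (f s)), Complex.mul_conj,
      Complex.normSq_eq_norm_sq]⟩

lemma sum_scaled_amp {W : Type} [Fintype W] [DecidableEq W] (v : PureState W) (m : ℕ) :
    ∑ u, star ((((Real.sqrt (2 ^ m))⁻¹ : ℝ) : ℂ) * amp v u) *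
      ((((Real.sqrt (2 ^ m))⁻¹ : ℝ) : ℂ) * amp v u) = (((2 ^ m : ℝ)⁻¹ : ℝ) : ℂ) := by
  have h1 : ∀ u, star ((((Real.sqrt (2 ^ m))⁻¹ : ℝ) : ℂ) * amp v u) *
      ((((Real.sqrt (2 ^ m))⁻¹ : ℝ) : ℂ) * amp v u) =
      (((Real.sqrt (2 ^ m))⁻¹ * (Real.sqrt (2 ^ m))⁻¹ : ℝ) : ℂ) * (star (amp v u) * amp v u) := by
    intro u
    simp only [star_mul', Complex.star_def, Complex.conj_ofReal, Complex.ofReal_mul]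
    ring
  rw [Finset.sum_congr rfl (fun u _ => h1 u), ← Finset.mul_sum, sum_amp, mul_one,
    ← mul_inv, Real.mul_self_sqrt (by positivity)]

lemma sum_sumBits {A B : Type} [Fintype A] [DecidableEq A] [Fintype B] [DecidableEq B]
    (f : (A → Bool) → (B → Bool) → ℂ) :
    ∑ s : A ⊕ B → Bool, f (s ∘ Sum.inl) (s ∘ Sum.inr) = ∑ a, ∑ b, f a b := by
  rw [← Fintype.sum_prod_type']
  exact Fintype.sum_equiv (Equiv.sumArrowEquivProdArrow A B Bool) _ _ (fun _ => rfl)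

lemma sumBits_ext {A B : Type} {s t : A ⊕ B → Bool} :
    s = t ↔ s ∘ Sum.inl = t ∘ Sum.inl ∧ s ∘ Sum.inr = t ∘ Sum.inr := by
  constructor
  · rintro rfl; exact ⟨rfl, rfl⟩
  · rintro ⟨h1, h2⟩
    funext w
    rcases w with a | b
    · exact congrFun h1 a
    · exact congrFun h2 b

/-! ### Pseudorandom function-like states -/

/-- The Haar distribution on the pure states of `W`: the normalized (unitarily invariant) surface
measure of the unit sphere. -/
def haarState (W : Type) [Fintype W] [DecidableEq W] : MeasureTheory.Measure (PureState W) :=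
  ((MeasureTheory.volume : MeasureTheory.Measure (EuclideanSpace ℂ (W → Bool))).toSphere
    Set.univ)⁻¹ •
    (MeasureTheory.volume : MeasureTheory.Measure (EuclideanSpace ℂ (W → Bool))).toSphere

/-- The superposition oracle of a family of states `v x`: the isometry `|x⟩ ↦ |x⟩|v x⟩`. -/
def stateOracle {d l : ℕ} (v : (Fin d → Bool) → PureState (Fin l)) :
    Channel (Fin d) (Fin d ⊕ Fin l) where
  ι := Unit
  fintypeι := inferInstance
  kraus := fun _ => Matrix.of fun s x =>
    if s ∘ Sum.inl = x then amp (v x) (s ∘ Sum.inr) else 0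
  complete := by
    refine kraus_complete fun x x' => ?_
    rw [Fintype.sum_unique]
    simp only [Matrix.of_apply]
    rw [sum_sumBits (fun a b => star (if a = x then amp (v x) b else 0) *
      (if a = x' then amp (v x') b else 0)), Finset.sum_eq_single x]
    · by_cases h : x = x'
      · subst h; simpa using sum_amp (v x)
      · simp [h]
    · intro a _ ha; simp [ha]
    · simp

/-- The interface of a machine with access to one state oracle. -/
def stateInterface (d l : ℕ) : Interface where
  Q := Unit
  inp := fun _ => Fin d
  out := fun _ => Fin d ⊕ Fin l
  fintypeInp := fun _ => inferInstance
  decEqInp := fun _ => inferInstance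
  fintypeOut := fun _ => inferInstance
  decEqOut := fun _ => inferInstance

/-- A quantum distinguisher with (possibly mixed) quantum advice `init`, which also holds the
ancillas, and superposition access to a state oracle. -/
structure Distinguisher (d l : ℕ) where
  N : ℕ
  init : DensityOp (Fin N)
  prog : List (Instr (stateInterface d l) (Fin N))
  out : Fin N

/-- Number of qubits plus number of gates and queries. -/
def Distinguisher.size {d l : ℕ} (D : Distinguisher d l) : ℕ := D.N + D.prog.length

/-- The probability that the distinguisher outputs `1` with the oracle of the family `v`. -/
def Distinguisher.acceptProb {d l : ℕ} (D : Distinguisher d l)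
    (v : (Fin d → Bool) → PureState (Fin l)) : ℝ :=
  measProb (runProg (I := stateInterface d l) (fun _ => stateOracle v) D.prog D.init.mat)
    D.out true

/-- The state family `ψ` can be generated in superposition by quantum circuits of polynomial size:
for every key `k` the circuit maps `|k⟩|x⟩|0⟩|0⟩` to `|x⟩|ψ_{k,x}⟩` tensored with a state `g` of the
key wires and ancillas that does not depend on `x`, that is, with these discarded it performs the
isometry `|x⟩ ↦ |x⟩|ψ_{k,x}⟩`. -/
def EfficientlyGenerated (d l : ℕ → ℕ)
    (ψ : ∀ lam, (Fin lam → Bool) → (Fin (d lam) → Bool) → PureState (Fin (l lam))) : Prop :=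
  ∃ p : Polynomial ℕ, ∀ lam : ℕ, ∃ (a : ℕ)
    (C : List (Gate ((Fin lam ⊕ Fin a) ⊕ (Fin (d lam) ⊕ Fin (l lam))))),
    lam + a + d lam + l lam + C.length ≤ p.eval lam ∧
    ∀ k : Fin lam → Bool, ∃ g : (Fin lam ⊕ Fin a → Bool) → ℂ,
      ∀ (x : Fin (d lam) → Bool) (s : (Fin lam ⊕ Fin a) ⊕ (Fin (d lam) ⊕ Fin (l lam)) → Bool),
        circuitOp C s (Sum.elim (Sum.elim k fun _ => false) (Sum.elim x fun _ => false)) =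
          g (s ∘ Sum.inl) * (if s ∘ Sum.inr ∘ Sum.inl = x then 1 else 0) *
            amp (ψ lam k x) (s ∘ Sum.inr ∘ Sum.inr)

/-- Quantum-accessible pseudorandom function-like states with key length `λ`, input length `d` and
output length `l`. -/
structure IsQAPRFS (d l : ℕ → ℕ)
    (ψ : ∀ lam, (Fin lam → Bool) → (Fin (d lam) → Bool) → PureState (Fin (l lam))) : Prop where
  efficient : EfficientlyGenerated d l ψ
  pseudorandom : ∀ D : ∀ lam, Distinguisher (d lam) (l lam), PolyBounded (fun lam => (D lam).size) →
    ∃ ε : ℕ → ℝ, Negligible ε ∧ ∀ lam,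
      |(∑ k : Fin lam → Bool, (2 ^ lam : ℝ)⁻¹ * (D lam).acceptProb (ψ lam k)) -
        ∫ v, (D lam).acceptProb v
          ∂(MeasureTheory.Measure.pi fun _ : Fin (d lam) → Bool => haarState (Fin (l lam)))|
      ≤ ε lam

/-! ### Public-key encryption with quantum public keys and quantum ciphertexts -/

/-- A single-bit encryption scheme with quantum public keys and quantum ciphertexts, at a fixed
security parameter. The public key is a pure state, determined by the decryption key. (No recycled
public key is output.) -/
structure QPKE where
  DK : Type
  PK : Type
  CT : Type
  fintypeDK : Fintype DK
  fintypePK : Fintype PK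
  decEqPK : DecidableEq PK
  fintypeCT : Fintype CT
  decEqCT : DecidableEq CT
  gen : PMF DK
  qpkGen : DK → PureState PK
  enc : Bool → Channel PK CT
  dec : DK → Channel CT Unit

attribute [instance] QPKE.fintypeDK QPKE.fintypePK QPKE.decEqPK QPKE.fintypeCT QPKE.decEqCT

/-- The oracle `QPKGen(dk)`: returns a fresh copy of the public key. -/
def QPKE.qpkOracle (S : QPKE) (dk : S.DK) : Channel Empty S.PK where
  ι := Unit
  fintypeι := inferInstance
  kraus := fun _ => Matrix.of fun s _ => amp (S.qpkGen dk) s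
  complete := by
    refine kraus_complete fun x x' => ?_
    obtain rfl : x = x' := Subsingleton.elim _ _
    rw [Fintype.sum_unique]
    simpa using sum_amp (S.qpkGen dk)

/-- Measures the register `A`, and encrypts the bit found on its wire `a` under a fresh copy of the
public key. -/
def QPKE.encOracle (S : QPKE) (dk : S.DK) {A : Type} [Fintype A] [DecidableEq A] (a : A) :
    Channel A S.CT where
  ι := (m : A → Bool) × (S.enc (m a)).ι
  fintypeι := inferInstance
  kraus := fun i => Matrix.of fun c m =>
    if m = i.1 then ((S.enc (i.1 a)).kraus i.2).mulVec (amp (S.qpkGen dk)) c else 0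
  complete := by
    refine kraus_complete fun x x' => ?_
    simp only [Matrix.of_apply]
    rw [Fintype.sum_sigma, Finset.sum_eq_single x]
    · by_cases h : x = x'
      · subst h
        have key : ∀ i : (S.enc (x a)).ι,
            ∑ c, star (((S.enc (x a)).kraus i).mulVec (amp (S.qpkGen dk)) c) *
              ((S.enc (x a)).kraus i).mulVec (amp (S.qpkGen dk)) c =
            star (amp (S.qpkGen dk)) ⬝ᵥ
              (((S.enc (x a)).kraus i).conjTranspose * (S.enc (x a)).kraus i).mulVec
                (amp (S.qpkGen dk)) := by
          intro i
          rw [← Matrix.mulVec_mulVec, Matrix.dotProduct_mulVec, ← Matrix.star_mulVec]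
          rfl
        simp only [if_true]
        rw [Finset.sum_congr rfl (fun i _ => key i), ← dotProduct_sum, ← Matrix.sum_mulVec,
          (S.enc (x a)).complete, Matrix.one_mulVec]
        exact sum_amp _
      · simp [h, Ne.symm h]
    · intro m _ hm
      simp [Ne.symm hm]
    · simp

/-- Oracles available before the challenge. -/
inductive Query₁ | qpk | enc | dec

/-- Oracles available after the challenge. -/
inductive Query₂ | qpk | enc

/-- The oracle interface before the challenge. -/
def QPKE.interface₁ (S : QPKE) : Interface where
  Q := Query₁
  inp | .qpk => Empty | .enc => Unit | .dec => S.CT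
  out | .qpk => S.PK | .enc => S.CT | .dec => Unit
  fintypeInp
    | .qpk => inferInstanceAs (Fintype Empty)
    | .enc => inferInstanceAs (Fintype Unit)
    | .dec => inferInstanceAs (Fintype S.CT)
  decEqInp
    | .qpk => inferInstanceAs (DecidableEq Empty)
    | .enc => inferInstanceAs (DecidableEq Unit)
    | .dec => inferInstanceAs (DecidableEq S.CT)
  fintypeOut
    | .qpk => inferInstanceAs (Fintype S.PK)
    | .enc => inferInstanceAs (Fintype S.CT)
    | .dec => inferInstanceAs (Fintype Unit)
  decEqOut
    | .qpk => inferInstanceAs (DecidableEq S.PK)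
    | .enc => inferInstanceAs (DecidableEq S.CT)
    | .dec => inferInstanceAs (DecidableEq Unit)

/-- The oracle interface after the challenge. -/
def QPKE.interface₂ (S : QPKE) : Interface where
  Q := Query₂
  inp | .qpk => Empty | .enc => Unit
  out | .qpk => S.PK | .enc => S.CT
  fintypeInp
    | .qpk => inferInstanceAs (Fintype Empty)
    | .enc => inferInstanceAs (Fintype Unit)
  decEqInp
    | .qpk => inferInstanceAs (DecidableEq Empty)
    | .enc => inferInstanceAs (DecidableEq Unit)
  fintypeOut
    | .qpk => inferInstanceAs (Fintype S.PK)
    | .enc => inferInstanceAs (Fintype S.CT)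
  decEqOut
    | .qpk => inferInstanceAs (DecidableEq S.PK)
    | .enc => inferInstanceAs (DecidableEq S.CT)

/-- The oracles before the challenge: public keys, encryption, decryption. -/
def QPKE.oracles₁ (S : QPKE) (dk : S.DK) :
    ∀ q : S.interface₁.Q, Channel (S.interface₁.inp q) (S.interface₁.out q)
  | .qpk => S.qpkOracle dk
  | .enc => S.encOracle dk (A := Unit) ()
  | .dec => S.dec dk

/-- The oracles after the challenge: public keys, encryption. -/
def QPKE.oracles₂ (S : QPKE) (dk : S.DK) :
    ∀ q : S.interface₂.Q, Channel (S.interface₂.inp q) (S.interface₂.out q)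
  | .qpk => S.qpkOracle dk
  | .enc => S.encOracle dk (A := Unit) ()

/-- An adversary in the IND-CCA1 game. Its memory has `N` qubits and starts in the state `init`
(ancillas and quantum advice); `prog₁` and `prog₂` are run before and after the challenge. The
messages `m₀, m₁` are read off the wires `chal (inl false)` and `chal (inl true)`, the challenge
ciphertext is delivered on the wires `chal (inr _)`, and the guess is read off the wire `out`. -/
structure CCA1Adversary (S : QPKE) where
  N : ℕ
  init : DensityOp (Fin N)
  prog₁ : List (Instr S.interface₁ (Fin N))
  chal : Bool ⊕ S.CT ↪ Fin N
  prog₂ : List (Instr S.interface₂ (Fin N))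
  out : Fin N

/-- Number of qubits plus number of gates and queries. -/
def CCA1Adversary.size {S : QPKE} (A : CCA1Adversary S) : ℕ :=
  A.N + A.prog₁.length + A.prog₂.length

/-- The final state of the adversary in the IND-CCA1 game with decryption key `dk` and challenge
bit `b`. -/
def CCA1Adversary.finalState {S : QPKE} (A : CCA1Adversary S) (dk : S.DK) (b : Bool) :
    Op (Fin A.N) :=
  runProg (S.oracles₂ dk) A.prog₂
    ((S.encOracle dk b).query A.chal
      (runProg (S.oracles₁ dk) A.prog₁ A.init.mat))

/-- The probability that the adversary wins the IND-CCA1 game, that is, guesses `b`. -/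
def CCA1Adversary.winProb {S : QPKE} (A : CCA1Adversary S) : ℝ :=
  ∑ dk : S.DK, (S.gen dk).toReal * ∑ b : Bool, (1 / 2) * measProb (A.finalState dk b) A.out b

/-- IND-CCA1 security of a family of schemes, indexed by the security parameter. -/
def IsINDCCA1 (S : ℕ → QPKE) : Prop :=
  ∀ A : ∀ lam, CCA1Adversary (S lam), PolyBounded (fun lam => (A lam).size) →
    ∃ ε : ℕ → ℝ, Negligible ε ∧ ∀ lam, (A lam).winProb ≤ 1 / 2 + ε lam

/-! ### The construction -/

lemma sum_rows {n l : ℕ} (f : Fin n → (Fin l → Bool) → ℂ) :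
    ∑ s : Fin n × Fin l → Bool, ∏ i, f i (fun j => s (i, j)) = ∏ i, ∑ u, f i u := by
  rw [Finset.prod_univ_sum, Fintype.piFinset_univ]
  exact Fintype.sum_equiv (Equiv.curry (Fin n) (Fin l) Bool) _ _ (fun _ => rfl)

/-- The state `|v⟩^{⊗n}`; the wires of the `i`-th copy are `(i, j)`. -/
def tensorPow {l : ℕ} (n : ℕ) (v : PureState (Fin l)) : PureState (Fin n × Fin l) :=
  mkState (fun s => ∏ i, amp v (fun j => s (i, j))) (by
    simp only [star_prod, ← Finset.prod_mul_distrib]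
    rw [sum_rows (fun _ u => star (amp v u) * amp v u)]
    simp only [sum_amp, Finset.prod_const_one])

/-- The quantum public key `2^{-d/2} ∑ₓ |x⟩|v x⟩^{⊗n}`. -/
def publicKey {d l : ℕ} (n : ℕ) (v : (Fin d → Bool) → PureState (Fin l)) :
    PureState (Fin d ⊕ (Fin n × Fin l)) :=
  mkState (fun s => ((Real.sqrt (2 ^ d))⁻¹ : ℝ) *
      amp (tensorPow n (v (s ∘ Sum.inl))) (s ∘ Sum.inr)) (by
    rw [sum_sumBits (fun x u => star (((Real.sqrt (2 ^ d))⁻¹ : ℝ) * amp (tensorPow n (v x)) u) *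
      (((Real.sqrt (2 ^ d))⁻¹ : ℝ) * amp (tensorPow n (v x)) u))]
    rw [Finset.sum_congr rfl (fun x _ => sum_scaled_amp (tensorPow n (v x)) d)]
    simp)

/-- Encryption of `0`: measure the register `R` (with outcome `x`) and keep the residual state. -/
def encZero (d m : Type) [Fintype d] [DecidableEq d] [Fintype m] [DecidableEq m] :
    Channel (d ⊕ m) (d ⊕ m) where
  ι := d → Bool
  fintypeι := inferInstance
  kraus := fun x => Matrix.diagonal fun s => if s ∘ Sum.inl = x then 1 else 0
  complete := by
    ext s t
    simp only [Matrix.diagonal_conjTranspose, Matrix.diagonal_mul_diagonal, Matrix.sum_apply]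
    by_cases h : s = t
    · subst h; simp
    · simp [h]

/-- Encryption of `1`: measure the register `R` (with outcome `x`), discard the residual state
(summation over `u`), sample a uniformly random key `k` and output `x` with `n` copies of
`|ψ_{k,x}⟩`. -/
def encOne {lam d l : ℕ} (n : ℕ)
    (ψ : (Fin lam → Bool) → (Fin d → Bool) → PureState (Fin l)) :
    Channel (Fin d ⊕ (Fin n × Fin l)) (Fin d ⊕ (Fin n × Fin l)) where
  ι := (Fin lam → Bool) × ((Fin d → Bool) × (Fin n × Fin l → Bool))
  fintypeι := inferInstance
  kraus := fun i => Matrix.of fun s t =>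
    if s ∘ Sum.inl = i.2.1 ∧ t ∘ Sum.inl = i.2.1 ∧ t ∘ Sum.inr = i.2.2 then
      ((Real.sqrt (2 ^ lam))⁻¹ : ℝ) * amp (tensorPow n (ψ i.1 i.2.1)) (s ∘ Sum.inr)
    else 0
  complete := by
    refine kraus_complete fun t t' => ?_
    simp only [Matrix.of_apply]
    have key : ∀ k : Fin lam → Bool, (∑ xu : (Fin d → Bool) × (Fin n × Fin l → Bool),
        ∑ s : Fin d ⊕ (Fin n × Fin l) → Bool,
        star (if s ∘ Sum.inl = xu.1 ∧ t ∘ Sum.inl = xu.1 ∧ t ∘ Sum.inr = xu.2 then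
          (((Real.sqrt (2 ^ lam))⁻¹ : ℝ) : ℂ) * amp (tensorPow n (ψ k xu.1)) (s ∘ Sum.inr)
          else 0) *
        (if s ∘ Sum.inl = xu.1 ∧ t' ∘ Sum.inl = xu.1 ∧ t' ∘ Sum.inr = xu.2 then
          (((Real.sqrt (2 ^ lam))⁻¹ : ℝ) : ℂ) * amp (tensorPow n (ψ k xu.1)) (s ∘ Sum.inr)
          else 0)) = if t = t' then (((2 ^ lam : ℝ)⁻¹ : ℝ) : ℂ) else 0 := by
      intro k
      rw [Finset.sum_eq_single (t ∘ Sum.inl, t ∘ Sum.inr)]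
      · by_cases h : t = t'
        · subst h
          simp only [and_true, if_true]
          rw [sum_sumBits (fun a b => star (if a = t ∘ Sum.inl then
            (((Real.sqrt (2 ^ lam))⁻¹ : ℝ) : ℂ) * amp (tensorPow n (ψ k (t ∘ Sum.inl))) b else 0) *
            (if a = t ∘ Sum.inl then
            (((Real.sqrt (2 ^ lam))⁻¹ : ℝ) : ℂ) * amp (tensorPow n (ψ k (t ∘ Sum.inl))) b
            else 0)), Finset.sum_eq_single (t ∘ Sum.inl)]
          · simp only [if_true]
            exact sum_scaled_amp _ _
          · intro a _ ha; simp [ha]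
          · simp
        · have h' : ¬ (t' ∘ Sum.inl = t ∘ Sum.inl ∧ t' ∘ Sum.inr = t ∘ Sum.inr) :=
            fun hh => h (sumBits_ext.2 ⟨hh.1.symm, hh.2.symm⟩)
          simp [h, h']
      · rintro ⟨x, u⟩ _ hxu
        have h' : ¬ (t ∘ Sum.inl = x ∧ t ∘ Sum.inr = u) := by
          rintro ⟨rfl, rfl⟩; exact hxu rfl
        simp [h']
      · simp
    rw [Fintype.sum_prod_type, Finset.sum_congr rfl (fun k _ => key k)]
    by_cases h : t = t'
    · simp [h]
    · simp [h]

/-! The SWAP test. -/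

/-- The projector `(1 + SWAP) / 2` on two systems with basis `L`: outcome `0` of the SWAP test. -/
def swapTestZero (L : Type) [DecidableEq L] : Matrix (L × L) (L × L) ℂ :=
  (1 / 2 : ℂ) • (1 + Matrix.of fun p q => if p = q.swap then 1 else 0)

/-- The projector for the event that `n` SWAP tests, the `i`-th one between the `i`-th subsystems
of two registers of `n` systems of `l` qubits, all have outcome `0`: the `n`-fold tensor product of
`swapTestZero`. -/
def allSwapTestsZero (n l : ℕ) :
    Matrix ((Fin n × Fin l → Bool) × (Fin n × Fin l → Bool))
      ((Fin n × Fin l → Bool) × (Fin n × Fin l → Bool)) ℂ :=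
  Matrix.of fun p q => ∏ i, swapTestZero (Fin l → Bool)
    (fun j => p.1 (i, j), fun j => p.2 (i, j)) (fun j => q.1 (i, j), fun j => q.2 (i, j))

/-- The measurement "did all SWAP tests give `0`": outcome `false` if all did, `true` if not. -/
def swapTestsMeas (n l : ℕ) (b : Bool) :
    Matrix ((Fin n × Fin l → Bool) × (Fin n × Fin l → Bool))
      ((Fin n × Fin l → Bool) × (Fin n × Fin l → Bool)) ℂ :=
  if b then 1 - allSwapTestsZero n l else allSwapTestsZero n l

lemma swapTestZero_herm (L : Type) [DecidableEq L] (p q : L × L) :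
    star (swapTestZero L p q) = swapTestZero L q p := by
  have h1 : (p = q.swap) ↔ (q = p.swap) := by
    constructor <;> (rintro rfl; simp)
  simp only [swapTestZero, Matrix.smul_apply, Matrix.add_apply, Matrix.of_apply, Matrix.one_apply,
    smul_eq_mul, h1, eq_comm (a := p) (b := q)]
  split_ifs <;> simp

lemma swapTestZero_idem (L : Type) [DecidableEq L] [Fintype L] :
    swapTestZero L * swapTestZero L = swapTestZero L := by
  have h : (Matrix.of fun p q : L × L => if p = q.swap then (1 : ℂ) else 0) *
      (Matrix.of fun p q : L × L => if p = q.swap then (1 : ℂ) else 0) = 1 := by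
    ext p q
    simp [Matrix.mul_apply, Matrix.one_apply]
  simp only [swapTestZero, Matrix.smul_mul, Matrix.mul_smul, mul_add, add_mul, mul_one, one_mul, h]
  ext p q
  simp only [Matrix.smul_apply, Matrix.add_apply, smul_eq_mul]
  ring

lemma swapTestsMeas_complete (n l : ℕ) :
    ∑ b, (swapTestsMeas n l b).conjTranspose * swapTestsMeas n l b = 1 := by
  have h1 : (allSwapTestsZero n l).conjTranspose = allSwapTestsZero n l := by
    ext p q
    simp only [Matrix.conjTranspose_apply, allSwapTestsZero, Matrix.of_apply, star_prod,
      swapTestZero_herm]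
  have h2 : allSwapTestsZero n l * allSwapTestsZero n l = allSwapTestsZero n l := by
    ext p q
    simp only [Matrix.mul_apply, allSwapTestsZero, Matrix.of_apply, ← Finset.prod_mul_distrib]
    have hT := swapTestZero_idem (Fin l → Bool)
    calc _ = ∑ r : Fin n → (Fin l → Bool) × (Fin l → Bool), ∏ i,
          swapTestZero (Fin l → Bool) (fun j => p.1 (i, j), fun j => p.2 (i, j)) (r i) *
          swapTestZero (Fin l → Bool) (r i) (fun j => q.1 (i, j), fun j => q.2 (i, j)) := by
          refine Fintype.sum_equiv
            (((Equiv.curry (Fin n) (Fin l) Bool).prodCongr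
              (Equiv.curry (Fin n) (Fin l) Bool)).trans (Equiv.arrowProdEquivProdArrow _ _ _).symm)
            _ _ (fun _ => rfl)
      _ = ∏ i, ∑ r, swapTestZero (Fin l → Bool) (fun j => p.1 (i, j), fun j => p.2 (i, j)) r *
          swapTestZero (Fin l → Bool) r (fun j => q.1 (i, j), fun j => q.2 (i, j)) := by
          rw [Finset.prod_univ_sum, Fintype.piFinset_univ]
      _ = _ := by
          refine Finset.prod_congr rfl fun i _ => ?_
          rw [← Matrix.mul_apply, hT]
  simp only [Fintype.sum_bool, swapTestsMeas, if_true, Bool.false_eq_true, if_false,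
    Matrix.conjTranspose_sub, Matrix.conjTranspose_one, h1, mul_sub, sub_mul, mul_one, one_mul, h2]
  abel

/-- Decryption: on input `(x, Ψ)` compute `|v x⟩^{⊗n}`, perform `n` SWAP tests between the
subsystems of `Ψ` and the copies of `|v x⟩`, and output `0` if all outcomes are `0`, otherwise `1`.
Here `b` is the output, and `x` and the registers after the tests (summation over `r`) are
discarded. -/
def decChannel {d l : ℕ} (n : ℕ) (v : (Fin d → Bool) → PureState (Fin l)) :
    Channel (Fin d ⊕ (Fin n × Fin l)) Unit where
  ι := Bool × ((Fin d → Bool) × ((Fin n × Fin l → Bool) × (Fin n × Fin l → Bool)))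
  fintypeι := inferInstance
  kraus := fun i => Matrix.of fun c t =>
    if c () = i.1 ∧ t ∘ Sum.inl = i.2.1 then
      ∑ w, swapTestsMeas n l i.1 i.2.2 (t ∘ Sum.inr, w) * amp (tensorPow n (v i.2.1)) w
    else 0
  complete := by
    refine kraus_complete fun t t' => ?_
    simp only [Matrix.of_apply]
    let J : (Fin d → Bool) → Matrix ((Fin n × Fin l → Bool) × (Fin n × Fin l → Bool))
        (Fin n × Fin l → Bool) ℂ :=
      fun x => Matrix.of fun p u => if p.1 = u then amp (tensorPow n (v x)) p.2 else 0
    have hJ : ∀ x, (J x).conjTranspose * J x = 1 := by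
      intro x
      ext u u'
      simp only [Matrix.mul_apply, Matrix.conjTranspose_apply, J, Matrix.of_apply, Matrix.one_apply]
      rw [Fintype.sum_prod_type, Finset.sum_eq_single u]
      · by_cases h : u = u'
        · simpa [h] using sum_amp (tensorPow n (v x))
        · simp [h]
      · intro a _ ha; simp [ha]
      · simp
    have hM : ∀ x b r u, ∑ w, swapTestsMeas n l b r (u, w) * amp (tensorPow n (v x)) w =
        (swapTestsMeas n l b * J x) r u := by
      intro x b r u
      simp only [Matrix.mul_apply, J, Matrix.of_apply]
      rw [Fintype.sum_prod_type]
      symm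
      rw [Finset.sum_eq_single u]
      · simp
      · intro a _ ha; simp [ha]
      · simp
    simp only [hM]
    have hsum : ∀ x, ∑ b, (swapTestsMeas n l b * J x).conjTranspose * (swapTestsMeas n l b * J x)
        = 1 := by
      intro x
      have : ∀ b, (swapTestsMeas n l b * J x).conjTranspose * (swapTestsMeas n l b * J x) =
          (J x).conjTranspose * ((swapTestsMeas n l b).conjTranspose * swapTestsMeas n l b) *
            J x := by
        intro b; simp only [Matrix.conjTranspose_mul, Matrix.mul_assoc]
      rw [Finset.sum_congr rfl (fun b _ => this b), ← Matrix.sum_mul, ← Matrix.mul_sum,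
        swapTestsMeas_complete, Matrix.mul_one, hJ]
    have key : ∀ b, (∑ xr : (Fin d → Bool) × ((Fin n × Fin l → Bool) × (Fin n × Fin l → Bool)),
        ∑ c : Unit → Bool,
        star (if c () = b ∧ t ∘ Sum.inl = xr.1 then
          (swapTestsMeas n l b * J xr.1) xr.2 (t ∘ Sum.inr) else 0) *
        (if c () = b ∧ t' ∘ Sum.inl = xr.1 then
          (swapTestsMeas n l b * J xr.1) xr.2 (t' ∘ Sum.inr) else 0)) =
        if t ∘ Sum.inl = t' ∘ Sum.inl then
          ((swapTestsMeas n l b * J (t ∘ Sum.inl)).conjTranspose *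
            (swapTestsMeas n l b * J (t ∘ Sum.inl))) (t ∘ Sum.inr) (t' ∘ Sum.inr) else 0 := by
      intro b
      rw [Fintype.sum_prod_type, Finset.sum_eq_single (t ∘ Sum.inl)]
      · by_cases h : t ∘ Sum.inl = t' ∘ Sum.inl
        · rw [if_pos h, Matrix.mul_apply]
          refine Finset.sum_congr rfl fun r _ => ?_
          rw [Finset.sum_eq_single (fun _ => b)]
          · simp only [← h, and_true, if_true, Matrix.conjTranspose_apply]
          · intro c _ hc
            have : c () ≠ b := fun hcb => hc (funext fun _ => hcb)
            simp [this]
          · simp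
        · simp [h, Ne.symm h]
      · intro x _ hx; simp [Ne.symm hx]
      · simp
    rw [Fintype.sum_prod_type, Finset.sum_congr rfl (fun b _ => key b)]
    by_cases h : t ∘ Sum.inl = t' ∘ Sum.inl
    · simp only [h, if_true]
      rw [← Matrix.sum_apply, hsum, Matrix.one_apply]
      simp only [sumBits_ext, h, true_and]
    · have h' : t ≠ t' := fun hh => h (by rw [hh])
      simp [h, h']

/-- The scheme built from a state family `ψ` with `n` copies, at security parameter `lam`. -/
def prfsScheme {lam d l : ℕ} (n : ℕ)
    (ψ : (Fin lam → Bool) → (Fin d → Bool) → PureState (Fin l)) : QPKE where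
  DK := Fin lam → Bool
  PK := Fin d ⊕ (Fin n × Fin l)
  CT := Fin d ⊕ (Fin n × Fin l)
  fintypeDK := inferInstance
  fintypePK := inferInstance
  decEqPK := inferInstance
  fintypeCT := inferInstance
  decEqCT := inferInstance
  gen := PMF.uniformOfFintype (Fin lam → Bool)
  qpkGen := fun dk => publicKey n (ψ dk)
  enc := fun m => if m then encOne n ψ else encZero (Fin d) (Fin n × Fin l)
  dec := fun dk => decChannel n (ψ dk)

end QCrypto

end

set_option linter.unusedSectionVars false

/-! Either message is encrypted to a uniform `x` followed by `n` copies of a state indexed by `x`.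
For `0` this state belongs to the decryption key, for `1` to an independent random key. For a
challenge bit `b`, consider the probability that the adversary outputs 1 when all oracles are run
with a state family `v` and the challenge is described by functionals `χ₀`, `χ₁` for the messages 0
and 1 (`CCA1Adversary.value`). The winning probability exceeds 1/2 by half the difference of this
quantity for `b = 1` and `b = 0` (`CCA1Adversary.winProb_eq`). Three replacements remove the
dependence on `b`.

Key to Haar. The whole game is a polynomial-size circuit with access to the state oracle: public
keys, ciphertexts of 0 and SWAP tests all come from copies of `|v x⟩`. The mixture of ciphertexts of
1 does not depend on the decryption key and is supplied as advice. Hence pseudorandomness replaces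
the family of the decryption key by a Haar family `v` (`CCA1Adversary.exists_distinguisher_key`).

Challenge for 1 to Haar. Pseudorandomness is used again, to replace the random key inside the
challenge by an independent Haar family `w`. The other oracles now belong to `v`, which has no
efficient description, so one good `v` is fixed and hard-wired. The memory after the first phase,
decryption queries included, becomes quantum advice. The answers in the second phase are built from
fixed states, supplied as further advice (`Sim.oracles₂_const`). A decryption query after the
challenge would not be of this kind; this is where CCA1 rather than CCA2 enters
(`CCA1Adversary.exists_distinguisher_avgCt`).

Challenge for 0 from `v` to `w`. This step is statistical. Exchanging `v x` and `w x` preserves the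
product measure, so it suffices to bound, on average over the challenge point `x`, the effect of
altering the oracles' family at `x` alone (`CCA1Adversary.abs_integral_value_sub_le`). A public key
contains `x` with amplitude `2^(-d/2)`, and an encryption with probability `2^(-d)`. A decryption
query can be aimed at a particular `x`, but it is block diagonal in `x`, so its effects summed over
all `x` are at most 1 (`sum_localQuery_dec_sub_le`); and before the challenge the queries cannot
depend on `x`. The total loss is at most `9 * 2^(-d/2)` per step, negligible because `d` is
superlogarithmic.

At the end both messages have the same challenge distribution, so `b` is hidden
(`CCA1Adversary.value_eq_of_same`).

The game is treated in the Heisenberg picture: channels act on observables, which turns reductions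
into identities between linear maps (`Sim`) and statistical comparisons into inequalities between
positive functionals (`sum_progDual_sub_le`). -/

noncomputable section

namespace QCrypto

open scoped Matrix

/-! ### Circuits and queries as linear maps of observables. -/

section Heisenberg

variable {V W A B C R : Type} [Fintype V] [DecidableEq V] [Fintype W] [DecidableEq W]
  [Fintype A] [DecidableEq A] [Fintype B] [DecidableEq B] [Fintype C] [DecidableEq C]
  [Fintype R] [DecidableEq R]

/-! ### The Heisenberg picture -/

/-- The map `M ↦ Kᴴ M K`. -/
def conjBy {α β : Type} [Fintype α] [Fintype β] (K : Matrix β α ℂ) :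
    Matrix β β ℂ →ₗ[ℂ] Matrix α α ℂ where
  toFun M := Kᴴ * M * K
  map_add' M N := by rw [Matrix.mul_add, Matrix.add_mul]
  map_smul' c M := by rw [Matrix.mul_smul, Matrix.smul_mul, RingHom.id_apply]

lemma conjBy_apply {α β : Type} [Fintype α] [Fintype β] (K : Matrix β α ℂ) (M : Matrix β β ℂ) :
    conjBy K M = Kᴴ * M * K := rfl

lemma conjBy_entry {α β : Type} [Fintype α] [Fintype β] (K : Matrix β α ℂ) (M : Matrix β β ℂ)
    (s t : α) : conjBy K M s t = ∑ a, ∑ b, star (K a s) * M a b * K b t := by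
  simp only [conjBy_apply, Matrix.mul_apply, Matrix.conjTranspose_apply, Finset.sum_mul]
  exact Finset.sum_comm

lemma extend_comp_self (f : V ↪ W) (a : V → Bool) (s : W → Bool) :
    Function.extend f a s ∘ f = a := funext fun x => f.injective.extend_apply a s x

lemma extend_self (f : V ↪ W) (s : W → Bool) : Function.extend f (s ∘ f) s = s := by
  funext w
  by_cases h : ∃ x, f x = w
  · obtain ⟨x, rfl⟩ := h
    exact f.injective.extend_apply _ _ x
  · exact Function.extend_apply' _ _ _ h

lemma extend_extend (f : V ↪ W) (a b : V → Bool) (s : W → Bool) :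
    Function.extend f b (Function.extend f a s) = Function.extend f b s := by
  funext w
  by_cases h : ∃ x, f x = w
  · obtain ⟨x, rfl⟩ := h
    rw [f.injective.extend_apply, f.injective.extend_apply]
  · rw [Function.extend_apply' _ _ _ h, Function.extend_apply' _ _ _ h,
      Function.extend_apply' _ _ _ h]

open Classical in
lemma liftOp_apply (f : V ↪ W) (M : Op V) (s t : W → Bool) :
    liftOp f M s t = if ∀ w, w ∉ Set.range f → s w = t w then M (s ∘ f) (t ∘ f) else 0 := by
  simp only [liftOp, Matrix.of_apply]
  congr

-- The strings that agree with `s` off the range of `f` are exactly the extensions of strings on `f`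
-- by `s`, so the sum can be reindexed.
open Classical in
lemma sum_agree (f : V ↪ W) (s : W → Bool) (F : (W → Bool) → ℂ) :
    ∑ s', (if ∀ w, w ∉ Set.range f → s' w = s w then F s' else 0) =
      ∑ a, F (Function.extend f a s) := by
  symm
  refine Fintype.sum_of_injective (fun a => Function.extend f a s) ?_ _ _ ?_ ?_
  · intro a b h
    have := congrArg (fun z => z ∘ f) h
    simpa only [extend_comp_self] using this
  · intro s' hs'
    rw [if_neg]
    intro h
    refine hs' ⟨s' ∘ f, ?_⟩
    funext w
    by_cases hw : ∃ x, f x = w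
    · obtain ⟨x, rfl⟩ := hw
      exact f.injective.extend_apply _ _ x
    · exact (Function.extend_apply' _ _ _ hw).trans (h w hw).symm
  · intro a
    rw [if_pos]
    intro w hw
    exact Function.extend_apply' _ _ _ hw

/-- A map of observables of `V`, acting on the wires of `W` selected by `f`. -/
def loc (f : V ↪ W) (T : Op V →ₗ[ℂ] Op V) : Op W →ₗ[ℂ] Op W where
  toFun Y := Matrix.of fun s t =>
    T (Y.submatrix (fun a => Function.extend f a s) (fun a => Function.extend f a t)) (s ∘ f) (t ∘ f)
  map_add' X Y := by
    ext s t
    simp only [Matrix.of_apply, Matrix.add_apply]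
    rw [← Matrix.add_apply, ← map_add]; rfl
  map_smul' c X := by
    ext s t
    simp only [Matrix.of_apply, Matrix.smul_apply, RingHom.id_apply]
    rw [← Matrix.smul_apply, ← map_smul]; rfl

lemma loc_apply (f : V ↪ W) (T : Op V →ₗ[ℂ] Op V) (Y : Op W) (s t : W → Bool) :
    loc f T Y s t = T (Y.submatrix (fun a => Function.extend f a s)
      (fun a => Function.extend f a t)) (s ∘ f) (t ∘ f) := rfl

/-- A lifted operator is diagonal in the outer wires. The outer bits of the two indices therefore
stay fixed, and only one block of the observable enters. -/
lemma conjBy_liftOp (f : V ↪ W) (K : Op V) : conjBy (liftOp f K) = loc f (conjBy K) := by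
  classical
  ext1 Y
  ext s t
  rw [loc_apply, conjBy_entry, conjBy_entry]
  simp only [liftOp_apply, Matrix.submatrix_apply]
  have h1 : ∀ s', ∑ t', star (if ∀ w, w ∉ Set.range f → s' w = s w then K (s' ∘ f) (s ∘ f) else 0) *
      Y s' t' * (if ∀ w, w ∉ Set.range f → t' w = t w then K (t' ∘ f) (t ∘ f) else 0) =
      if ∀ w, w ∉ Set.range f → s' w = s w then
        ∑ t', (if ∀ w, w ∉ Set.range f → t' w = t w then
          star (K (s' ∘ f) (s ∘ f)) * Y s' t' * K (t' ∘ f) (t ∘ f) else 0) else 0 := by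
    intro s'
    split_ifs with h
    · exact Finset.sum_congr rfl fun t' _ => by split_ifs <;> simp
    · simp
  rw [Finset.sum_congr rfl fun s' _ => h1 s', sum_agree]
  refine Finset.sum_congr rfl fun a _ => ?_
  rw [sum_agree]
  simp only [extend_comp_self]

lemma loc_comp (f : V ↪ W) (T T' : Op V →ₗ[ℂ] Op V) (Y : Op W) :
    loc f T (loc f T' Y) = loc f (T ∘ₗ T') Y := by
  ext s t
  rw [loc_apply, loc_apply, LinearMap.comp_apply]
  have h : (loc f T' Y).submatrix (fun a => Function.extend f a s)
      (fun a => Function.extend f a t) = T' (Y.submatrix (fun a => Function.extend f a s)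
      (fun a => Function.extend f a t)) := by
    ext a b
    simp only [Matrix.submatrix_apply, loc_apply, extend_comp_self, extend_extend]
  rw [h]

lemma loc_id (f : V ↪ W) (Y : Op W) : loc f LinearMap.id Y = Y := by
  ext s t
  simp only [loc_apply, LinearMap.id_apply, Matrix.submatrix_apply, extend_self]

lemma loc_sum {ι : Type} (f : V ↪ W) (S : Finset ι) (T : ι → Op V →ₗ[ℂ] Op V) :
    loc f (∑ i ∈ S, T i) = ∑ i ∈ S, loc f (T i) := by
  ext1 Y
  ext s t
  simp only [loc_apply, LinearMap.sum_apply, Matrix.sum_apply]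

lemma liftOp_trans (e : V ↪ W) (f : W ↪ R) (M : Op V) :
    liftOp f (liftOp e M) = liftOp (e.trans f) M := by
  classical
  ext s t
  simp only [liftOp_apply]
  by_cases h : ∀ w, w ∉ Set.range (e.trans f) → s w = t w
  · rw [if_pos h, if_pos, if_pos]
    · rfl
    · intro w hw
      refine h (f w) ?_
      rintro ⟨x, hx⟩
      exact hw ⟨x, f.injective hx⟩
    · intro w hw
      refine h w ?_
      rintro ⟨x, hx⟩
      exact hw ⟨e x, hx⟩
  · rw [if_neg h]
    split_ifs with h1 h2
    · exfalso
      refine h fun w hw => ?_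
      by_cases hf : w ∈ Set.range f
      · obtain ⟨x, rfl⟩ := hf
        refine h2 x ?_
        rintro ⟨y, rfl⟩
        exact hw ⟨y, rfl⟩
      · exact h1 w hf
    · rfl
    · rfl

lemma liftOp_refl (M : Op V) : liftOp (Function.Embedding.refl V) M = M := by
  classical
  ext s t
  rw [liftOp_apply, if_pos]
  · rfl
  · intro w hw; exact absurd ⟨w, rfl⟩ hw

/-- `liftOp` as a linear map. -/
def liftOpL (f : V ↪ W) : Op V →ₗ[ℂ] Op W where
  toFun := liftOp f
  map_add' M N := by
    classical
    ext s t
    simp only [liftOp_apply, Matrix.add_apply]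
    split_ifs <;> simp
  map_smul' c M := by
    classical
    ext s t
    simp only [liftOp_apply, Matrix.smul_apply, RingHom.id_apply]
    split_ifs <;> simp

lemma liftOpL_apply (f : V ↪ W) (M : Op V) : liftOpL f M = liftOp f M := rfl

lemma loc_liftOp (f : V ↪ W) (T : Op V →ₗ[ℂ] Op V) (M : Op V) :
    loc f T (liftOp f M) = liftOp f (T M) := by
  classical
  ext s t
  rw [loc_apply, liftOp_apply]
  have key : (liftOp f M).submatrix (fun a => Function.extend f a s)
      (fun a => Function.extend f a t) =
      if ∀ w, w ∉ Set.range f → s w = t w then M else 0 := by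
    ext a b
    rw [Matrix.submatrix_apply, liftOp_apply]
    simp only [extend_comp_self]
    have : (∀ w, w ∉ Set.range f → Function.extend f a s w = Function.extend f b t w) ↔
        ∀ w, w ∉ Set.range f → s w = t w := by
      refine forall_congr' fun w => imp_congr_right fun hw => ?_
      rw [Function.extend_apply' _ _ _ hw, Function.extend_apply' _ _ _ hw]
    simp only [this]
    split_ifs <;> rfl
  rw [key]
  split_ifs
  · rfl
  · simp

/-- The adjoint of a channel, a map of observables. -/
def Channel.dual (Φ : Channel A B) : Op B →ₗ[ℂ] Op A := ∑ i, conjBy (Φ.kraus i)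

lemma Channel.dual_apply (Φ : Channel A B) (M : Op B) :
    Φ.dual M = ∑ i, (Φ.kraus i)ᴴ * M * Φ.kraus i := by
  simp only [Channel.dual, LinearMap.sum_apply, conjBy_apply]

lemma Channel.dual_one (Φ : Channel A B) : Φ.dual 1 = 1 := by
  simp only [Channel.dual_apply, Matrix.mul_one, Φ.complete]

/-- The Kraus operator of a query associated with a Kraus operator `K` of the queried channel. -/
def qKraus (K : Matrix (B → Bool) (A → Bool) ℂ) (b : B → Bool) : Op (A ⊕ B) :=
  Matrix.of fun s t => if (∀ a, s (Sum.inl a) = false) ∧ t ∘ Sum.inr = b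
    then K (s ∘ Sum.inr) (t ∘ Sum.inl) else 0

/-- The map of observables performed by a query on the wires `e` to a channel with adjoint `T`. -/
def localQuery (e : A ⊕ B ↪ W) (T : Op B →ₗ[ℂ] Op A) : Op W →ₗ[ℂ] Op W where
  -- The old content of the output wires is traced out, which gives the equality test on them; the
  -- input wires are left in the state 0, which gives the constant `false`.
  toFun Y := Matrix.of fun s t => if s ∘ e ∘ Sum.inr = t ∘ e ∘ Sum.inr then
    T (Y.submatrix (fun c => Function.extend e (Sum.elim (fun _ => false) c) s)
      (fun c => Function.extend e (Sum.elim (fun _ => false) c) t))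
      (s ∘ e ∘ Sum.inl) (t ∘ e ∘ Sum.inl) else 0
  map_add' X Y := by
    ext s t
    simp only [Matrix.of_apply, Matrix.add_apply]
    split_ifs
    · rw [← Matrix.add_apply, ← map_add]; rfl
    · simp
  map_smul' c X := by
    ext s t
    simp only [Matrix.of_apply, Matrix.smul_apply, RingHom.id_apply]
    split_ifs
    · rw [← Matrix.smul_apply, ← map_smul]; rfl
    · simp

lemma localQuery_apply (e : A ⊕ B ↪ W) (T : Op B →ₗ[ℂ] Op A) (Y : Op W) (s t : W → Bool) :
    localQuery e T Y s t = if s ∘ e ∘ Sum.inr = t ∘ e ∘ Sum.inr then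
    T (Y.submatrix (fun c => Function.extend e (Sum.elim (fun _ => false) c) s)
      (fun c => Function.extend e (Sum.elim (fun _ => false) c) t))
      (s ∘ e ∘ Sum.inl) (t ∘ e ∘ Sum.inl) else 0 := rfl

lemma localQuery_sum {ι : Type} (e : A ⊕ B ↪ W) (S : Finset ι) (T : ι → Op B →ₗ[ℂ] Op A) :
    localQuery e (∑ i ∈ S, T i) = ∑ i ∈ S, localQuery e (T i) := by
  ext1 Y
  ext s t
  simp only [localQuery_apply, LinearMap.sum_apply, Matrix.sum_apply]
  split_ifs <;> simp

lemma localQuery_add (e : A ⊕ B ↪ W) (T T' : Op B →ₗ[ℂ] Op A) :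
    localQuery e (T + T') = localQuery e T + localQuery e T' := by
  ext1 Y
  ext s t
  simp only [localQuery_apply, LinearMap.add_apply, Matrix.add_apply]
  split_ifs <;> simp

lemma localQuery_smul (e : A ⊕ B ↪ W) (c : ℂ) (T : Op B →ₗ[ℂ] Op A) :
    localQuery e (c • T) = c • localQuery e T := by
  ext1 Y
  ext s t
  simp only [localQuery_apply, LinearMap.smul_apply, Matrix.smul_apply]
  split_ifs <;> simp

lemma localQuery_comp_loc (e : A ⊕ B ↪ W) (f : W ↪ R) (T : Op B →ₗ[ℂ] Op A) :
    localQuery (e.trans f) T = loc f (localQuery e T) := by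
  ext1 Y
  ext s t
  rw [localQuery_apply, loc_apply, localQuery_apply]
  have key : ∀ (s : R → Bool) (c : A ⊕ B → Bool),
      Function.extend f (Function.extend e c (s ∘ f)) s = Function.extend (e.trans f) c s := by
    intro s c
    funext w
    by_cases hw : ∃ x, f x = w
    · obtain ⟨x, rfl⟩ := hw
      rw [f.injective.extend_apply]
      by_cases hx : ∃ y, e y = x
      · obtain ⟨y, rfl⟩ := hx
        rw [e.injective.extend_apply]
        exact ((e.trans f).injective.extend_apply c s y).symm
      · rw [Function.extend_apply' _ _ _ hx, Function.extend_apply']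
        · rfl
        · rintro ⟨y, hy⟩; exact hx ⟨y, f.injective hy⟩
    · rw [Function.extend_apply' _ _ _ hw, Function.extend_apply']
      rintro ⟨y, hy⟩; exact hw ⟨e y, hy⟩
  simp only [Matrix.submatrix_submatrix]
  have h2 : ∀ s : R → Bool, (fun a => Function.extend f a s) ∘
      (fun c : B → Bool => Function.extend e (Sum.elim (fun _ => false) c) (s ∘ f)) =
      fun c => Function.extend (e.trans f) (Sum.elim (fun _ => false) c) s :=
    fun s => funext fun c => key s _
  rw [h2, h2]
  rfl

lemma sumElim_comp {X : Type} (s : A ⊕ B → X) : Sum.elim (s ∘ Sum.inl) (s ∘ Sum.inr) = s :=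
  Sum.elim_comp_inl_inr s

/-- Summing over `b`, the discarded content of the output register, turns the Kraus form of a query
into the closed form `localQuery`. -/
lemma sum_conjBy_qKraus (e : A ⊕ B ↪ W) (K : Matrix (B → Bool) (A → Bool) ℂ) :
    ∑ b, conjBy (liftOp e (qKraus K b)) = localQuery e (conjBy K) := by
  simp only [conjBy_liftOp]
  rw [← loc_sum]
  -- It is enough to treat a memory consisting of the two queried registers only; the general
  -- embedding follows by localisation.
  have h0 : (∑ b, conjBy (qKraus K b)) = localQuery (Function.Embedding.refl _) (conjBy K) := by
    ext1 N
    ext s t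
    rw [LinearMap.sum_apply, Matrix.sum_apply, localQuery_apply]
    have hext : ∀ (s : A ⊕ B → Bool) c, Function.extend (Function.Embedding.refl (A ⊕ B)) c s = c := by
      intro s c
      funext w
      exact (Function.Embedding.refl (A ⊕ B)).injective.extend_apply c s w
    simp only [hext]
    have hterm : ∀ b, conjBy (qKraus K b) N s t =
        if s ∘ Sum.inr = b ∧ t ∘ Sum.inr = b then
          ∑ c, ∑ c', star (K c (s ∘ Sum.inl)) * N (Sum.elim (fun _ => false) c)
            (Sum.elim (fun _ => false) c') * K c' (t ∘ Sum.inl) else 0 := by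
      intro b
      rw [conjBy_entry]
      have inner : ∀ (F : (A → Bool) → (B → Bool) → ℂ),
          ∑ a : A ⊕ B → Bool, F (a ∘ Sum.inl) (a ∘ Sum.inr) = ∑ x, ∑ y, F x y :=
        fun F => sum_sumBits F
      have h1 := inner (fun x y => ∑ a', star (qKraus K b (Sum.elim x y) s) *
        N (Sum.elim x y) a' * qKraus K b a' t)
      simp only [sumElim_comp] at h1
      rw [h1, Finset.sum_eq_single (fun _ => false)]
      · have h2 : ∀ c, ∑ a', star (qKraus K b (Sum.elim (fun _ => false) c) s) *
            N (Sum.elim (fun _ => false) c) a' * qKraus K b a' t =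
            if s ∘ Sum.inr = b ∧ t ∘ Sum.inr = b then
            ∑ c', star (K c (s ∘ Sum.inl)) * N (Sum.elim (fun _ => false) c)
            (Sum.elim (fun _ => false) c') * K c' (t ∘ Sum.inl) else 0 := by
          intro c
          have h3 := inner (fun x y => star (qKraus K b (Sum.elim (fun _ => false) c) s) *
            N (Sum.elim (fun _ => false) c) (Sum.elim x y) * qKraus K b (Sum.elim x y) t)
          simp only [sumElim_comp] at h3
          rw [h3, Finset.sum_eq_single (fun _ => false)]
          · by_cases hs : s ∘ Sum.inr = b <;> by_cases ht : t ∘ Sum.inr = b <;>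
              simp [qKraus, hs, ht]
          · intro x _ hx
            have : ¬ ∀ a, x a = false := fun h => hx (funext h)
            simp [qKraus, this]
          · simp
        rw [Finset.sum_congr rfl fun c _ => h2 c]
        split_ifs <;> simp
      · intro x _ hx
        have : ¬ ∀ a, x a = false := fun h => hx (funext h)
        simp [qKraus, this]
      · simp
    rw [Finset.sum_congr rfl fun b _ => hterm b, Finset.sum_eq_single (s ∘ Sum.inr)]
    · simp only [true_and]
      by_cases h : s ∘ Sum.inr = t ∘ Sum.inr
      · rw [if_pos h.symm]
        refine Eq.trans ?_ (if_pos h).symm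
        exact (conjBy_entry _ _ _ _).symm
      · rw [if_neg (Ne.symm h)]
        exact (if_neg h).symm
    · intro b _ hb
      rw [if_neg]
      exact fun h => hb h.1.symm
    · simp
  rw [h0, ← localQuery_comp_loc]
  rfl

lemma queryKraus_eq (Φ : Channel A B) (i : Φ.ι) (b : B → Bool) :
    Φ.queryKraus i b = qKraus (Φ.kraus i) b := rfl

/-- The adjoint of one step of an oracle circuit. -/
def Instr.dual {I : Interface} (O : ∀ q, Channel (I.inp q) (I.out q)) :
    Instr I W → Op W →ₗ[ℂ] Op W
  | .gate g => conjBy g.op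
  | .query q e => localQuery e (O q).dual

/-- The adjoint of an oracle circuit. -/
def progDual {I : Interface} (O : ∀ q, Channel (I.inp q) (I.out q)) :
    List (Instr I W) → Op W →ₗ[ℂ] Op W
  | [] => LinearMap.id
  | c :: P => c.dual O ∘ₗ progDual O P

lemma progDual_append {I : Interface} (O : ∀ q, Channel (I.inp q) (I.out q))
    (P Q : List (Instr I W)) : progDual O (P ++ Q) = progDual O P ∘ₗ progDual O Q := by
  induction P with
  | nil => rfl
  | cons c P ih => simp only [List.cons_append, progDual, ih, LinearMap.comp_assoc]

lemma trace_conj_mul {α β : Type} [Fintype α] [Fintype β] (K : Matrix β α ℂ) (ρ : Matrix α α ℂ)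
    (M : Matrix β β ℂ) : (K * ρ * Kᴴ * M).trace = (ρ * conjBy K M).trace := by
  rw [conjBy_apply, Matrix.mul_assoc, Matrix.mul_assoc, Matrix.trace_mul_comm]
  simp only [Matrix.mul_assoc]

lemma Channel.trace_query (Φ : Channel A B) (e : A ⊕ B ↪ W) (ρ M : Op W) :
    (Φ.query e ρ * M).trace = (ρ * localQuery e Φ.dual M).trace := by
  have h : localQuery e Φ.dual M = ∑ i, ∑ b, conjBy (liftOp e (Φ.queryKraus i b)) M := by
    rw [Channel.dual, localQuery_sum]
    simp only [queryKraus_eq, LinearMap.sum_apply, ← sum_conjBy_qKraus]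
  rw [h]
  simp only [Channel.query, Matrix.mul_sum, Matrix.sum_mul, Matrix.trace_sum, trace_conj_mul]

lemma Instr.trace_run {I : Interface} (O : ∀ q, Channel (I.inp q) (I.out q)) (c : Instr I W)
    (ρ M : Op W) : (c.run O ρ * M).trace = (ρ * c.dual O M).trace := by
  cases c with
  | gate g => exact trace_conj_mul _ _ _
  | query q e => exact Channel.trace_query _ _ _ _

/-- The passage between the two pictures: steps of the circuit are moved one by one from the state
to the observable by cyclicity of the trace. The last step of the circuit acts first on the
observable. -/
lemma trace_runProg {I : Interface} (O : ∀ q, Channel (I.inp q) (I.out q)) (P : List (Instr I W))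
    (ρ M : Op W) : (runProg O P ρ * M).trace = (ρ * progDual O P M).trace := by
  induction P generalizing ρ with
  | nil => rfl
  | cons c P ih =>
    rw [show runProg O (c :: P) ρ = runProg O P (c.run O ρ) from rfl, ih, Instr.trace_run]
    rfl

/-- The observable "the wire `w` has the value `b`". -/
def wireProj (w : W) (b : Bool) : Op W := Matrix.diagonal fun s => if s w = b then 1 else 0

lemma measProb_eq (ρ : Op W) (w : W) (b : Bool) :
    measProb ρ w b = (ρ * wireProj w b).trace.re := by
  simp only [measProb, wireProj, Matrix.trace, Matrix.diag_apply, Matrix.mul_diagonal, Complex.re_sum]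
  refine Finset.sum_congr rfl fun s _ => ?_
  split_ifs <;> simp

lemma wireProj_add (w : W) : wireProj w false + wireProj w true = 1 := by
  rw [wireProj, wireProj, Matrix.diagonal_add, ← Matrix.diagonal_one]
  congr 1
  funext s
  cases s w <;> simp

/-- The circuit step `c` on the wires selected by `f`. -/
def Instr.mapWires {I : Interface} (f : V ↪ W) : Instr I V → Instr I W
  | .gate g => .gate ⟨g.arity, g.arity_le, g.wires.trans f, g.unitary⟩
  | .query q e => .query q (e.trans f)

lemma Instr.dual_mapWires {I : Interface} (O : ∀ q, Channel (I.inp q) (I.out q)) (f : V ↪ W)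
    (c : Instr I V) : (c.mapWires f).dual O = loc f (c.dual O) := by
  cases c with
  | gate g =>
    simp only [Instr.mapWires, Instr.dual, Gate.op]
    rw [← liftOp_trans, conjBy_liftOp f]
  | query q e => exact localQuery_comp_loc _ _ _

/-- Lets a circuit be run inside a larger memory, as needed to compose circuits and to add ancillas.
-/
lemma progDual_mapWires {I : Interface} (O : ∀ q, Channel (I.inp q) (I.out q)) (f : V ↪ W)
    (P : List (Instr I V)) : progDual O (P.map (Instr.mapWires f)) = loc f (progDual O P) := by
  induction P with
  | nil => ext1 Y; exact (loc_id f Y).symm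
  | cons c P ih =>
    ext1 Y
    simp only [List.map_cons, progDual, LinearMap.comp_apply, ih, Instr.dual_mapWires, loc_comp]

end Heisenberg

/-! ### A calculus of reductions: which maps are realised by circuits with the state oracle. -/

section Simulation

variable {V W A B C D R : Type} [Fintype V] [DecidableEq V] [Fintype W] [DecidableEq W]
  [Fintype A] [DecidableEq A] [Fintype B] [DecidableEq B] [Fintype C] [DecidableEq C]
  [Fintype D] [DecidableEq D] [Fintype R] [DecidableEq R]

/-! ### Simulation of channels by oracle circuits -/

lemma sum_bits_sum {R : Type} [AddCommMonoid R] (F : (A ⊕ B → Bool) → R) :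
    ∑ s, F s = ∑ a, ∑ b, F (Sum.elim a b) := by
  rw [← Fintype.sum_prod_type']
  refine Fintype.sum_equiv (Equiv.sumArrowEquivProdArrow A B Bool) _ _ fun s => ?_
  exact congrArg F (sumElim_comp s).symm

/-- The product of two operators on a pair of registers. -/
def prodOp (ρ : Op A) (σ : Op C) : Op (A ⊕ C) :=
  Matrix.of fun s t => ρ (s ∘ Sum.inl) (t ∘ Sum.inl) * σ (s ∘ Sum.inr) (t ∘ Sum.inr)

lemma prodOp_elim (ρ : Op A) (σ : Op C) (s t : A → Bool) (c c' : C → Bool) :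
    prodOp ρ σ (Sum.elim s c) (Sum.elim t c') = ρ s t * σ c c' := rfl

/-- The product of two density operators. -/
def DensityOp.prod (ρ : DensityOp A) (σ : DensityOp C) : DensityOp (A ⊕ C) where
  mat := prodOp ρ.mat σ.mat
  posSemidef :=
    (ρ.posSemidef.kronecker σ.posSemidef).submatrix (fun s => (s ∘ Sum.inl, s ∘ Sum.inr))
  trace_eq_one := by
    have h : (prodOp ρ.mat σ.mat).trace = ρ.mat.trace * σ.mat.trace := by
      simp only [Matrix.trace, Matrix.diag_apply]
      rw [sum_bits_sum]
      simp only [prodOp_elim, Finset.sum_mul_sum]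
    rw [h, ρ.trace_eq_one, σ.trace_eq_one, mul_one]

/-- The observable on `A` obtained by putting `C` into the state `β`. -/
def slice (β : Op C) : Op (A ⊕ C) →ₗ[ℂ] Op A where
  toFun Y := Matrix.of fun s t => ∑ c, ∑ c', β c' c * Y (Sum.elim s c) (Sum.elim t c')
  map_add' X Y := by
    ext s t
    simp only [Matrix.of_apply, Matrix.add_apply, mul_add, Finset.sum_add_distrib]
  map_smul' z X := by
    ext s t
    simp only [Matrix.of_apply, Matrix.smul_apply, smul_eq_mul, RingHom.id_apply, Finset.mul_sum]
    refine Finset.sum_congr rfl fun c _ => Finset.sum_congr rfl fun c' _ => ?_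
    ring

lemma slice_apply (β : Op C) (Y : Op (A ⊕ C)) (s t : A → Bool) :
    slice β Y s t = ∑ c, ∑ c', β c' c * Y (Sum.elim s c) (Sum.elim t c') := rfl

lemma trace_prodOp_mul (ρ : Op A) (β : Op C) (Y : Op (A ⊕ C)) :
    (prodOp ρ β * Y).trace = (ρ * slice β Y).trace := by
  simp only [Matrix.trace, Matrix.diag_apply, Matrix.mul_apply, slice_apply]
  rw [sum_bits_sum]
  refine Finset.sum_congr rfl fun s _ => ?_
  have h : ∀ c : C → Bool, ∑ x, prodOp ρ β (Sum.elim s c) x * Y x (Sum.elim s c) =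
      ∑ t, ∑ c', ρ s t * (β c c' * Y (Sum.elim t c') (Sum.elim s c)) := by
    intro c
    rw [sum_bits_sum]
    simp only [prodOp_elim, mul_assoc]
  rw [Finset.sum_congr rfl fun c _ => h c, Finset.sum_comm]
  refine Finset.sum_congr rfl fun t _ => ?_
  rw [Finset.sum_comm]
  simp only [Finset.mul_sum]

/-- `T` acting on the first of two registers. -/
def tensorId (R : Type) (T : Op B →ₗ[ℂ] Op A) : Op (B ⊕ R) →ₗ[ℂ] Op (A ⊕ R) where
  toFun Y := Matrix.of fun s t =>
    T (Y.submatrix (fun b => Sum.elim b (s ∘ Sum.inr)) (fun b => Sum.elim b (t ∘ Sum.inr)))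
      (s ∘ Sum.inl) (t ∘ Sum.inl)
  map_add' X Y := by
    ext s t
    simp only [Matrix.of_apply, Matrix.add_apply]
    rw [← Matrix.add_apply, ← map_add]; rfl
  map_smul' c X := by
    ext s t
    simp only [Matrix.of_apply, Matrix.smul_apply, RingHom.id_apply]
    rw [← Matrix.smul_apply, ← map_smul]; rfl

lemma tensorId_elim (T : Op B →ₗ[ℂ] Op A) (Y : Op (B ⊕ R)) (s t : A → Bool) (r r' : R → Bool) :
    tensorId R T Y (Sum.elim s r) (Sum.elim t r') =
      T (Y.submatrix (fun b => Sum.elim b r) (fun b => Sum.elim b r')) s t := rfl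

/-- An ancilla that the observable ignores contributes only its trace, which is one. -/
lemma slice_liftOp_inl (β : DensityOp C) (M : Op A) :
    slice β.mat (liftOp Function.Embedding.inl M) = M := by
  classical
  ext s t
  rw [slice_apply]
  have h : ∀ c c' : C → Bool, liftOp Function.Embedding.inl M (Sum.elim s c) (Sum.elim t c') =
      if c = c' then M s t else 0 := by
    intro c c'
    rw [liftOp_apply]
    refine if_congr ?_ rfl rfl
    constructor
    · intro h
      funext x
      exact h (Sum.inr x) (by simp)
    · rintro rfl w hw
      rcases w with a | x
      · exact absurd ⟨a, rfl⟩ hw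
      · rfl
  simp only [h, mul_ite, mul_zero, Finset.sum_ite_eq, Finset.mem_univ, if_true]
  rw [← Finset.sum_mul]
  have := β.trace_eq_one
  rw [Matrix.trace] at this
  simp only [Matrix.diag_apply] at this
  rw [this, one_mul]

/-- Families of `l`-qubit states indexed by `d`-bit strings. -/
abbrev Fam (d l : ℕ) : Type := (Fin d → Bool) → PureState (Fin l)

/-- The oracle for the state family `v`. -/
def famOracle {d l : ℕ} (v : Fam d l) (q : (stateInterface d l).Q) :
    Channel ((stateInterface d l).inp q) ((stateInterface d l).out q) := stateOracle v

/-- The adjoint of a circuit with an oracle for the state family `v`. -/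
def famDual {d l : ℕ} (v : Fam d l) (P : List (Instr (stateInterface d l) W)) :
    Op W →ₗ[ℂ] Op W :=
  progDual (famOracle v) P

/-- The maps of observables `T v` are performed by one circuit of size at most `s` with an oracle
for the state family `v`, with ancillas `C` in a fixed state; the output is found on the wires
selected by an embedding, and all other wires are discarded. -/
def Sim {d l : ℕ} (T : Fam d l → Op B →ₗ[ℂ] Op A) (s : ℕ) : Prop :=
  ∃ (C : Type) (_ : Fintype C) (_ : DecidableEq C) (β : DensityOp C)
    (P : List (Instr (stateInterface d l) (A ⊕ C))) (o : B ↪ A ⊕ C),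
    Fintype.card C + P.length ≤ s ∧
      ∀ v M, slice β.mat (famDual v P (liftOp o M)) = T v M

/-- The density operator of an empty register. -/
def DensityOp.empty : DensityOp Empty where
  mat := 1
  posSemidef := Matrix.PosSemidef.one
  trace_eq_one := by simp

variable {d l : ℕ}

lemma Sim.mono {T : Fam d l → Op B →ₗ[ℂ] Op A} {s s' : ℕ} (h : Sim T s) (hs : s ≤ s') :
    Sim T s' := by
  obtain ⟨C, i1, i2, β, P, o, h1, h2⟩ := h
  exact ⟨C, i1, i2, β, P, o, h1.trans hs, h2⟩

lemma Sim.congr {T T' : Fam d l → Op B →ₗ[ℂ] Op A} {s : ℕ} (h : Sim T s)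
    (hT : ∀ v M, T v M = T' v M) : Sim T' s := by
  have : T = T' := funext fun v => LinearMap.ext (hT v)
  exact this ▸ h

lemma Sim.prog (P : List (Instr (stateInterface d l) A)) :
    Sim (fun v => famDual v P) P.length := by
  refine ⟨Empty, inferInstance, inferInstance, DensityOp.empty,
    P.map (Instr.mapWires Function.Embedding.inl), Function.Embedding.inl, by simp, ?_⟩
  intro v M
  rw [famDual, progDual_mapWires, loc_liftOp, slice_liftOp_inl]
  rfl

/-- On observables, lifting along `o` is the adjoint of discarding the wires outside its range and
renaming the rest. It costs no gate, only a choice of output wires. -/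
lemma Sim.relabel (o : B ↪ A) : Sim (fun _ : Fam d l => liftOpL o) 0 := by
  refine ⟨Empty, inferInstance, inferInstance, DensityOp.empty, [], o.trans Function.Embedding.inl,
    by simp, ?_⟩
  intro v M
  rw [← liftOp_trans]
  exact slice_liftOp_inl _ _

lemma Sim.prep (β : DensityOp C) :
    Sim (fun _ : Fam d l => (slice β.mat : Op (A ⊕ C) →ₗ[ℂ] Op A)) (Fintype.card C) := by
  refine ⟨C, inferInstance, inferInstance, β, [], Function.Embedding.refl _, by simp, ?_⟩
  intro v M
  rw [liftOp_refl]
  rfl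

/-- The embedding of `A ⊕ C` into `A ⊕ (C ⊕ D)`. -/
def embFst (A C D : Type) : A ⊕ C ↪ A ⊕ (C ⊕ D) :=
  ⟨Sum.map id Sum.inl, Function.Injective.sumMap Function.injective_id Sum.inl_injective⟩

lemma extend_embFst (a : A ⊕ C → Bool) (s : A → Bool) (c : C → Bool) (c' : D → Bool) :
    Function.extend (embFst A C D) a (Sum.elim s (Sum.elim c c')) =
      Sum.elim (a ∘ Sum.inl) (Sum.elim (a ∘ Sum.inr) c') := by
  funext w
  rcases w with x | x | x
  · exact (embFst A C D).injective.extend_apply a _ (Sum.inl x)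
  · exact (embFst A C D).injective.extend_apply a _ (Sum.inr x)
  · rw [Function.extend_apply']
    · rfl
    · rintro ⟨y | y, hy⟩ <;> simp [embFst] at hy

/-- The embedding of `B ⊕ D` into `A ⊕ (C ⊕ D)` extending an embedding of `B` into `A ⊕ C`. -/
def embSnd (o : B ↪ A ⊕ C) (D : Type) : B ⊕ D ↪ A ⊕ (C ⊕ D) :=
  ⟨Sum.elim (fun b => embFst A C D (o b)) (fun x => Sum.inr (Sum.inr x)), by
    rintro (b | x) (b' | x') h
    · exact congrArg Sum.inl (o.injective ((embFst A C D).injective h))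
    · exfalso
      revert h
      simp only [Sum.elim_inl, Sum.elim_inr]
      rcases o b with y | y <;> simp [embFst]
    · exfalso
      revert h
      simp only [Sum.elim_inl, Sum.elim_inr]
      rcases o b' with y | y <;> simp [embFst]
    · simpa using h⟩

lemma liftOp_embSnd (o : B ↪ A ⊕ C) (Y : Op (B ⊕ D)) (a b : A ⊕ C → Bool) (c c' : D → Bool) :
    liftOp (embSnd o D) Y (Sum.elim (a ∘ Sum.inl) (Sum.elim (a ∘ Sum.inr) c))
      (Sum.elim (b ∘ Sum.inl) (Sum.elim (b ∘ Sum.inr) c')) =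
    liftOp o (Y.submatrix (fun x => Sum.elim x c) (fun x => Sum.elim x c')) a b := by
  classical
  rw [liftOp_apply, liftOp_apply]
  have h1 : ∀ (a : A ⊕ C → Bool) (c : D → Bool) y,
      (Sum.elim (a ∘ Sum.inl) (Sum.elim (a ∘ Sum.inr) c) : A ⊕ (C ⊕ D) → Bool)
        (embFst A C D y) = a y := by
    rintro a c (y | y) <;> rfl
  have h2 : ∀ (a : A ⊕ C → Bool) (c : D → Bool),
      (Sum.elim (a ∘ Sum.inl) (Sum.elim (a ∘ Sum.inr) c) : A ⊕ (C ⊕ D) → Bool) ∘ embSnd o D =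
        Sum.elim (a ∘ o) c := by
    intro a c
    funext w
    rcases w with y | y
    · exact h1 a c (o y)
    · rfl
  rw [h2, h2]
  refine if_congr ?_ rfl rfl
  constructor
  · intro h w hw
    have := h (embFst A C D w) (by
      rintro ⟨y | y, hy⟩
      · exact hw ⟨y, (embFst A C D).injective hy⟩
      · rcases w with w | w <;> simp [embSnd, embFst] at hy)
    rwa [h1, h1] at this
  · intro h w hw
    have key : ∀ y, w = embFst A C D y → (Sum.elim (a ∘ Sum.inl) (Sum.elim (a ∘ Sum.inr) c) :
        A ⊕ (C ⊕ D) → Bool) w = (Sum.elim (b ∘ Sum.inl) (Sum.elim (b ∘ Sum.inr) c') :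
        A ⊕ (C ⊕ D) → Bool) w := by
      rintro y rfl
      rw [h1, h1]
      refine h y ?_
      rintro ⟨z, rfl⟩
      exact hw ⟨Sum.inl z, rfl⟩
    rcases w with x | x | x
    · exact key (Sum.inl x) rfl
    · exact key (Sum.inr x) rfl
    · exact absurd ⟨Sum.inr x, rfl⟩ hw

/-- Sequential composition; `T₁` is performed first. -/
lemma Sim.comp {T₁ : Fam d l → Op B →ₗ[ℂ] Op A} {T₂ : Fam d l → Op D →ₗ[ℂ] Op B} {s₁ s₂ : ℕ}
    (h₁ : Sim T₁ s₁) (h₂ : Sim T₂ s₂) : Sim (fun v => T₁ v ∘ₗ T₂ v) (s₁ + s₂) := by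
  obtain ⟨C₁, i1, i2, β₁, P₁, o₁, hs₁, h₁⟩ := h₁
  obtain ⟨C₂, i3, i4, β₂, P₂, o₂, hs₂, h₂⟩ := h₂
  refine ⟨C₁ ⊕ C₂, inferInstance, inferInstance, β₁.prod β₂,
    P₁.map (Instr.mapWires (embFst A C₁ C₂)) ++ P₂.map (Instr.mapWires (embSnd o₁ C₂)),
    o₂.trans (embSnd o₁ C₂), ?_, ?_⟩
  · simp only [Fintype.card_sum, List.length_append, List.length_map]; omega
  intro v M
  rw [famDual, progDual_append, LinearMap.comp_apply, progDual_mapWires, progDual_mapWires,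
    ← liftOp_trans, loc_liftOp, LinearMap.comp_apply, ← h₂]
  change slice _ (loc _ (famDual v P₁) (liftOp _ (famDual v P₂ (liftOp o₂ M)))) = _
  generalize famDual v P₂ (liftOp o₂ M) = Y
  -- The slice of `Y` is a combination of blocks of `Y` with coefficients from `β₂`. By linearity
  -- `T₁ v` acts block by block, so the ancillas of the second circuit may be filled in at the very
  -- start.
  have hlin : T₁ v (slice β₂.mat Y) = ∑ c, ∑ c', β₂.mat c' c •
      T₁ v (Y.submatrix (fun x => Sum.elim x c) (fun x => Sum.elim x c')) := by
    simp only [← map_smul, ← map_sum]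
    congr 1
    ext s t
    simp only [slice_apply, Matrix.sum_apply, Matrix.smul_apply, smul_eq_mul, Matrix.submatrix_apply]
  rw [hlin]
  ext s t
  rw [slice_apply, sum_bits_sum, Finset.sum_comm]
  simp only [Matrix.sum_apply, Matrix.smul_apply, smul_eq_mul]
  refine Finset.sum_congr rfl fun c₂ _ => ?_
  have hc : ∀ c₁ : C₁ → Bool, ∑ c', (β₁.prod β₂).mat c' (Sum.elim c₁ c₂) *
      loc (embFst A C₁ C₂) (famDual v P₁) (liftOp (embSnd o₁ C₂) Y)
        (Sum.elim s (Sum.elim c₁ c₂)) (Sum.elim t c') =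
      ∑ c₂', β₂.mat c₂' c₂ * ∑ c₁', β₁.mat c₁' c₁ *
        famDual v P₁ (liftOp o₁ (Y.submatrix (fun x => Sum.elim x c₂) (fun x => Sum.elim x c₂')))
          (Sum.elim s c₁) (Sum.elim t c₁') := by
    intro c₁
    rw [sum_bits_sum, Finset.sum_comm]
    refine Finset.sum_congr rfl fun c₂' _ => ?_
    rw [Finset.mul_sum]
    refine Finset.sum_congr rfl fun c₁' _ => ?_
    have hm : (β₁.prod β₂).mat (Sum.elim c₁' c₂') (Sum.elim c₁ c₂) =
        β₁.mat c₁' c₁ * β₂.mat c₂' c₂ := rfl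
    rw [hm, loc_apply]
    simp only [extend_embFst]
    have hsub : (liftOp (embSnd o₁ C₂) Y).submatrix
        (fun a => Sum.elim (a ∘ Sum.inl) (Sum.elim (a ∘ Sum.inr) c₂))
        (fun a => Sum.elim (a ∘ Sum.inl) (Sum.elim (a ∘ Sum.inr) c₂')) =
        liftOp o₁ (Y.submatrix (fun x => Sum.elim x c₂) (fun x => Sum.elim x c₂')) := by
      ext a b
      exact liftOp_embSnd o₁ Y a b c₂ c₂'
    rw [hsub]
    have hcomp : ∀ (s : A → Bool) (c₁ : C₁ → Bool) (c₂ : C₂ → Bool),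
        (Sum.elim s (Sum.elim c₁ c₂) : A ⊕ (C₁ ⊕ C₂) → Bool) ∘ embFst A C₁ C₂ = Sum.elim s c₁ := by
      intro s c₁ c₂
      funext w
      rcases w with w | w <;> rfl
    rw [hcomp, hcomp]
    ring
  rw [Finset.sum_congr rfl fun c₁ _ => hc c₁, Finset.sum_comm]
  refine Finset.sum_congr rfl fun c₂' _ => ?_
  rw [← Finset.mul_sum, ← h₁, slice_apply]

/-- The embedding of `A ⊕ C` into `(A ⊕ R) ⊕ C`. -/
def embMid (A C R : Type) : A ⊕ C ↪ (A ⊕ R) ⊕ C :=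
  ⟨Sum.map Sum.inl id, Function.Injective.sumMap Sum.inl_injective Function.injective_id⟩

/-- The embedding of `B ⊕ R` into `(A ⊕ R) ⊕ C` extending an embedding of `B` into `A ⊕ C`. -/
def embSide (o : B ↪ A ⊕ C) (R : Type) : B ⊕ R ↪ (A ⊕ R) ⊕ C :=
  ⟨Sum.elim (fun b => embMid A C R (o b)) (fun x => Sum.inl (Sum.inr x)), by
    rintro (b | x) (b' | x') h
    · exact congrArg Sum.inl (o.injective ((embMid A C R).injective h))
    · exfalso
      revert h
      simp only [Sum.elim_inl, Sum.elim_inr]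
      rcases o b with y | y <;> simp [embMid]
    · exfalso
      revert h
      simp only [Sum.elim_inl, Sum.elim_inr]
      rcases o b' with y | y <;> simp [embMid]
    · simpa using h⟩

lemma liftOp_embSide (o : B ↪ A ⊕ C) (Y : Op (B ⊕ R)) (a b : A ⊕ C → Bool) (c c' : R → Bool) :
    liftOp (embSide o R) Y (Sum.elim (Sum.elim (a ∘ Sum.inl) c) (a ∘ Sum.inr))
      (Sum.elim (Sum.elim (b ∘ Sum.inl) c') (b ∘ Sum.inr)) =
    liftOp o (Y.submatrix (fun x => Sum.elim x c) (fun x => Sum.elim x c')) a b := by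
  classical
  rw [liftOp_apply, liftOp_apply]
  have h1 : ∀ (a : A ⊕ C → Bool) (c : R → Bool) y,
      (Sum.elim (Sum.elim (a ∘ Sum.inl) c) (a ∘ Sum.inr) : (A ⊕ R) ⊕ C → Bool)
        (embMid A C R y) = a y := by
    rintro a c (y | y) <;> rfl
  have h2 : ∀ (a : A ⊕ C → Bool) (c : R → Bool),
      (Sum.elim (Sum.elim (a ∘ Sum.inl) c) (a ∘ Sum.inr) : (A ⊕ R) ⊕ C → Bool) ∘ embSide o R =
        Sum.elim (a ∘ o) c := by
    intro a c
    funext w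
    rcases w with y | y
    · exact h1 a c (o y)
    · rfl
  rw [h2, h2]
  refine if_congr ?_ rfl rfl
  constructor
  · intro h w hw
    have := h (embMid A C R w) (by
      rintro ⟨y | y, hy⟩
      · exact hw ⟨y, (embMid A C R).injective hy⟩
      · rcases w with w | w <;> simp [embSide, embMid] at hy)
    rwa [h1, h1] at this
  · intro h w hw
    have key : ∀ y, w = embMid A C R y → (Sum.elim (Sum.elim (a ∘ Sum.inl) c) (a ∘ Sum.inr) :
        (A ⊕ R) ⊕ C → Bool) w = (Sum.elim (Sum.elim (b ∘ Sum.inl) c') (b ∘ Sum.inr) :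
        (A ⊕ R) ⊕ C → Bool) w := by
      rintro y rfl
      rw [h1, h1]
      refine h y ?_
      rintro ⟨z, rfl⟩
      exact hw ⟨Sum.inl z, rfl⟩
    rcases w with (x | x) | x
    · exact key (Sum.inl x) rfl
    · exact absurd ⟨Sum.inr x, rfl⟩ hw
    · exact key (Sum.inr x) rfl

/-- A simulated channel may act on a part of a larger register. -/
lemma Sim.tensor {T : Fam d l → Op B →ₗ[ℂ] Op A} {s : ℕ} (h : Sim T s) (R : Type) [Fintype R]
    [DecidableEq R] : Sim (fun v => tensorId R (T v)) s := by
  obtain ⟨C, i1, i2, β, P, o, hs, h⟩ := h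
  refine ⟨C, i1, i2, β, P.map (Instr.mapWires (embMid A C R)), embSide o R, by simpa using hs, ?_⟩
  intro v M
  rw [famDual, progDual_mapWires]
  change slice _ (loc _ (famDual v P) _) = _
  ext s t
  rw [slice_apply, ← sumElim_comp s, ← sumElim_comp t, tensorId_elim, ← h, slice_apply]
  refine Finset.sum_congr rfl fun c _ => Finset.sum_congr rfl fun c' _ => ?_
  rw [loc_apply]
  have hext : ∀ (a : A ⊕ C → Bool) (x : A → Bool) (r : R → Bool) (c : C → Bool),
      Function.extend (embMid A C R) a (Sum.elim (Sum.elim x r) c) =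
      Sum.elim (Sum.elim (a ∘ Sum.inl) r) (a ∘ Sum.inr) := by
    intro a x r c
    funext w
    rcases w with (w | w) | w
    · exact (embMid A C R).injective.extend_apply a _ (Sum.inl w)
    · rw [Function.extend_apply']
      · rfl
      · rintro ⟨y | y, hy⟩ <;> simp [embMid] at hy
    · exact (embMid A C R).injective.extend_apply a _ (Sum.inr w)
  have hcomp : ∀ (x : A → Bool) (r : R → Bool) (c : C → Bool),
      (Sum.elim (Sum.elim x r) c : (A ⊕ R) ⊕ C → Bool) ∘ embMid A C R = Sum.elim x c := by
    intro x r c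
    funext w
    rcases w with w | w <;> rfl
  simp only [hext, hcomp]
  have hsub : (liftOp (embSide o R) M).submatrix
      (fun a => Sum.elim (Sum.elim (a ∘ Sum.inl) (s ∘ Sum.inr)) (a ∘ Sum.inr))
      (fun a => Sum.elim (Sum.elim (a ∘ Sum.inl) (t ∘ Sum.inr)) (a ∘ Sum.inr)) =
      liftOp o (M.submatrix (fun x => Sum.elim x (s ∘ Sum.inr))
        (fun x => Sum.elim x (t ∘ Sum.inr))) := by
    ext a b
    exact liftOp_embSide o M a b _ _
  rw [hsub]

/-- The basis state `z` as a density operator. -/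
def DensityOp.basis (z : C → Bool) : DensityOp C where
  mat := Matrix.diagonal fun s => if s = z then 1 else 0
  posSemidef := Matrix.PosSemidef.diagonal fun s => by
    dsimp only
    split_ifs
    · exact zero_le_one
    · exact le_rfl
  trace_eq_one := by simp [Matrix.trace_diagonal]

lemma slice_basis (z : C → Bool) (Y : Op (A ⊕ C)) (s t : A → Bool) :
    slice (DensityOp.basis z).mat Y s t = Y (Sum.elim s z) (Sum.elim t z) := by
  rw [slice_apply, Finset.sum_eq_single z, Finset.sum_eq_single z]
  · simp [DensityOp.basis]
  · intro c _ hc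
    simp [DensityOp.basis, Matrix.diagonal_apply_ne _ hc]
  · simp
  · intro c _ hc
    refine Finset.sum_eq_zero fun c' _ => ?_
    by_cases h : c' = c
    · subst h; simp [DensityOp.basis, hc]
    · simp [DensityOp.basis, Matrix.diagonal_apply_ne _ h]
  · simp

/-- A simulated channel may be queried on arbitrary wires of a memory. -/
lemma Sim.localQuery {T : Fam d l → Op B →ₗ[ℂ] Op A} {s : ℕ} (h : Sim T s) (e : A ⊕ B ↪ W) :
    Sim (fun v => localQuery e (T v)) (s + Fintype.card A) := by
  classical
  -- `R` collects the wires untouched by the query. The memory then splits as input, output and `R`.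
  let R : Type := {w // w ∉ Set.range e}
  let i : A ⊕ R ↪ W := ⟨Sum.elim (fun a => e (Sum.inl a)) Subtype.val, by
    rintro (a | r) (a' | r') hh
    · exact congrArg Sum.inl (Sum.inl_injective (e.injective hh))
    · exact absurd ⟨_, hh⟩ r'.2
    · exact absurd ⟨_, hh.symm⟩ r.2
    · exact congrArg Sum.inr (Subtype.ext hh)⟩
  let k : (B ⊕ R) ⊕ A → W :=
    Sum.elim (Sum.elim (fun b => e (Sum.inr b)) Subtype.val) (fun a => e (Sum.inl a))
  have hk : Function.Bijective k := by
    constructor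
    · rintro ((b | r) | a) ((b' | r') | a') hh
      · exact congrArg _ (congrArg _ (Sum.inr_injective (e.injective hh)))
      · exact absurd ⟨_, hh⟩ r'.2
      · exact absurd (e.injective hh) (by simp)
      · exact absurd ⟨_, hh.symm⟩ r.2
      · exact congrArg _ (congrArg _ (Subtype.ext hh))
      · exact absurd ⟨_, hh.symm⟩ r.2
      · exact absurd (e.injective hh) (by simp)
      · exact absurd ⟨_, hh⟩ r'.2
      · exact congrArg _ (Sum.inl_injective (e.injective hh))
    · intro w
      by_cases hw : w ∈ Set.range e
      · obtain ⟨a | b, rfl⟩ := hw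
        · exact ⟨Sum.inr a, rfl⟩
        · exact ⟨Sum.inl (Sum.inl b), rfl⟩
      · exact ⟨Sum.inl (Sum.inr ⟨w, hw⟩), rfl⟩
  let κ := Equiv.ofBijective k hk
  -- In the order of time: discard the old output wires, apply `T` to the input with `R` as
  -- spectator, append fresh zero wires in place of the consumed input, and put all wires back in
  -- place. The fresh wires account for the summand `card A`.
  have hsim := (((Sim.relabel (d := d) (l := l) i).comp (h.tensor R)).comp
    (Sim.prep (DensityOp.basis (C := A) fun _ => false))).comp (Sim.relabel κ.symm.toEmbedding)
  refine (hsim.mono (by omega)).congr fun v M => ?_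
  ext x y
  simp only [LinearMap.comp_apply, liftOpL_apply]
  rw [liftOp_apply, localQuery_apply]
  have hcond : (∀ w, w ∉ Set.range i → x w = y w) ↔ x ∘ e ∘ Sum.inr = y ∘ e ∘ Sum.inr := by
    constructor
    · intro hh
      funext b
      refine hh (e (Sum.inr b)) ?_
      rintro ⟨a | r, hr⟩
      · exact absurd (e.injective hr) (by simp)
      · exact r.2 ⟨_, hr.symm⟩
    · intro hh w hw
      by_cases hwe : w ∈ Set.range e
      · obtain ⟨a | b, rfl⟩ := hwe
        · exact absurd ⟨Sum.inl a, rfl⟩ hw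
        · exact congrFun hh b
      · exact absurd ⟨Sum.inr ⟨w, hwe⟩, rfl⟩ hw
  refine if_congr hcond ?_ rfl
  have hsub : (slice (DensityOp.basis (C := A) fun _ => false).mat
      (liftOp κ.symm.toEmbedding M)).submatrix (fun b => Sum.elim b (x ∘ i ∘ Sum.inr))
        (fun b => Sum.elim b (y ∘ i ∘ Sum.inr)) =
      M.submatrix (fun c => Function.extend e (Sum.elim (fun _ => false) c) x)
        (fun c => Function.extend e (Sum.elim (fun _ => false) c) y) := by
    ext b b'
    rw [Matrix.submatrix_apply, slice_basis, liftOp_apply, if_pos, Matrix.submatrix_apply]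
    · have hre : ∀ (x : W → Bool) (b : B → Bool),
          (Sum.elim (Sum.elim b (x ∘ i ∘ Sum.inr)) (fun _ => false) : (B ⊕ R) ⊕ A → Bool) ∘
            κ.symm.toEmbedding = Function.extend e (Sum.elim (fun _ => false) b) x := by
        intro x b
        funext w
        obtain ⟨z, rfl⟩ := κ.surjective w
        have h0 : κ.symm.toEmbedding (κ z) = z := κ.symm_apply_apply z
        rw [Function.comp_apply, h0]
        rcases z with (z | z) | z
        · exact (e.injective.extend_apply (Sum.elim (fun _ => false) b) x (Sum.inr z)).symm
        · exact (Function.extend_apply' _ _ _ z.2).symm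
        · exact (e.injective.extend_apply (Sum.elim (fun _ => false) b) x (Sum.inl z)).symm
      rw [hre, hre]
    · intro w hw
      exact absurd ⟨κ w, κ.symm_apply_apply w⟩ hw
  rw [← hsub]
  rfl

/-- One query to the state oracle. -/
lemma Sim.oracle : Sim (fun v : Fam d l => (stateOracle v).dual) (d + l + 1) := by
  classical
  refine ⟨Fin d ⊕ Fin l, inferInstance, inferInstance, DensityOp.basis fun _ => false,
    [Instr.query (I := stateInterface d l) () (Function.Embedding.refl _)],
    Function.Embedding.inr, by simp, ?_⟩
  intro v M
  ext x y
  rw [slice_basis]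
  change QCrypto.localQuery (Function.Embedding.refl _) (stateOracle v).dual _ _ _ = _
  rw [QCrypto.localQuery_apply]
  refine (if_pos rfl).trans ?_
  have hsub : (liftOp (Function.Embedding.inr : Fin d ⊕ Fin l ↪ Fin d ⊕ (Fin d ⊕ Fin l)) M).submatrix
      (fun c => Function.extend (Function.Embedding.refl _) (Sum.elim (fun _ => false) c)
        (Sum.elim x fun _ => false))
      (fun c => Function.extend (Function.Embedding.refl _) (Sum.elim (fun _ => false) c)
        (Sum.elim y fun _ => false)) = M := by
    have hext : ∀ (s : Fin d ⊕ (Fin d ⊕ Fin l) → Bool) c,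
        Function.extend (Function.Embedding.refl (Fin d ⊕ (Fin d ⊕ Fin l))) c s = c := by
      intro s c
      funext w
      exact (Function.Embedding.refl _).injective.extend_apply c s w
    ext a b
    rw [Matrix.submatrix_apply, hext, hext, liftOp_apply, if_pos]
    · rfl
    · rintro (w | w) hw
      · rfl
      · exact absurd ⟨w, rfl⟩ hw
  rw [hsub]
  rfl

lemma Sim.id : Sim (fun _ : Fam d l => (LinearMap.id : Op A →ₗ[ℂ] Op A)) 0 := by
  refine (Sim.relabel (Function.Embedding.refl A)).congr fun v M => ?_
  exact liftOp_refl M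

/-- Circuits with simulated oracles are simulated. -/
lemma Sim.progDual {I : Interface} {O : Fam d l → ∀ q, Channel (I.inp q) (I.out q)} {s : ℕ}
    (h : ∀ q, Sim (fun v => (O v q).dual) s) (hs : ∀ q, Fintype.card (I.inp q) ≤ s)
    (P : List (Instr I W)) : Sim (fun v => progDual (O v) P) (P.length * (2 * s + 1)) := by
  induction P with
  | nil => exact (Sim.id).mono (by simp)
  | cons c P ih =>
    -- A gate has size 1 and a query at most `s` plus the number of its input wires, hence at most
    -- `2 * s`; `2 * s + 1` covers both.
    have hc : Sim (fun v => c.dual (O v)) (2 * s + 1) := by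
      cases c with
      | gate g =>
        refine ((Sim.prog [Instr.gate g]).mono (by simp)).congr fun v M => ?_
        rfl
      | query q e =>
        refine ((h q).localQuery e).mono ?_
        have := hs q
        omega
    refine (hc.comp ih).mono ?_
    rw [List.length_cons]
    ring_nf
    omega

lemma liftOp_wireProj (f : V ↪ W) (w : V) (b : Bool) :
    liftOp f (wireProj w b) = wireProj (f w) b := by
  classical
  ext s t
  rw [liftOp_apply, wireProj, wireProj]
  by_cases h : s = t
  · subst h; simp
  · rw [Matrix.diagonal_apply_ne _ h]
    split_ifs with h1
    · rw [Matrix.diagonal_apply_ne]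
      intro h2
      refine h (funext fun x => ?_)
      by_cases hx : x ∈ Set.range f
      · obtain ⟨y, rfl⟩ := hx
        exact congrFun h2 y
      · exact h1 x hx
    · rfl

/-- A simulated process yields a distinguisher. -/
lemma Sim.exists_distinguisher {N s : ℕ} {T : Fam d l → Op (Fin N) →ₗ[ℂ] Op (Fin N)}
    (h : Sim T s) (ρ : DensityOp (Fin N)) (out : Fin N) :
    ∃ D : Distinguisher d l, D.size ≤ N + s ∧
      ∀ v, D.acceptProb v = (ρ.mat * T v (wireProj out true)).trace.re := by
  classical
  obtain ⟨C, i1, i2, β, P, o, hs, h⟩ := h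
  -- A distinguisher has wires numbered by some `Fin`, so the memory together with the ancillas is
  -- renumbered; traces and lifts are unaffected.
  let κ : Fin N ⊕ C ≃ Fin (Fintype.card (Fin N ⊕ C)) := Fintype.equivFin _
  let f : Fin N ⊕ C ↪ Fin (Fintype.card (Fin N ⊕ C)) := κ.toEmbedding
  let σ := ρ.prod β
  have hbij : Function.Bijective
      (fun s : Fin (Fintype.card (Fin N ⊕ C)) → Bool => s ∘ κ) :=
    (Equiv.arrowCongr κ.symm (Equiv.refl Bool)).bijective
  have htr : ∀ M : Op (Fin N ⊕ C), (M.submatrix (fun s => s ∘ κ) (fun s => s ∘ κ)).trace =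
      M.trace := fun M => Fintype.sum_bijective _ hbij _ _ fun _ => rfl
  have hlift : ∀ M : Op (Fin N ⊕ C), liftOp f M =
      M.submatrix (fun s => s ∘ κ) (fun s => s ∘ κ) := by
    intro M
    ext x y
    rw [liftOp_apply, if_pos]
    · rfl
    · intro w hw
      exact absurd ⟨κ.symm w, κ.apply_symm_apply w⟩ hw
  refine ⟨⟨Fintype.card (Fin N ⊕ C), ⟨σ.mat.submatrix (fun s => s ∘ κ) (fun s => s ∘ κ),
    σ.posSemidef.submatrix _, (htr _).trans σ.trace_eq_one⟩, P.map (Instr.mapWires f), f (o out)⟩,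
    ?_, ?_⟩
  · simp only [Distinguisher.size, List.length_map, Fintype.card_sum, Fintype.card_fin]
    omega
  · intro v
    rw [Distinguisher.acceptProb, measProb_eq]
    change (runProg (famOracle v) (P.map (Instr.mapWires f))
      (σ.mat.submatrix (fun s => s ∘ κ) (fun s => s ∘ κ)) * wireProj (f (o out)) true).trace.re = _
    rw [trace_runProg, progDual_mapWires, ← liftOp_wireProj,
      loc_liftOp, ← liftOp_wireProj, hlift, ← h, ← trace_prodOp_mul]
    congr 1
    rw [← htr (prodOp ρ.mat β.mat * _)]
    congr 1
    ext x y
    simp only [Matrix.mul_apply, Matrix.submatrix_apply]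
    exact Fintype.sum_bijective _ hbij _ _ fun _ => rfl

end Simulation

/-! ### Elementary gates, and preparation of fixed states from advice. -/

section Gates

variable {V W A B C D R : Type} [Fintype V] [DecidableEq V] [Fintype W] [DecidableEq W]
  [Fintype A] [DecidableEq A] [Fintype B] [DecidableEq B] [Fintype C] [DecidableEq C]
  [Fintype D] [DecidableEq D] [Fintype R] [DecidableEq R] {d l : ℕ}

/-! ### Controlled swaps and Hadamard gates -/

/-- The unitary permuting the basis states by `σ`. -/
def permUnitary {α : Type} [Fintype α] [DecidableEq α] (σ : Equiv.Perm α) :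
    Matrix.unitaryGroup α ℂ :=
  ⟨Matrix.of fun a b => if a = σ b then 1 else 0, by
    rw [Matrix.mem_unitaryGroup_iff']
    ext a b
    simp [Matrix.mul_apply, Matrix.one_apply, Matrix.star_apply, eq_comm]⟩

lemma conjBy_permUnitary {α : Type} [Fintype α] [DecidableEq α] (σ : Equiv.Perm α)
    (Y : Matrix α α ℂ) (s t : α) : conjBy (permUnitary σ).1 Y s t = Y (σ s) (σ t) := by
  rw [conjBy_entry]
  simp [permUnitary]

/-- The action of a controlled swap on bit strings: swap the wires `p` and `q` if the wire `a`
is set. -/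
def cswapFun (a p q : W) (s : W → Bool) : W → Bool := if s a then s ∘ Equiv.swap p q else s

/-- The controlled swap of three bits. -/
def cswapPerm : Equiv.Perm (Fin 3 → Bool) :=
  Function.Involutive.toPerm (cswapFun 0 1 2) (by
    intro s
    have h0 : Equiv.swap (1 : Fin 3) 2 0 = 0 := by decide
    unfold cswapFun
    by_cases h : s 0
    · simp only [h, if_true, Function.comp_apply, h0]
      funext x
      simp
    · simp [h])

/-- The wires of a controlled swap gate. -/
def cswapWires (a p q : W) (hap : a ≠ p) (haq : a ≠ q) (hpq : p ≠ q) : Fin 3 ↪ W :=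
  ⟨![a, p, q], by
    intro i j h
    fin_cases i <;> fin_cases j <;> simp_all [eq_comm]⟩

/-- The controlled swap gate. -/
def cswapGate (a p q : W) (hap : a ≠ p) (haq : a ≠ q) (hpq : p ≠ q) : Gate W where
  arity := 3
  arity_le := le_rfl
  wires := cswapWires a p q hap haq hpq
  unitary := permUnitary cswapPerm

lemma conjBy_cswapGate (a p q : W) (hap : a ≠ p) (haq : a ≠ q) (hpq : p ≠ q) (Y : Op W)
    (s t : W → Bool) : conjBy (cswapGate a p q hap haq hpq).op Y s t =
      Y (cswapFun a p q s) (cswapFun a p q t) := by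
  have hop : (cswapGate a p q hap haq hpq).op =
      liftOp (cswapWires a p q hap haq hpq) (permUnitary cswapPerm).1 := rfl
  rw [hop, conjBy_liftOp, loc_apply, conjBy_permUnitary, Matrix.submatrix_apply]
  have key : ∀ s : W → Bool, Function.extend (cswapWires a p q hap haq hpq)
      (cswapPerm (s ∘ (cswapWires a p q hap haq hpq))) s = cswapFun a p q s := by
    intro s
    have hw : ∀ i, (cswapWires a p q hap haq hpq) i = ![a, p, q] i := fun _ => rfl
    have hp : cswapPerm (s ∘ (cswapWires a p q hap haq hpq)) =
        cswapFun (0 : Fin 3) 1 2 (s ∘ (cswapWires a p q hap haq hpq)) := rfl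
    funext w
    rw [hp]
    have h0 : Equiv.swap (1 : Fin 3) 2 0 = 0 := by decide
    have hext : ∀ i : Fin 3, Function.extend (cswapWires a p q hap haq hpq)
        (cswapFun (0 : Fin 3) 1 2 (s ∘ (cswapWires a p q hap haq hpq))) s (![a, p, q] i) =
        cswapFun (0 : Fin 3) 1 2 (s ∘ (cswapWires a p q hap haq hpq)) i := fun i =>
      (cswapWires a p q hap haq hpq).injective.extend_apply _ s i
    have hsa : (s ∘ (cswapWires a p q hap haq hpq)) (0 : Fin 3) = s a := rfl
    by_cases h1 : w = a
    · subst h1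
      refine (hext 0).trans ?_
      unfold cswapFun
      rw [hsa]
      split_ifs
      · simp only [Function.comp_apply, h0, Equiv.swap_apply_of_ne_of_ne hap haq]
        rfl
      · rfl
    by_cases h2 : w = p
    · subst h2
      refine (hext 1).trans ?_
      unfold cswapFun
      rw [hsa]
      split_ifs
      · simp only [Function.comp_apply, Equiv.swap_apply_left]
        rfl
      · rfl
    by_cases h3 : w = q
    · subst h3
      refine (hext 2).trans ?_
      unfold cswapFun
      rw [hsa]
      split_ifs
      · simp only [Function.comp_apply, Equiv.swap_apply_right]
        rfl
      · rfl
    rw [Function.extend_apply']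
    · unfold cswapFun
      split_ifs
      · rw [Function.comp_apply, Equiv.swap_apply_of_ne_of_ne h2 h3]
      · rfl
    · rintro ⟨i, hi⟩
      rw [hw] at hi
      have : ∀ i : Fin 3, ![a, p, q] i = w → False := by
        intro i
        fin_cases i
        · exact fun hh => h1 hh.symm
        · exact fun hh => h2 hh.symm
        · exact fun hh => h3 hh.symm
      exact this i hi
  rw [key, key]

/-- Injectivity of `Sum.elim p q` makes the transpositions disjoint, so each acts on its own pair.
The cases `r ∈ L` and `r ∉ L` are carried together because the induction needs to know that the new
pair is not yet moved. -/
lemma swapList_prod (p q : R → W) (hpq : Function.Injective (Sum.elim p q)) (L : List R)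
    (hL : L.Nodup) :
    (∀ r, (r ∈ L → (L.map fun r => Equiv.swap (p r) (q r)).prod (p r) = q r ∧
        (L.map fun r => Equiv.swap (p r) (q r)).prod (q r) = p r) ∧
      (r ∉ L → (L.map fun r => Equiv.swap (p r) (q r)).prod (p r) = p r ∧
        (L.map fun r => Equiv.swap (p r) (q r)).prod (q r) = q r)) ∧
    ∀ w, w ∉ Set.range p → w ∉ Set.range q →
      (L.map fun r => Equiv.swap (p r) (q r)).prod w = w := by
  have hp : Function.Injective p := fun x y h => Sum.inl_injective (hpq h)
  have hq : Function.Injective q := fun x y h => Sum.inr_injective (hpq h)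
  have hne : ∀ x y, p x ≠ q y := fun x y h => Sum.inl_ne_inr (hpq (a₁ := Sum.inl x) (a₂ := Sum.inr y) h)
  induction L with
  | nil => simp
  | cons r₀ L ih =>
    obtain ⟨ih1, ih2⟩ := ih (List.nodup_cons.1 hL).2
    have hr₀ := (List.nodup_cons.1 hL).1
    simp only [List.map_cons, List.prod_cons, Equiv.Perm.mul_apply]
    refine ⟨fun r => ⟨fun hr => ?_, fun hr => ?_⟩, fun w hw hw' => ?_⟩
    · by_cases h : r = r₀
      · subst h
        rw [((ih1 r).2 hr₀).1, ((ih1 r).2 hr₀).2]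
        simp
      · have hr' : r ∈ L := by simpa [h] using hr
        rw [((ih1 r).1 hr').1, ((ih1 r).1 hr').2]
        exact ⟨Equiv.swap_apply_of_ne_of_ne (hne _ _).symm (fun hh => h (hq hh)),
          Equiv.swap_apply_of_ne_of_ne (fun hh => h (hp hh)) (hne _ _)⟩
    · have h : r ≠ r₀ := fun h => hr (h ▸ List.mem_cons_self)
      have hr' : r ∉ L := fun h => hr (List.mem_cons_of_mem _ h)
      rw [((ih1 r).2 hr').1, ((ih1 r).2 hr').2]
      exact ⟨Equiv.swap_apply_of_ne_of_ne (fun hh => h (hp hh)) (hne _ _),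
        Equiv.swap_apply_of_ne_of_ne (hne _ _).symm (fun hh => h (hq hh))⟩
    · rw [ih2 w hw hw']
      exact Equiv.swap_apply_of_ne_of_ne (fun hh => hw ⟨_, hh.symm⟩) (fun hh => hw' ⟨_, hh.symm⟩)

/-- Two registers may be swapped conditionally on a control wire. -/
lemma exists_cswap_prog (d l : ℕ) (a : W) (p q : R → W) (hpq : Function.Injective (Sum.elim p q))
    (hap : ∀ r, a ≠ p r) (haq : ∀ r, a ≠ q r) :
    ∃ (P : List (Instr (stateInterface d l) W)) (σ : Equiv.Perm W),
      P.length = Fintype.card R ∧ (∀ r, σ (p r) = q r) ∧ (∀ r, σ (q r) = p r) ∧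
      (∀ w, w ∉ Set.range p → w ∉ Set.range q → σ w = w) ∧
      ∀ v Y s t, famDual v P Y s t =
        Y (if s a then s ∘ σ else s) (if t a then t ∘ σ else t) := by
  have hne : ∀ x, p x ≠ q x := fun x h => Sum.inl_ne_inr (hpq (a₁ := Sum.inl x) (a₂ := Sum.inr x) h)
  have hP : ∀ (L : List R) (v : Fam d l) (Y : Op W) (s t : W → Bool),
      famDual v (L.map fun r => Instr.gate (cswapGate a (p r) (q r) (hap r) (haq r) (hne r))) Y s t =
      Y (if s a then s ∘ (L.map fun r => Equiv.swap (p r) (q r)).prod else s)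
        (if t a then t ∘ (L.map fun r => Equiv.swap (p r) (q r)).prod else t) := by
    intro L v Y
    induction L with
    | nil => intro s t; simp [famDual, progDual]
    | cons r L ih =>
      intro s t
      -- No gate moves the control wire, so all gates read the same control bit and their swaps
      -- multiply.
      have h0 : ∀ s : W → Bool, cswapFun a (p r) (q r) s a = s a := by
        intro s
        unfold cswapFun
        split_ifs
        · rw [Function.comp_apply, Equiv.swap_apply_of_ne_of_ne (hap r) (haq r)]
        · rfl
      refine (conjBy_cswapGate a (p r) (q r) (hap r) (haq r) (hne r) _ s t).trans ?_
      refine (ih _ _).trans ?_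
      rw [h0, h0]
      have h1 : ∀ s : W → Bool, (if s a then cswapFun a (p r) (q r) s ∘
          (L.map fun r => Equiv.swap (p r) (q r)).prod else cswapFun a (p r) (q r) s) =
          if s a then s ∘ ((r :: L).map fun r => Equiv.swap (p r) (q r)).prod else s := by
        intro s
        unfold cswapFun
        split_ifs
        · rw [List.map_cons, List.prod_cons, Equiv.Perm.coe_mul]; rfl
        · rfl
      rw [h1, h1]
  obtain ⟨h1, h2⟩ := swapList_prod p q hpq Finset.univ.toList (Finset.nodup_toList _)
  refine ⟨_, (Finset.univ.toList.map fun r => Equiv.swap (p r) (q r)).prod, ?_, fun r => ?_,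
    fun r => ?_, h2, hP Finset.univ.toList⟩
  · simp
  · exact ((h1 r).1 (by simp)).1
  · exact ((h1 r).1 (by simp)).2

/-- The Hadamard matrix. -/
def hadamard (a b : Bool) : ℂ := ((Real.sqrt 2)⁻¹ : ℝ) * if a && b then -1 else 1

lemma inv_sqrt_two_mul_self :
    (((Real.sqrt 2)⁻¹ : ℝ) : ℂ) * (((Real.sqrt 2)⁻¹ : ℝ) : ℂ) = 1 / 2 := by
  rw [← Complex.ofReal_mul, ← mul_inv, Real.mul_self_sqrt (by norm_num)]
  norm_num

lemma star_hadamard (a b : Bool) : star (hadamard a b) = hadamard a b := by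
  cases a <;> cases b <;> simp [hadamard]

lemma sum_bits_one {ι : Type} [Unique ι] [Fintype ι] [DecidableEq ι] (F : (ι → Bool) → ℂ) :
    ∑ s, F s = F (fun _ => true) + F (fun _ => false) := by
  have : ∑ s, F s = ∑ b : Bool, F (fun _ => b) := by
    refine Fintype.sum_equiv (Equiv.funUnique ι Bool) _ _ fun s => ?_
    congr 1
    funext i
    rw [Unique.eq_default i]
    rfl
  rw [this, Fintype.sum_bool]

/-- The wire of a Hadamard gate. -/
def hadamardWire (a : W) : Fin 1 ↪ W := ⟨fun _ => a, fun i j _ => Subsingleton.elim i j⟩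

/-- The Hadamard matrix, on a register of one wire. -/
def hadamardMatrix : Op (Fin 1) := Matrix.of fun s t => hadamard (s 0) (t 0)

/-- The Hadamard gate. -/
def hadamardGate (a : W) : Gate W where
  arity := 1
  arity_le := by norm_num
  wires := hadamardWire a
  unitary := ⟨hadamardMatrix, by
    rw [Matrix.mem_unitaryGroup_iff']
    ext s t
    rw [Matrix.mul_apply, sum_bits_one]
    simp only [hadamardMatrix, Matrix.star_apply, Matrix.of_apply, star_hadamard, Matrix.one_apply]
    have hst : s = t ↔ s 0 = t 0 := by
      constructor
      · rintro rfl; rfl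
      · intro h; funext i; rwa [Subsingleton.elim i 0]
    simp only [hst, hadamard]
    have := inv_sqrt_two_mul_self
    generalize (((Real.sqrt 2)⁻¹ : ℝ) : ℂ) = z at this
    cases s 0 <;> cases t 0 <;> simp <;> linear_combination 2 * this⟩

lemma conjBy_hadamardGate (a : W) (Y : Op W) (s t : W → Bool) :
    conjBy (hadamardGate a).op Y s t = ∑ x : Bool, ∑ y : Bool,
      hadamard x (s a) * Y (Function.update s a x) (Function.update t a y) * hadamard y (t a) := by
  have hop : (hadamardGate a).op = liftOp (hadamardWire a) hadamardMatrix := rfl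
  rw [hop, conjBy_liftOp, loc_apply, conjBy_entry, sum_bits_one, sum_bits_one, sum_bits_one]
  have key : ∀ (s : W → Bool) (x : Bool), Function.extend (hadamardWire a)
      (fun _ : Fin 1 => x) s = Function.update s a x := by
    intro s x
    funext w
    by_cases h : w = a
    · subst h
      rw [Function.update_self]
      exact (hadamardWire w).injective.extend_apply (fun _ => x) s (0 : Fin 1)
    · rw [Function.update_of_ne h, Function.extend_apply']
      rintro ⟨i, hi⟩
      exact h hi.symm
  simp only [Matrix.submatrix_apply, hadamardMatrix, Matrix.of_apply, star_hadamard,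
    Fintype.sum_bool, key]
  rfl

/-! ### Preparation of states -/

/-- The expectation value of an observable in a state. -/
def stateFun (β : Op C) : Op C →ₗ[ℂ] ℂ where
  toFun M := ∑ c, ∑ c', β c' c * M c c'
  map_add' X Y := by simp only [Matrix.add_apply, mul_add, Finset.sum_add_distrib]
  map_smul' z X := by
    simp only [Matrix.smul_apply, smul_eq_mul, RingHom.id_apply, Finset.mul_sum]
    refine Finset.sum_congr rfl fun c _ => Finset.sum_congr rfl fun c' _ => ?_
    ring

/-- A linear functional as a map to observables of the empty register. -/
def prepMap (χ : Op C →ₗ[ℂ] ℂ) : Op C →ₗ[ℂ] Op Empty where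
  toFun M := Matrix.of fun _ _ => χ M
  map_add' X Y := by ext; simp
  map_smul' z X := by ext; simp

/-- Feeding a fixed state into a simulated channel gives a preparation without input, represented by
a map to the empty register. -/
lemma Sim.ofState {T : Fam d l → Op B →ₗ[ℂ] Op C} {s : ℕ} (h : Sim T s) (β : DensityOp C) :
    Sim (fun v => prepMap (stateFun β.mat ∘ₗ T v)) (Fintype.card C + s) := by
  classical
  have h1 := ((Sim.prep (d := d) (l := l) (A := Empty) β).comp
    (Sim.relabel (Function.Embedding.inr : C ↪ Empty ⊕ C))).comp h
  refine (h1.mono (by omega)).congr fun v M => ?_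
  ext x y
  simp only [LinearMap.comp_apply, slice_apply, liftOpL_apply]
  change _ = ∑ c, ∑ c', β.mat c' c * T v M c c'
  refine Finset.sum_congr rfl fun c _ => Finset.sum_congr rfl fun c' _ => ?_
  rw [liftOp_apply, if_pos]
  · rfl
  · rintro (w | w) hw
    · exact w.elim
    · exact absurd ⟨w, rfl⟩ hw

/-- Positive normalized functionals are prepared from a suitable ancilla state. -/
lemma Sim.const (χ : Op C →ₗ[ℂ] ℂ) (h1 : χ 1 = 1)
    (hpos : ∀ z : (C → Bool) → ℂ, 0 ≤ χ (Matrix.vecMulVec z (star z))) :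
    Sim (fun _ : Fam d l => prepMap χ) (Fintype.card C) := by
  have hexp : ∀ M : Op C, χ M = ∑ c, ∑ c', χ (Matrix.single c c' 1) * M c c' := by
    intro M
    conv_lhs => rw [Matrix.matrix_eq_sum_single M]
    simp only [map_sum]
    refine Finset.sum_congr rfl fun c _ => Finset.sum_congr rfl fun c' _ => ?_
    rw [show Matrix.single c c' (M c c') = M c c' • Matrix.single c c' (1 : ℂ) by
      rw [Matrix.smul_single, smul_eq_mul, mul_one], map_smul, smul_eq_mul, mul_comm]
  -- The density matrix that represents `χ`; the indices are transposed so that `χ M` is the trace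
  -- of `β * M`.
  let β : Op C := Matrix.of fun c' c => χ (Matrix.single c c' 1)
  have hform : ∀ z : (C → Bool) → ℂ, star z ⬝ᵥ β *ᵥ z = χ (Matrix.vecMulVec z (star z)) := by
    intro z
    rw [hexp]
    simp only [dotProduct, Matrix.mulVec, β, Matrix.of_apply, Matrix.vecMulVec_apply, Finset.mul_sum]
    rw [Finset.sum_comm]
    refine Finset.sum_congr rfl fun c _ => Finset.sum_congr rfl fun c' _ => ?_
    ring
  have hψ : β.PosSemidef := by
    rw [Matrix.posSemidef_iff_dotProduct_mulVec]
    have hreal : ∀ z : (C → Bool) → ℂ, 0 ≤ star z ⬝ᵥ β *ᵥ z := fun z => (hform z).symm ▸ hpos z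
    refine ⟨?_, hreal⟩
    -- Over the complex numbers, a matrix whose quadratic form is real is Hermitian.
    rw [← Matrix.isSymmetric_toEuclideanLin_iff, LinearMap.isSymmetric_iff_inner_map_self_real]
    intro z
    have h2 := hreal z.ofLp
    rw [Complex.le_def] at h2
    rw [Complex.conj_eq_iff_im]
    have h3 : inner ℂ ((Matrix.toEuclideanLin β) z) z = star (star z.ofLp ⬝ᵥ β *ᵥ z.ofLp) := by
      rw [EuclideanSpace.inner_eq_star_dotProduct, Matrix.star_dotProduct, star_star,
        dotProduct_comm]
      rfl
    rw [h3, Complex.star_def, Complex.conj_im, ← h2.2]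
    simp
  have htr : β.trace = 1 := by
    rw [← h1, hexp 1]
    simp [Matrix.trace, β, Matrix.one_apply]
  refine ((Sim.id (d := d) (l := l)).ofState ⟨β, hψ, htr⟩).congr fun v M => ?_
  ext x y
  exact (hexp M).symm

end Gates

/-! ### Public keys and ciphertexts from oracle queries. -/

section Encryption

variable {V W A B C D R : Type} [Fintype V] [DecidableEq V] [Fintype W] [DecidableEq W]
  [Fintype A] [DecidableEq A] [Fintype B] [DecidableEq B] [Fintype C] [DecidableEq C]
  [Fintype D] [DecidableEq D] [Fintype R] [DecidableEq R] {d l : ℕ}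

/-! ### Simulation of public keys and encryption -/

lemma amp_tensorPow (n : ℕ) (φ : PureState (Fin l)) (s : Fin n × Fin l → Bool) :
    amp (tensorPow n φ) s = ∏ i, amp φ (fun j => s (i, j)) := rfl

lemma conjBy_isometry (f : (A → Bool) → (B → Bool) → ℂ) (M : Op (A ⊕ B)) (x y : A → Bool) :
    conjBy (Matrix.of fun (s : A ⊕ B → Bool) x => if s ∘ Sum.inl = x then f x (s ∘ Sum.inr) else 0)
      M x y = ∑ u, ∑ u', star (f x u) * M (Sum.elim x u) (Sum.elim y u') * f y u' := by
  rw [conjBy_entry, sum_bits_sum, Finset.sum_eq_single x]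
  · refine Finset.sum_congr rfl fun u _ => ?_
    rw [sum_bits_sum, Finset.sum_eq_single y]
    · simp [Matrix.of_apply]
    · intro a _ ha
      simp [Matrix.of_apply, ha]
    · simp
  · intro a _ ha
    simp [Matrix.of_apply, ha]
  · simp

lemma stateOracle_dual_apply (v : Fam d l) (M : Op (Fin d ⊕ Fin l)) (x y : Fin d → Bool) :
    (stateOracle v).dual M x y = ∑ u, ∑ u',
      star (amp (v x) u) * M (Sum.elim x u) (Sum.elim y u') * amp (v y) u' := by
  rw [← conjBy_isometry (fun x u => amp (v x) u) M x y]
  have : (stateOracle v).dual = conjBy ((stateOracle v).kraus ()) :=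
    Fintype.sum_unique (ι := Unit) _
  rw [this]
  rfl

/-- The adjoint of the isometry `|x⟩ ↦ |x⟩|v x⟩^{⊗n}`. -/
def copiesMap (n : ℕ) (v : Fam d l) : Op (Fin d ⊕ (Fin n × Fin l)) →ₗ[ℂ] Op (Fin d) :=
  conjBy (Matrix.of fun (s : Fin d ⊕ (Fin n × Fin l) → Bool) x =>
    if s ∘ Sum.inl = x then amp (tensorPow n (v x)) (s ∘ Sum.inr) else 0)

lemma copiesMap_apply (n : ℕ) (v : Fam d l) (M : Op (Fin d ⊕ (Fin n × Fin l)))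
    (x y : Fin d → Bool) : copiesMap n v M x y = ∑ u, ∑ u', star (amp (tensorPow n (v x)) u) *
      M (Sum.elim x u) (Sum.elim y u') * amp (tensorPow n (v y)) u' :=
  conjBy_isometry (fun x u => amp (tensorPow n (v x)) u) M x y

lemma copiesMap_one (n : ℕ) (v : Fam d l) : copiesMap n v 1 = 1 := by
  ext x y
  rw [copiesMap_apply]
  by_cases h : x = y
  · subst h
    have h1 : ∀ u u' : Fin n × Fin l → Bool,
        (1 : Op (Fin d ⊕ (Fin n × Fin l))) (Sum.elim x u) (Sum.elim x u') =
        if u = u' then 1 else 0 := by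
      intro u u'
      rw [Matrix.one_apply]
      refine if_congr ?_ rfl rfl
      rw [sumBits_ext]
      simp
    simp only [h1, Matrix.one_apply_eq, mul_ite, mul_one, mul_zero, ite_mul, zero_mul,
      Finset.sum_ite_eq, Finset.mem_univ, if_true]
    exact sum_amp _
  · rw [Matrix.one_apply_ne h]
    refine Finset.sum_eq_zero fun u _ => Finset.sum_eq_zero fun u' _ => ?_
    rw [Matrix.one_apply_ne]
    · simp
    · intro hh
      exact h (sumBits_ext.1 hh).1

/-- The bit string with first row `φ` and remaining rows `u`. -/
def rowCons {n l : ℕ} (φ : Fin l → Bool) (u : Fin n × Fin l → Bool) : Fin (n + 1) × Fin l → Bool :=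
  fun p => (Fin.cons (φ p.2) (fun i => u (i, p.2)) : Fin (n + 1) → Bool) p.1

lemma sum_rowCons {n l : ℕ} (F : (Fin (n + 1) × Fin l → Bool) → ℂ) :
    ∑ U, F U = ∑ φ, ∑ u, F (rowCons φ u) := by
  rw [← Fintype.sum_prod_type']
  symm
  refine Fintype.sum_bijective (fun p : (Fin l → Bool) × (Fin n × Fin l → Bool) => rowCons p.1 p.2)
    ⟨?_, ?_⟩ _ _ fun _ => rfl
  · rintro ⟨φ, u⟩ ⟨φ', u'⟩ h
    refine Prod.ext (funext fun j => ?_) (funext fun p => ?_)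
    · exact congrFun h (0, j)
    · exact congrFun h (p.1.succ, p.2)
  · intro U
    refine ⟨(fun j => U (0, j), fun p => U (p.1.succ, p.2)), ?_⟩
    funext p
    obtain ⟨i, j⟩ := p
    refine Fin.cases ?_ (fun i => ?_) i <;> rfl

lemma amp_tensorPow_rowCons {n : ℕ} (v : PureState (Fin l)) (φ : Fin l → Bool)
    (u : Fin n × Fin l → Bool) :
    amp (tensorPow (n + 1) v) (rowCons φ u) = amp v φ * amp (tensorPow n v) u := by
  rw [amp_tensorPow, Fin.prod_univ_succ]
  rfl

/-- The wire at which the wire of a register with `n + 1` rows is found after splitting off the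
first row. -/
def splitRow {n l : ℕ} (p : Fin (n + 1) × Fin l) : Fin l ⊕ (Fin n × Fin l) :=
  (Fin.cons (Sum.inl p.2) (fun i => Sum.inr (i, p.2)) :
    Fin (n + 1) → Fin l ⊕ (Fin n × Fin l)) p.1

lemma splitRow_injective {n l : ℕ} : Function.Injective (splitRow (n := n) (l := l)) := by
  rintro ⟨i, j⟩ ⟨i', j'⟩
  refine Fin.cases ?_ (fun i => ?_) i <;> refine Fin.cases ?_ (fun i' => ?_) i' <;>
    simp +contextual [splitRow]

/-- The embedding splitting off the first row. -/
def copiesEmb (d n l : ℕ) :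
    Fin d ⊕ (Fin (n + 1) × Fin l) ↪ (Fin d ⊕ (Fin n × Fin l)) ⊕ Fin l :=
  ⟨Sum.elim (fun x => Sum.inl (Sum.inl x))
    (fun p => Sum.elim Sum.inr (fun q => Sum.inl (Sum.inr q)) (splitRow p)), by
    have hi : Function.Injective (Sum.elim Sum.inr (fun q => Sum.inl (Sum.inr q)) :
        Fin l ⊕ (Fin n × Fin l) → (Fin d ⊕ (Fin n × Fin l)) ⊕ Fin l) := by
      rintro (a | a) (b | b) h <;> simp_all
    rintro (x | p) (y | q) h
    · simpa using h
    · exfalso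
      revert h
      simp only [Sum.elim_inl, Sum.elim_inr]
      rcases splitRow q with z | z <;> simp
    · exfalso
      revert h
      simp only [Sum.elim_inl, Sum.elim_inr]
      rcases splitRow p with z | z <;> simp
    · exact congrArg Sum.inr (splitRow_injective (hi h))⟩

lemma copiesEmb_surjective (d n l : ℕ) (w : (Fin d ⊕ (Fin n × Fin l)) ⊕ Fin l) :
    w ∈ Set.range (copiesEmb d n l) := by
  rcases w with (x | p) | j
  · exact ⟨Sum.inl x, rfl⟩
  · exact ⟨Sum.inr (p.1.succ, p.2), rfl⟩
  · exact ⟨Sum.inr (0, j), rfl⟩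

lemma elim_comp_copiesEmb {n : ℕ} (x : Fin d → Bool) (u : Fin n × Fin l → Bool)
    (φ : Fin l → Bool) : (Sum.elim (Sum.elim x u) φ : (Fin d ⊕ (Fin n × Fin l)) ⊕ Fin l → Bool) ∘
      copiesEmb d n l = Sum.elim x (rowCons φ u) := by
  funext w
  rcases w with x | ⟨i, j⟩
  · rfl
  · refine Fin.cases ?_ (fun i => ?_) i <;> rfl

/-- The oracle returns `x` along with the state, so the same `x` can be queried again, in
superposition as well: `n` copies cost `n` queries. -/
lemma Sim.copies (n : ℕ) : Sim (fun v : Fam d l => copiesMap n v) (n * (d + l + 1)) := by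
  classical
  induction n with
  | zero =>
    -- With no copies the second register is empty, and the map is a mere renaming of the register
    -- of `x`.
    have hemb : Function.Injective (Sum.elim _root_.id (fun p => p.1.elim0) :
        Fin d ⊕ (Fin 0 × Fin l) → Fin d) := by
      rintro (x | p) (y | q) h
      · exact congrArg _ h
      · exact q.1.elim0
      · exact p.1.elim0
      · exact p.1.elim0
    refine ((Sim.relabel ⟨_, hemb⟩).mono (by simp)).congr fun v M => ?_
    ext x y
    rw [copiesMap_apply, liftOpL_apply, liftOp_apply, if_pos]
    · have : ∀ (x : Fin d → Bool) (u : Fin 0 × Fin l → Bool),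
          Sum.elim x u = x ∘ (Sum.elim _root_.id (fun p => p.1.elim0) :
            Fin d ⊕ (Fin 0 × Fin l) → Fin d) := by
        intro x u
        funext w
        rcases w with w | p
        · rfl
        · exact p.1.elim0
      simp only [amp_tensorPow, Finset.univ_eq_empty, Finset.prod_empty, star_one, one_mul, mul_one,
        this, Finset.sum_const, Finset.card_univ]
      simp
    · intro w hw
      exact absurd ⟨Sum.inl w, rfl⟩ hw
  | succ n ih =>
    -- One query supplies the first row. The remaining rows are made from the returned `x` with this
    -- row as spectator, and the rows are then merged.
    have h1 := ((Sim.oracle (d := d) (l := l)).comp (ih.tensor (Fin l))).comp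
      (Sim.relabel (copiesEmb d n l))
    refine (h1.mono (by ring_nf; omega)).congr fun v M => ?_
    ext x y
    simp only [LinearMap.comp_apply, liftOpL_apply]
    rw [stateOracle_dual_apply, copiesMap_apply, sum_rowCons]
    refine Finset.sum_congr rfl fun φ _ => ?_
    simp only [tensorId_elim, copiesMap_apply, Matrix.submatrix_apply]
    have hM : ∀ u u' φ φ', liftOp (copiesEmb d n l) M (Sum.elim (Sum.elim x u) φ)
        (Sum.elim (Sum.elim y u') φ') =
        M (Sum.elim x (rowCons φ u)) (Sum.elim y (rowCons φ' u')) := by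
      intro u u' φ φ'
      rw [liftOp_apply, if_pos, elim_comp_copiesEmb, elim_comp_copiesEmb]
      intro w hw
      exact absurd (copiesEmb_surjective d n l w) hw
    simp only [hM, sum_rowCons (n := n) (l := l), amp_tensorPow_rowCons, Finset.mul_sum,
      Finset.sum_mul]
    rw [Finset.sum_comm]
    refine Finset.sum_congr rfl fun u _ => Finset.sum_congr rfl fun φ' _ =>
      Finset.sum_congr rfl fun u' _ => ?_
    rw [star_mul']
    ring

/-- The uniformly random basis state. -/
def DensityOp.uniform (d : ℕ) : DensityOp (Fin d) where
  mat := Matrix.diagonal fun _ => (2 ^ d : ℂ)⁻¹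
  posSemidef := Matrix.PosSemidef.diagonal fun _ => by
    change (0 : ℂ) ≤ (2 ^ d : ℂ)⁻¹
    rw [show (2 ^ d : ℂ)⁻¹ = (((2 ^ d : ℝ)⁻¹ : ℝ) : ℂ) by push_cast; rfl]
    exact_mod_cast (by positivity : (0 : ℝ) ≤ (2 ^ d : ℝ)⁻¹)
  trace_eq_one := by simp [Matrix.trace_diagonal]

/-- The uniform superposition of all basis states. -/
def DensityOp.superposition (d : ℕ) : DensityOp (Fin d) where
  mat := Matrix.of fun _ _ => (2 ^ d : ℂ)⁻¹
  posSemidef := by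
    have h : (Matrix.of fun _ _ => (2 ^ d : ℂ)⁻¹ : Op (Fin d)) =
        Matrix.vecMulVec (fun _ => (((Real.sqrt (2 ^ d))⁻¹ : ℝ) : ℂ))
          (star fun _ => (((Real.sqrt (2 ^ d))⁻¹ : ℝ) : ℂ)) := by
      ext x y
      rw [Matrix.of_apply, Matrix.vecMulVec_apply, Pi.star_apply, Complex.star_def,
        Complex.conj_ofReal, ← Complex.ofReal_mul, ← mul_inv, Real.mul_self_sqrt (by positivity)]
      push_cast
      rfl
    rw [h]
    exact Matrix.posSemidef_vecMulVec_self_star _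
  trace_eq_one := by simp [Matrix.trace]

/-- The expectation value of an observable in an encryption of `0` under the state family `v`. -/
def ctFun (n : ℕ) (v : Fam d l) : Op (Fin d ⊕ (Fin n × Fin l)) →ₗ[ℂ] ℂ :=
  stateFun (DensityOp.uniform d).mat ∘ₗ copiesMap n v

/-- The expectation value of an observable in the public key of the state family `v`. -/
def pkFun (n : ℕ) (v : Fam d l) : Op (Fin d ⊕ (Fin n × Fin l)) →ₗ[ℂ] ℂ :=
  stateFun (DensityOp.superposition d).mat ∘ₗ copiesMap n v

lemma ctFun_apply (n : ℕ) (v : Fam d l) (M : Op (Fin d ⊕ (Fin n × Fin l))) :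
    ctFun n v M = ∑ x, (2 ^ d : ℂ)⁻¹ * copiesMap n v M x x := by
  change ∑ c, ∑ c', (DensityOp.uniform d).mat c' c * copiesMap n v M c c' = _
  refine Finset.sum_congr rfl fun x _ => ?_
  rw [Finset.sum_eq_single x]
  · simp [DensityOp.uniform]
  · intro y _ hy
    simp [DensityOp.uniform, Matrix.diagonal_apply_ne _ hy]
  · simp

lemma pkFun_apply (n : ℕ) (v : Fam d l) (M : Op (Fin d ⊕ (Fin n × Fin l))) :
    pkFun n v M = ∑ x, ∑ y, (2 ^ d : ℂ)⁻¹ * copiesMap n v M x y := rfl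

lemma ctFun_one (n : ℕ) (v : Fam d l) : ctFun n v 1 = 1 := by
  rw [ctFun_apply, copiesMap_one]
  simp

lemma Sim.ct (n : ℕ) : Sim (fun v : Fam d l => prepMap (ctFun n v)) (d + n * (d + l + 1)) :=
  ((Sim.copies n).ofState (DensityOp.uniform d)).mono (by simp)

lemma Sim.pk (n : ℕ) : Sim (fun v : Fam d l => prepMap (pkFun n v)) (d + n * (d + l + 1)) :=
  ((Sim.copies n).ofState (DensityOp.superposition d)).mono (by simp)

/-- Adjoin a register `C` in the state with expectation values `χ`. -/
def prependMap (R : Type) (χ : Op C →ₗ[ℂ] ℂ) : Op (C ⊕ R) →ₗ[ℂ] Op R where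
  toFun Y := Matrix.of fun r r' =>
    χ (Y.submatrix (fun c => Sum.elim c r) (fun c => Sum.elim c r'))
  map_add' X Y := by
    ext r r'
    simp only [Matrix.of_apply, Matrix.add_apply]
    rw [← map_add]; rfl
  map_smul' z X := by
    ext r r'
    simp only [Matrix.of_apply, Matrix.smul_apply, RingHom.id_apply]
    rw [← map_smul]; rfl

lemma Sim.prepend {χ : Fam d l → Op C →ₗ[ℂ] ℂ} {s : ℕ} (h : Sim (fun v => prepMap (χ v)) s)
    (R : Type) [Fintype R] [DecidableEq R] : Sim (fun v => prependMap R (χ v)) s := by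
  classical
  have h1 := (Sim.relabel (d := d) (l := l) (Equiv.emptySum Empty R).toEmbedding).comp (h.tensor R)
  refine (h1.mono (by omega)).congr fun v M => ?_
  ext r r'
  rw [LinearMap.comp_apply, liftOpL_apply, liftOp_apply, if_pos]
  · rfl
  · intro w hw
    exact absurd ⟨Sum.inr w, rfl⟩ hw

/-- Measure a register and prepare a state depending on the bit found on its wire `a`. -/
def selPrep (a : A) (χ₀ χ₁ : Op C →ₗ[ℂ] ℂ) : Op C →ₗ[ℂ] Op A where
  toFun M := Matrix.diagonal fun m => if m a then χ₁ M else χ₀ M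
  map_add' X Y := by
    rw [Matrix.diagonal_add]
    congr 1
    funext m
    split_ifs <;> simp
  map_smul' z X := by
    rw [RingHom.id_apply, ← Matrix.diagonal_smul]
    congr 1
    funext m
    rw [Pi.smul_apply]
    split_ifs <;> simp

lemma selPrep_apply (a : A) (χ₀ χ₁ : Op C →ₗ[ℂ] ℂ) (M : Op C) :
    selPrep a χ₀ χ₁ M = Matrix.diagonal fun m => if m a then χ₁ M else χ₀ M := rfl

/-- Both states are prepared, exchanged if the wire `a` is set, and only the first register is kept.
Normalisation of `χ₀` and `χ₁` is needed because the state not selected is discarded and contributes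
its value at 1. Discarding the register `A` as well has the effect of measuring it. -/
lemma Sim.select (a : A) {χ₀ χ₁ : Fam d l → Op C →ₗ[ℂ] ℂ} {s₀ s₁ : ℕ}
    (h₀ : Sim (fun v => prepMap (χ₀ v)) s₀) (h₁ : Sim (fun v => prepMap (χ₁ v)) s₁)
    (n₀ : ∀ v, χ₀ v 1 = 1) (n₁ : ∀ v, χ₁ v 1 = 1) :
    Sim (fun v => selPrep a (χ₀ v) (χ₁ v)) (s₀ + s₁ + Fintype.card C) := by
  classical
  obtain ⟨P, σ, hP, hσ1, hσ2, hσ3, hdual⟩ := exists_cswap_prog (W := C ⊕ (C ⊕ A)) d l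
    (Sum.inr (Sum.inr a)) (fun c : C => Sum.inl c) (fun c => Sum.inr (Sum.inl c))
    (by rintro (x | x) (y | y) h <;> simp_all) (by simp) (by simp)
  have h := (((h₁.prepend A).comp (h₀.prepend (C ⊕ A))).comp (Sim.prog P)).comp
    (Sim.relabel (d := d) (l := l) (Function.Embedding.inl : C ↪ C ⊕ (C ⊕ A)))
  refine (h.mono (by omega)).congr fun v M => ?_
  have hsw : ∀ (c c' : C → Bool) (m : A → Bool),
      (Sum.elim c (Sum.elim c' m) : C ⊕ (C ⊕ A) → Bool) ∘ σ = Sum.elim c' (Sum.elim c m) := by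
    intro c c' m
    funext w
    rcases w with w | w | w
    · rw [Function.comp_apply, hσ1]; rfl
    · rw [Function.comp_apply, hσ2]; rfl
    · rw [Function.comp_apply, hσ3 _ (by simp) (by simp)]; rfl
  have hif : ∀ (c c' : C → Bool) (m : A → Bool),
      (if (Sum.elim c (Sum.elim c' m) : C ⊕ (C ⊕ A) → Bool) (Sum.inr (Sum.inr a)) then
        (Sum.elim c (Sum.elim c' m) : C ⊕ (C ⊕ A) → Bool) ∘ σ else Sum.elim c (Sum.elim c' m)) =
      if m a then Sum.elim c' (Sum.elim c m) else Sum.elim c (Sum.elim c' m) := by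
    intro c c' m
    rw [hsw]
    rfl
  have hl : ∀ (c c₁ : C → Bool) (z z₁ : C ⊕ A → Bool),
      liftOp (Function.Embedding.inl : C ↪ C ⊕ (C ⊕ A)) M (Sum.elim c z) (Sum.elim c₁ z₁) =
        if z = z₁ then M c c₁ else 0 := by
    intro c c₁ z z₁
    rw [liftOp_apply]
    refine if_congr ⟨fun hh => funext fun w => hh (Sum.inr w) (by simp), ?_⟩ rfl rfl
    rintro rfl w hw
    rcases w with w | w
    · exact absurd ⟨w, rfl⟩ hw
    · rfl
  ext m m'
  simp only [LinearMap.comp_apply, liftOpL_apply]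
  rw [selPrep_apply]
  change χ₁ v (Matrix.of fun c' c₁' => χ₀ v (Matrix.of fun c c₁ =>
    famDual v P (liftOp Function.Embedding.inl M) (Sum.elim c (Sum.elim c' m))
      (Sum.elim c₁ (Sum.elim c₁' m')))) = _
  simp only [hdual, hif]
  by_cases hm : m = m'
  · subst hm
    rw [Matrix.diagonal_apply_eq]
    by_cases hma : m a
    · simp only [hma, if_true]
      have h2 : ∀ c' c₁', (Matrix.of fun c c₁ => liftOp (Function.Embedding.inl : C ↪ C ⊕ (C ⊕ A)) M
          (Sum.elim c' (Sum.elim c m)) (Sum.elim c₁' (Sum.elim c₁ m))) = M c' c₁' • (1 : Op C) := by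
        intro c' c₁'
        ext c c₁
        rw [Matrix.of_apply, hl, Matrix.smul_apply, Matrix.one_apply, smul_eq_mul, mul_ite, mul_one,
          mul_zero]
        refine if_congr ?_ rfl rfl
        rw [sumBits_ext]
        simp
      simp only [h2, map_smul, n₀, smul_eq_mul, mul_one]
      rfl
    · simp only [hma, Bool.false_eq_true, if_false]
      have h2 : ∀ c' c₁', (Matrix.of fun c c₁ => liftOp (Function.Embedding.inl : C ↪ C ⊕ (C ⊕ A)) M
          (Sum.elim c (Sum.elim c' m)) (Sum.elim c₁ (Sum.elim c₁' m))) =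
          (1 : Op C) c' c₁' • M := by
        intro c' c₁'
        ext c c₁
        rw [Matrix.of_apply, hl, Matrix.smul_apply, Matrix.one_apply, smul_eq_mul, ite_mul, one_mul,
          zero_mul]
        refine if_congr ?_ rfl rfl
        rw [sumBits_ext]
        simp
      simp only [h2, map_smul, smul_eq_mul]
      have h3 : (Matrix.of fun c' c₁' => (1 : Op C) c' c₁' * χ₀ v M) = χ₀ v M • (1 : Op C) := by
        ext c c'
        rw [Matrix.of_apply, Matrix.smul_apply, smul_eq_mul, mul_comm]
      rw [h3, map_smul, n₁, smul_eq_mul, mul_one]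
  -- Off the diagonal everything vanishes: the wires of `A` are discarded, so their two strings
  -- would have to agree.
  · rw [Matrix.diagonal_apply_ne _ hm]
    have hz : ∀ c c' c₁ c₁' : C → Bool, liftOp (Function.Embedding.inl : C ↪ C ⊕ (C ⊕ A)) M
        (if m a then Sum.elim c' (Sum.elim c m) else Sum.elim c (Sum.elim c' m))
        (if m' a then Sum.elim c₁' (Sum.elim c₁ m') else Sum.elim c₁ (Sum.elim c₁' m')) = 0 := by
      intro c c' c₁ c₁'
      have hne : ∀ x y : C → Bool, (Sum.elim x m : C ⊕ A → Bool) ≠ Sum.elim y m' := by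
        intro x y hh
        exact hm (sumBits_ext.1 hh).2
      split_ifs <;> rw [hl, if_neg (hne _ _)]
    simp only [hz]
    have h0 : (Matrix.of fun _ _ => (0 : ℂ) : Op C) = 0 := rfl
    rw [h0, map_zero, h0, map_zero]

end Encryption

/-! ### The circuit for a single SWAP test. -/

section Decryption

variable {d l : ℕ}

/-! ### Simulation of decryption -/

/-- Entries of the observable `(1 + |φ⟩⟨φ|) / 2`: a SWAP test against `φ` has outcome `0`. -/
def testEntry (φ : PureState (Fin l)) (a b : Fin l → Bool) : ℂ :=
  1 / 2 * ((if a = b then 1 else 0) + amp φ a * star (amp φ b))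

/-- Entries of the observable "all SWAP tests against the copies of `φ` have outcome `0`". -/
def testsEntry (n : ℕ) (φ : PureState (Fin l)) (u u' : Fin n × Fin l → Bool) : ℂ :=
  ∏ i, testEntry φ (fun j => u (i, j)) (fun j => u' (i, j))

lemma testsEntry_rowCons {n : ℕ} (φ : PureState (Fin l)) (a b : Fin l → Bool)
    (u u' : Fin n × Fin l → Bool) : testsEntry (n + 1) φ (rowCons a u) (rowCons b u') =
      testEntry φ a b * testsEntry n φ u u' := by
  rw [testsEntry, Fin.prod_univ_succ]
  rfl

/-- The wires of one SWAP test: input `x`, reference copy, flag, tested copy, and two ancillas. -/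
abbrev TestWires (d l : ℕ) : Type := ((Fin d ⊕ Fin l) ⊕ (Unit ⊕ Fin l)) ⊕ Bool

/-- A bit string on the wires of one SWAP test. -/
def testBits (x : Fin d → Bool) (φ : Fin l → Bool) (f : Unit → Bool) (ψ : Fin l → Bool)
    (a o : Bool) : TestWires d l → Bool :=
  Sum.elim (Sum.elim (Sum.elim x φ) (Sum.elim f ψ)) (fun b => cond b o a)

/-- The output wires of one SWAP test. -/
def testOut (d l : ℕ) : Fin d ⊕ Unit ↪ TestWires d l :=
  ⟨Sum.elim (fun x => Sum.inl (Sum.inl (Sum.inl x))) (fun f => Sum.inl (Sum.inr (Sum.inl f))), by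
    rintro (x | x) (y | y) h <;> simp_all⟩

lemma liftOp_testOut (N : Op (Fin d ⊕ Unit)) (x x' : Fin d → Bool) (φ φ' : Fin l → Bool)
    (f f' : Unit → Bool) (ψ ψ' : Fin l → Bool) (a a' o o' : Bool) :
    liftOp (testOut d l) N (testBits x φ f ψ a o) (testBits x' φ' f' ψ' a' o') =
      if φ = φ' ∧ ψ = ψ' ∧ a = a' ∧ o = o' then N (Sum.elim x f) (Sum.elim x' f') else 0 := by
  classical
  rw [liftOp_apply]
  have h1 : ∀ (x : Fin d → Bool) (φ : Fin l → Bool) (f : Unit → Bool) (ψ : Fin l → Bool)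
      (a o : Bool), testBits x φ f ψ a o ∘ testOut d l = Sum.elim x f := by
    intro x φ f ψ a o
    funext w
    rcases w with w | w <;> rfl
  rw [h1, h1]
  refine if_congr ⟨fun h => ⟨funext fun j => ?_, funext fun j => ?_, ?_, ?_⟩, ?_⟩ rfl rfl
  · exact h (Sum.inl (Sum.inl (Sum.inr j))) (by rintro ⟨w | w, hw⟩ <;> cases hw)
  · exact h (Sum.inl (Sum.inr (Sum.inr j))) (by rintro ⟨w | w, hw⟩ <;> cases hw)
  · exact h (Sum.inr false) (by rintro ⟨w | w, hw⟩ <;> cases hw)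
  · exact h (Sum.inr true) (by rintro ⟨w | w, hw⟩ <;> cases hw)
  · rintro ⟨rfl, rfl, rfl, rfl⟩ w hw
    rcases w with ((w | w) | (w | w)) | w
    · exact absurd ⟨Sum.inl w, rfl⟩ hw
    · rfl
    · exact absurd ⟨Sum.inr w, rfl⟩ hw
    · rfl
    · rfl

/-- The ancillas of one SWAP test: a control wire in the state `|+⟩` and a wire in the state
`|1⟩`. -/
def DensityOp.testAnc : DensityOp Bool where
  mat := Matrix.of fun s t => if s true && t true then 1 / 2 else 0
  posSemidef := by
    have h : (Matrix.of fun s t => if s true && t true then 1 / 2 else 0 : Op Bool) =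
        Matrix.vecMulVec (fun s => if s true then (((Real.sqrt 2)⁻¹ : ℝ) : ℂ) else 0)
          (star fun s => if s true then (((Real.sqrt 2)⁻¹ : ℝ) : ℂ) else 0) := by
      ext s t
      rw [Matrix.of_apply, Matrix.vecMulVec_apply, Pi.star_apply, ← inv_sqrt_two_mul_self]
      cases s true <;> cases t true <;> simp
    rw [h]
    exact Matrix.posSemidef_vecMulVec_self_star _
  trace_eq_one := by
    have : ∑ s : Bool → Bool, (if s true && s true then 1 / 2 else 0 : ℂ) =
        ∑ p : Bool × Bool, if p.2 && p.2 then 1 / 2 else 0 :=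
      Fintype.sum_equiv (Equiv.boolArrowEquivProd Bool) _ _ fun _ => rfl
    rw [Matrix.trace]
    simp only [Matrix.diag_apply, Matrix.of_apply]
    rw [this]
    simp [Fintype.sum_prod_type]

lemma sum_bits_bool (F : (Bool → Bool) → ℂ) :
    ∑ s, F s = ∑ a : Bool, ∑ o : Bool, F (fun b => cond b o a) := by
  rw [← Fintype.sum_prod_type']
  refine Fintype.sum_equiv (Equiv.boolArrowEquivProd Bool) _ _ fun s => ?_
  congr 1
  funext b
  cases b <;> rfl

lemma slice_testAnc (Y : Op (TestWires d l)) (x x' : Fin d → Bool) (φ φ' : Fin l → Bool)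
    (f f' : Unit → Bool) (ψ ψ' : Fin l → Bool) :
    slice DensityOp.testAnc.mat Y (Sum.elim (Sum.elim x φ) (Sum.elim f ψ))
      (Sum.elim (Sum.elim x' φ') (Sum.elim f' ψ')) =
    1 / 2 * ∑ a : Bool, ∑ a' : Bool,
      Y (testBits x φ f ψ a true) (testBits x' φ' f' ψ' a' true) := by
  rw [slice_apply]
  simp only [sum_bits_bool, DensityOp.testAnc, Matrix.of_apply, Fintype.sum_bool, cond_true,
    Bool.and_self, Bool.and_false, Bool.false_and, Bool.false_eq_true, if_true, if_false, zero_mul,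
    add_zero, testBits]
  ring

/-- The outcomes of the test are the projectors `(1 ± SWAP) / 2`, with values `n₀` and `n₁`. In the
reference state `g` the identity averages to 1 and SWAP to `|g⟩⟨g|`, so the two outcomes become `(1
± |g⟩⟨g|) / 2`. -/
lemma sum_swapTest (g : (Fin l → Bool) → ℂ) (hg : ∑ φ, star (g φ) * g φ = 1)
    (ψ ψ' : Fin l → Bool) (n₀ n₁ : ℂ) :
    ∑ φ, ∑ φ', star (g φ) * (1 / 2 * ((if φ = φ' ∧ ψ = ψ' then n₀ + n₁ else 0) +
        (if φ = ψ' ∧ ψ = φ' then n₀ - n₁ else 0))) * g φ' =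
      1 / 2 * ((if ψ = ψ' then 1 else 0) + g ψ * star (g ψ')) * n₀ +
        ((if ψ = ψ' then 1 else 0) - 1 / 2 * ((if ψ = ψ' then 1 else 0) + g ψ * star (g ψ'))) *
          n₁ := by
  have h1 : ∑ φ, ∑ φ', star (g φ) * (1 / 2 * (if φ = φ' ∧ ψ = ψ' then n₀ + n₁ else 0)) * g φ' =
      1 / 2 * (if ψ = ψ' then n₀ + n₁ else 0) := by
    have : ∀ φ φ', star (g φ) * (1 / 2 * (if φ = φ' ∧ ψ = ψ' then n₀ + n₁ else 0)) * g φ' =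
        if φ = φ' then 1 / 2 * (if ψ = ψ' then n₀ + n₁ else 0) * (star (g φ) * g φ') else 0 := by
      intro φ φ'
      rw [ite_and]
      split_ifs <;> ring
    simp only [this, Finset.sum_ite_eq, Finset.mem_univ, if_true, ← Finset.mul_sum, hg, mul_one]
  have h2 : ∑ φ, ∑ φ', star (g φ) * (1 / 2 * (if φ = ψ' ∧ ψ = φ' then n₀ - n₁ else 0)) * g φ' =
      1 / 2 * (g ψ * star (g ψ') * (n₀ - n₁)) := by
    have : ∀ φ φ', star (g φ) * (1 / 2 * (if φ = ψ' ∧ ψ = φ' then n₀ - n₁ else 0)) * g φ' =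
        if ψ = φ' then (if φ = ψ' then 1 / 2 * (g φ' * star (g φ) * (n₀ - n₁)) else 0) else 0 := by
      intro φ φ'
      rw [ite_and]
      split_ifs <;> ring
    simp only [this, Finset.sum_ite_eq, Finset.sum_ite_eq', Finset.mem_univ, if_true]
  simp only [mul_add, add_mul, Finset.sum_add_distrib]
  rw [h1, h2]
  split_ifs <;> ring

/-- One SWAP test against a reference copy, followed by setting a flag if the outcome is `1`. -/
lemma exists_testStep (d l : ℕ) :
    ∃ T : Fam d l → Op (Fin d ⊕ Unit) →ₗ[ℂ] Op ((Fin d ⊕ Unit) ⊕ Fin l),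
      Sim T (d + 2 * l + 5) ∧ ∀ v (N : Op (Fin d ⊕ Unit)),
      (∀ x f x' f', x ≠ x' → N (Sum.elim x f) (Sum.elim x' f') = 0) →
      ∀ x f ψ x' f' ψ', T v N (Sum.elim (Sum.elim x f) ψ) (Sum.elim (Sum.elim x' f') ψ') =
        if x = x' then testEntry (v x) ψ ψ' * N (Sum.elim x f) (Sum.elim x' f') +
          ((if ψ = ψ' then 1 else 0) - testEntry (v x) ψ ψ') *
            (if f = f' then N (Sum.elim x fun _ => true) (Sum.elim x' fun _ => true) else 0)
        else 0 := by
  classical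
  -- The controlled swap of reference and tested copy, with the control in the state `|+⟩`.
  obtain ⟨P₁, σ, hP₁, hσ1, hσ2, hσ3, hd₁⟩ := exists_cswap_prog (W := TestWires d l) d l
    (Sum.inr false) (fun j : Fin l => Sum.inl (Sum.inl (Sum.inr j)))
    (fun j => Sum.inl (Sum.inr (Sum.inr j)))
    (by rintro (x | x) (y | y) h <;> simp_all) (by simp) (by simp)
  -- After the Hadamard gate the control carries the outcome. If it is 1, the flag is exchanged with
  -- an ancilla in the state `|1⟩`; this records a failure without ever clearing an earlier one.
  obtain ⟨P₂, τ, hP₂, hτ1, hτ2, hτ3, hd₂⟩ := exists_cswap_prog (W := TestWires d l) d l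
    (Sum.inr false) (fun _ : Unit => Sum.inl (Sum.inr (Sum.inl ())))
    (fun _ => Sum.inr true)
    (by rintro (x | x) (y | y) h <;> simp_all) (by simp) (by simp)
  let r : Fin d ⊕ (Unit ⊕ Fin l) ↪ (Fin d ⊕ Unit) ⊕ Fin l :=
    (Equiv.sumAssoc (Fin d) Unit (Fin l)).symm.toEmbedding
  have hsim := ((((Sim.relabel (d := d) (l := l) r).comp
    ((Sim.oracle (d := d) (l := l)).tensor (Unit ⊕ Fin l))).comp
    (Sim.prep DensityOp.testAnc)).comp (Sim.prog (P₁ ++ Instr.gate (hadamardGate (Sum.inr false)) :: P₂))).comp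
    (Sim.relabel (testOut d l))
  refine ⟨_, hsim.mono ?_, ?_⟩
  · simp only [List.length_append, List.length_cons, hP₁, hP₂, Fintype.card_bool, Fintype.card_fin,
      Fintype.card_unit]
    omega
  intro v N hN x f ψ x' f' ψ'
  have hπ1 : ∀ (x : Fin d → Bool) (φ : Fin l → Bool) (f : Unit → Bool) (ψ : Fin l → Bool)
      (a o : Bool), (if testBits x φ f ψ a o (Sum.inr false) then testBits x φ f ψ a o ∘ σ else
        testBits x φ f ψ a o) = if a then testBits x ψ f φ a o else testBits x φ f ψ a o := by
    intro x φ f ψ a o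
    refine if_congr Iff.rfl ?_ rfl
    funext w
    rcases w with ((w | w) | (w | w)) | w
    · rw [Function.comp_apply, hσ3 _ (by simp) (by simp)]; rfl
    · rw [Function.comp_apply, hσ1]; rfl
    · rw [Function.comp_apply, hσ3 _ (by simp) (by simp)]; rfl
    · rw [Function.comp_apply, hσ2]; rfl
    · rw [Function.comp_apply, hσ3 _ (by simp) (by simp)]; rfl
  have hπ2 : ∀ (x : Fin d → Bool) (φ : Fin l → Bool) (f : Unit → Bool) (ψ : Fin l → Bool)
      (a o : Bool), (if testBits x φ f ψ a o (Sum.inr false) then testBits x φ f ψ a o ∘ τ else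
        testBits x φ f ψ a o) =
        if a then testBits x φ (fun _ => o) ψ a (f ()) else testBits x φ f ψ a o := by
    intro x φ f ψ a o
    refine if_congr Iff.rfl ?_ rfl
    funext w
    rcases w with ((w | w) | (w | w)) | w
    · rw [Function.comp_apply, hτ3 _ (by simp) (by simp)]; rfl
    · rw [Function.comp_apply, hτ3 _ (by simp) (by simp)]; rfl
    · rw [Function.comp_apply, hτ1 w]; rfl
    · rw [Function.comp_apply, hτ3 _ (by simp) (by simp)]; rfl
    · cases w
      · rw [Function.comp_apply, hτ3 _ (by simp) (by simp)]; rfl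
      · rw [Function.comp_apply, hτ2 ()]; rfl
  have hupd : ∀ (x : Fin d → Bool) (φ : Fin l → Bool) (f : Unit → Bool) (ψ : Fin l → Bool)
      (a o a' : Bool), Function.update (testBits x φ f ψ a o) (Sum.inr false) a' =
        testBits x φ f ψ a' o := by
    intro x φ f ψ a o a'
    funext w
    rcases w with w | w
    · rw [Function.update_of_ne (by simp)]; rfl
    · cases w
      · rw [Function.update_self]; rfl
      · rw [Function.update_of_ne (by simp)]; rfl
  have hfun : ∀ f f' : Unit → Bool, f () = f' () ↔ f = f' :=
    fun f f' => ⟨fun h => funext fun _ => h, fun h => by rw [h]⟩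
  -- the observable after the last controlled swap
  have hY2 : ∀ (φ φ' ψ ψ' : Fin l → Bool) (a a' : Bool),
      famDual v P₂ (liftOp (testOut d l) N) (testBits x φ f ψ a true)
        (testBits x' φ' f' ψ' a' true) =
      if a = a' ∧ φ = φ' ∧ ψ = ψ' then
        (if a then (if f = f' then N (Sum.elim x fun _ => true) (Sum.elim x' fun _ => true) else 0)
          else N (Sum.elim x f) (Sum.elim x' f')) else 0 := by
    intro φ φ' ψ ψ' a a'
    rw [hd₂, hπ2, hπ2]
    cases a <;> cases a' <;> simp [liftOp_testOut, hfun, ite_and]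
  set n₁ : ℂ := if f = f' then N (Sum.elim x fun _ => true) (Sum.elim x' fun _ => true) else 0
    with hn₁
  set n₀ : ℂ := N (Sum.elim x f) (Sum.elim x' f') with hn₀
  -- The initial `|+⟩` sums over the control bits before the first swap, and the Hadamard gate
  -- produces the signs: this is the SWAP test, with the identity and the exchange of copies as its
  -- two terms.
  have hY : ∀ (φ φ' : Fin l → Bool),
      slice DensityOp.testAnc.mat
        (famDual v (P₁ ++ Instr.gate (hadamardGate (Sum.inr false)) :: P₂)
          (liftOp (testOut d l) N)) (Sum.elim (Sum.elim x φ) (Sum.elim f ψ))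
          (Sum.elim (Sum.elim x' φ') (Sum.elim f' ψ')) =
      1 / 2 * ((if φ = φ' ∧ ψ = ψ' then n₀ + n₁ else 0) +
        (if φ = ψ' ∧ ψ = φ' then n₀ - n₁ else 0)) := by
    intro φ φ'
    have hsplit : famDual v (P₁ ++ Instr.gate (hadamardGate (Sum.inr false)) :: P₂)
        (liftOp (testOut d l) N) = famDual v P₁ (conjBy (hadamardGate (Sum.inr false)).op
          (famDual v P₂ (liftOp (testOut d l) N))) := by
      rw [famDual, progDual_append]
      rfl
    rw [hsplit, slice_testAnc]
    have hH : ∀ (φ φ' ψ ψ' : Fin l → Bool) (a a' : Bool),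
        conjBy (hadamardGate (Sum.inr false)).op (famDual v P₂ (liftOp (testOut d l) N))
          (testBits x φ f ψ a true) (testBits x' φ' f' ψ' a' true) =
        if φ = φ' ∧ ψ = ψ' then 1 / 2 * (n₀ + (if a = a' then n₁ else -n₁)) else 0 := by
      intro φ φ' ψ ψ' a a'
      rw [conjBy_hadamardGate]
      simp only [hupd, hY2]
      have ha : ∀ (x : Fin d → Bool) (φ : Fin l → Bool) (f : Unit → Bool) (ψ : Fin l → Bool)
        (a o : Bool), testBits x φ f ψ a o (Sum.inr false) = a := fun _ _ _ _ _ _ => rfl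
      simp only [ha, Fintype.sum_bool]
      have hz := inv_sqrt_two_mul_self
      simp only [hadamard]
      generalize (((Real.sqrt 2)⁻¹ : ℝ) : ℂ) = z at hz
      by_cases hc : φ = φ' ∧ ψ = ψ'
      · cases a <;> cases a' <;> simp [hc]
        · linear_combination (n₀ + n₁) * hz
        · linear_combination (n₀ - n₁) * hz
        · linear_combination (n₀ - n₁) * hz
        · linear_combination (n₀ + n₁) * hz
      · simp [hc]
    simp only [hd₁, hπ1, Fintype.sum_bool, if_true, Bool.false_eq_true, if_false, hH]
    have e1 : (ψ = ψ' ∧ φ = φ') ↔ (φ = φ' ∧ ψ = ψ') := and_comm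
    have e2 : (ψ = φ' ∧ φ = ψ') ↔ (φ = ψ' ∧ ψ = φ') := and_comm
    simp only [e1, e2, Bool.true_eq_false, if_false]
    split_ifs <;> ring
  have hrel : ∀ Q : Op (Fin d ⊕ (Unit ⊕ Fin l)), liftOp r Q (Sum.elim (Sum.elim x f) ψ)
      (Sum.elim (Sum.elim x' f') ψ') = Q (Sum.elim x (Sum.elim f ψ)) (Sum.elim x' (Sum.elim f' ψ')) := by
    intro Q
    rw [liftOp_apply, if_pos]
    · congr 1 <;> (funext w; rcases w with w | w | w <;> rfl)
    · intro w hw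
      refine absurd ⟨Equiv.sumAssoc _ _ _ w, ?_⟩ hw
      exact (Equiv.sumAssoc _ _ _).symm_apply_apply w
  simp only [LinearMap.comp_apply, liftOpL_apply]
  rw [hrel, tensorId_elim, stateOracle_dual_apply]
  simp only [Matrix.submatrix_apply, hY]
  -- Only the block-diagonal part is claimed. Off the diagonal the references would belong to
  -- different states, but there `N` vanishes: `x` is discarded in the end.
  by_cases hx : x = x'
  · subst hx
    rw [if_pos rfl]
    rw [sum_swapTest _ (sum_amp (v x)), testEntry]
  · rw [if_neg hx]
    have h0 : n₀ = 0 := hN _ _ _ _ hx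
    have h1 : n₁ = 0 := by
      rw [hn₁, hN _ _ _ _ hx, ite_self]
    simp [h0, h1]

end Decryption

/-! ### All SWAP tests in sequence, and their agreement with the decryption channel. -/

section DecryptionOracle

variable {d l : ℕ}

/-- The embedding moving the first row of a ciphertext next to the input and the flag. -/
def flagEmb (d n l : ℕ) : ((Fin d ⊕ Unit) ⊕ Fin l) ⊕ (Fin n × Fin l) ↪
    (Fin d ⊕ Unit) ⊕ (Fin (n + 1) × Fin l) :=
  ⟨Sum.elim (Sum.elim Sum.inl (fun j => Sum.inr (0, j))) (fun p => Sum.inr (p.1.succ, p.2)), by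
    rintro ((a | a) | a) ((b | b) | b) h <;> simp_all [Fin.succ_ne_zero, Prod.ext_iff]
    exact absurd h.1 (Fin.succ_ne_zero _).symm⟩

lemma flagEmb_surjective (d n l : ℕ) (w : (Fin d ⊕ Unit) ⊕ (Fin (n + 1) × Fin l)) :
    w ∈ Set.range (flagEmb d n l) := by
  rcases w with w | ⟨i, j⟩
  · exact ⟨Sum.inl (Sum.inl w), rfl⟩
  · refine Fin.cases ?_ (fun i => ?_) i
    · exact ⟨Sum.inl (Sum.inr j), rfl⟩
    · exact ⟨Sum.inr (i, j), rfl⟩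

lemma rowCons_eq_iff {n : ℕ} (φ φ' : Fin l → Bool) (u u' : Fin n × Fin l → Bool) :
    rowCons φ u = rowCons φ' u' ↔ φ = φ' ∧ u = u' := by
  constructor
  · intro h
    exact ⟨funext fun j => congrFun h (0, j), funext fun p => congrFun h (p.1.succ, p.2)⟩
  · rintro ⟨rfl, rfl⟩; rfl

lemma exists_rowCons {n : ℕ} (U : Fin (n + 1) × Fin l → Bool) :
    ∃ φ u, U = rowCons φ u := by
  refine ⟨fun j => U (0, j), fun p => U (p.1.succ, p.2), ?_⟩
  funext p
  obtain ⟨i, j⟩ := p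
  refine Fin.cases ?_ (fun i => ?_) i <;> rfl

/-- The SWAP tests of all rows, setting a flag if one of the outcomes is `1`. -/
lemma exists_flagMap (d l n : ℕ) :
    ∃ T : Fam d l → Op Unit →ₗ[ℂ] Op ((Fin d ⊕ Unit) ⊕ (Fin n × Fin l)),
      Sim T (n * (d + 2 * l + 5)) ∧ ∀ v G x f u x' f' u',
      T v G (Sum.elim (Sum.elim x f) u) (Sum.elim (Sum.elim x' f') u') =
        if x = x' then testsEntry n (v x) u u' * G f f' +
          ((if u = u' then 1 else 0) - testsEntry n (v x) u u') *
            (if f = f' then G (fun _ => true) (fun _ => true) else 0)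
        else 0 := by
  classical
  induction n with
  | zero =>
    let r : Unit ↪ (Fin d ⊕ Unit) ⊕ (Fin 0 × Fin l) :=
      Function.Embedding.inr.trans Function.Embedding.inl
    refine ⟨_, (Sim.relabel r).mono (by simp), ?_⟩
    intro v G x f u x' f' u'
    rw [liftOpL_apply, liftOp_apply]
    have hu : u = u' := funext fun p => p.1.elim0
    have ht : testsEntry 0 (v x) u u' = 1 := by
      rw [testsEntry, Finset.univ_eq_empty, Finset.prod_empty]
    rw [ht, if_pos hu]
    simp only [one_mul, sub_self, zero_mul, add_zero]
    refine if_congr ⟨fun h => funext fun j => ?_, ?_⟩ rfl rfl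
    · exact h (Sum.inl (Sum.inl j)) (by rintro ⟨w, hw⟩; cases hw)
    · rintro rfl w hw
      rcases w with (w | w) | w
      · rfl
      · exact absurd ⟨w, rfl⟩ hw
      · exact w.1.elim0
  | succ n ih =>
    obtain ⟨T, hT, hTv⟩ := ih
    obtain ⟨S, hS, hSv⟩ := exists_testStep d l
    -- The first row is tested first, then the others, with the flag passed along. Running the later
    -- tests on a flag that is already set does not change it.
    have hsim := ((Sim.relabel (d := d) (l := l) (flagEmb d n l)).comp
      (hS.tensor (Fin n × Fin l))).comp hT
    refine ⟨_, hsim.mono (by ring_nf; omega), ?_⟩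
    intro v G x f U x' f' U'
    obtain ⟨φ, u, rfl⟩ := exists_rowCons U
    obtain ⟨φ', u', rfl⟩ := exists_rowCons U'
    have hcomp : ∀ (x : Fin d → Bool) (f : Unit → Bool) (φ : Fin l → Bool)
        (u : Fin n × Fin l → Bool), (Sum.elim (Sum.elim x f) (rowCons φ u) :
          (Fin d ⊕ Unit) ⊕ (Fin (n + 1) × Fin l) → Bool) ∘ flagEmb d n l =
        Sum.elim (Sum.elim (Sum.elim x f) φ) u := by
      intro x f φ u
      funext w
      rcases w with ((w | w) | w) | w <;> rfl
    simp only [LinearMap.comp_apply, liftOpL_apply]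
    rw [liftOp_apply, if_pos (fun w hw => absurd (flagEmb_surjective d n l w) hw), hcomp, hcomp,
      tensorId_elim, hSv]
    -- With `p` for the first test and `q` for the rest, the flag is left alone with operator `p *
    -- q` and set with the complement of this product; the terms for a failure now and a failure
    -- later add up to it.
    · simp only [Matrix.submatrix_apply, hTv, testsEntry_rowCons, rowCons_eq_iff]
      by_cases hx : x = x'
      · subst hx
        simp only [if_true, ite_and]
        generalize testEntry (v x) φ φ' = p
        generalize testsEntry n (v x) u u' = q
        split_ifs <;> ring
      · simp only [hx, if_false]
    -- The remaining tests vanish off the diagonal in `x`, as the first test requires.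
    · intro y g y' g' hy
      rw [Matrix.submatrix_apply, hTv, if_neg hy]

/-! The adjoint of the decryption channel. -/

lemma swapTestsMeas_proj (n l : ℕ) (b : Bool) :
    (swapTestsMeas n l b)ᴴ * swapTestsMeas n l b = swapTestsMeas n l b := by
  have h1 : (allSwapTestsZero n l)ᴴ = allSwapTestsZero n l := by
    ext p q
    simp only [Matrix.conjTranspose_apply, allSwapTestsZero, Matrix.of_apply, star_prod,
      swapTestZero_herm]
  -- Idempotence is read off from completeness: `Z * Z + (1 - Z) * (1 - Z) = 1` forces `2 Z² = 2 Z`.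
  have h2 : allSwapTestsZero n l * allSwapTestsZero n l = allSwapTestsZero n l := by
    have h := swapTestsMeas_complete n l
    simp only [Fintype.sum_bool, swapTestsMeas, if_true, Bool.false_eq_true, if_false,
      Matrix.conjTranspose_sub, Matrix.conjTranspose_one, h1, mul_sub, sub_mul, mul_one,
      one_mul] at h
    have h3 : (2 : ℂ) • (allSwapTestsZero n l * allSwapTestsZero n l) =
        (2 : ℂ) • allSwapTestsZero n l := by
      rw [two_smul, two_smul]
      generalize allSwapTestsZero n l * allSwapTestsZero n l = X at h
      generalize allSwapTestsZero n l = Z at h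
      have h4 : X + X - (Z + Z) = (1 - Z - (Z - X) + X) - 1 := by abel
      rw [h, sub_self] at h4
      exact sub_eq_zero.1 h4
    exact smul_right_injective _ (two_ne_zero) h3
  cases b
  · simp only [swapTestsMeas, Bool.false_eq_true, if_false, h1, h2]
  · simp only [swapTestsMeas, if_true, Matrix.conjTranspose_sub, Matrix.conjTranspose_one, h1,
      mul_sub, sub_mul, mul_one, one_mul, h2]
    abel

lemma sum_swapTestZero (g : (Fin l → Bool) → ℂ) (hg : ∑ φ, star (g φ) * g φ = 1)
    (a b : Fin l → Bool) : ∑ φ, ∑ φ', star (g φ) * swapTestZero (Fin l → Bool) (a, φ) (b, φ') *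
      g φ' = 1 / 2 * ((if a = b then 1 else 0) + g a * star (g b)) := by
  have h := sum_swapTest g hg a b 1 0
  simp only [add_zero, sub_zero, mul_one, mul_zero] at h
  rw [← h]
  refine Finset.sum_congr rfl fun φ _ => Finset.sum_congr rfl fun φ' _ => ?_
  congr 2
  simp only [swapTestZero, Matrix.smul_apply, Matrix.add_apply, Matrix.of_apply, Matrix.one_apply,
    smul_eq_mul, Prod.mk.injEq, Prod.swap_prod_mk]
  congr 2
  · exact if_congr and_comm rfl rfl
  · exact if_congr and_comm rfl rfl

/-- Reference copies and tests are both products over the rows, so the expectation factors into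
single SWAP tests. -/
lemma sum_allSwapTestsZero (n : ℕ) (φ : PureState (Fin l)) (u u' : Fin n × Fin l → Bool) :
    ∑ w, ∑ w', star (amp (tensorPow n φ) w) * allSwapTestsZero n l (u, w) (u', w') *
      amp (tensorPow n φ) w' = testsEntry n φ u u' := by
  rw [testsEntry]
  simp only [testEntry, ← sum_swapTestZero _ (sum_amp φ), amp_tensorPow, allSwapTestsZero,
    Matrix.of_apply, star_prod, ← Finset.prod_mul_distrib]
  have h1 : ∀ w : Fin n × Fin l → Bool,
      ∑ w' : Fin n × Fin l → Bool, ∏ i, star (amp φ fun j => w (i, j)) *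
        swapTestZero (Fin l → Bool) (fun j => u (i, j), fun j => w (i, j))
          (fun j => u' (i, j), fun j => w' (i, j)) * amp φ (fun j => w' (i, j)) =
      ∏ i, ∑ ψ', star (amp φ fun j => w (i, j)) *
        swapTestZero (Fin l → Bool) (fun j => u (i, j), fun j => w (i, j))
          (fun j => u' (i, j), ψ') * amp φ ψ' := fun w =>
    sum_rows (fun i ψ' => star (amp φ fun j => w (i, j)) *
        swapTestZero (Fin l → Bool) (fun j => u (i, j), fun j => w (i, j))
          (fun j => u' (i, j), ψ') * amp φ ψ')
  rw [Finset.sum_congr rfl fun w _ => h1 w]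
  exact sum_rows (fun i ψ => ∑ ψ', star (amp φ ψ) *
        swapTestZero (Fin l → Bool) (fun j => u (i, j), ψ)
          (fun j => u' (i, j), ψ') * amp φ ψ')

lemma sum_swapTestsMeas (n : ℕ) (φ : PureState (Fin l)) (u u' : Fin n × Fin l → Bool) (b : Bool) :
    ∑ w, ∑ w', star (amp (tensorPow n φ) w) * swapTestsMeas n l b (u, w) (u', w') *
      amp (tensorPow n φ) w' =
      if b then (if u = u' then 1 else 0) - testsEntry n φ u u' else testsEntry n φ u u' := by
  cases b
  · exact sum_allSwapTestsZero n φ u u'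
  · simp only [swapTestsMeas, if_true, Matrix.sub_apply, mul_sub, sub_mul, Finset.sum_sub_distrib,
      sum_allSwapTestsZero]
    congr 1
    have h : ∀ w w' : Fin n × Fin l → Bool, star (amp (tensorPow n φ) w) *
        (1 : Matrix ((Fin n × Fin l → Bool) × (Fin n × Fin l → Bool)) _ ℂ) (u, w) (u', w') *
        amp (tensorPow n φ) w' = if w = w' then (if u = u' then 1 else 0) *
          (star (amp (tensorPow n φ) w) * amp (tensorPow n φ) w') else 0 := by
      intro w w'
      simp only [Matrix.one_apply, Prod.mk.injEq, ite_and]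
      split_ifs <;> ring
    simp only [h, Finset.sum_ite_eq, Finset.mem_univ, if_true, ← Finset.mul_sum, sum_amp, mul_one]

/-- The classical part is measured, so blocks with `x ≠ x'` vanish. Summing over the discarded
registers turns each Kraus pair into the projector of the measurement, whose expectation in the
reference copies is known. -/
lemma decChannel_dual_apply (n : ℕ) (v : Fam d l) (M : Op Unit) (x x' : Fin d → Bool)
    (u u' : Fin n × Fin l → Bool) :
    (decChannel n v).dual M (Sum.elim x u) (Sum.elim x' u') =
      if x = x' then testsEntry n (v x) u u' * M (fun _ => false) (fun _ => false) +
        ((if u = u' then 1 else 0) - testsEntry n (v x) u u') * M (fun _ => true) (fun _ => true)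
      else 0 := by
  have h0 : (decChannel n v).dual M (Sum.elim x u) (Sum.elim x' u') =
      ∑ b : Bool, ∑ y : Fin d → Bool,
        ∑ r : (Fin n × Fin l → Bool) × (Fin n × Fin l → Bool), ∑ c : Unit → Bool,
        ∑ c' : Unit → Bool,
        star (if c () = b ∧ x = y then
          ∑ w, swapTestsMeas n l b r (u, w) * amp (tensorPow n (v y)) w else 0) * M c c' *
        (if c' () = b ∧ x' = y then
          ∑ w, swapTestsMeas n l b r (u', w) * amp (tensorPow n (v y)) w else 0) := by
    rw [Channel.dual, LinearMap.sum_apply, Matrix.sum_apply]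
    change ∑ i : Bool × ((Fin d → Bool) × ((Fin n × Fin l → Bool) × (Fin n × Fin l → Bool))), _ = _
    rw [Fintype.sum_prod_type]
    refine Finset.sum_congr rfl fun b _ => ?_
    rw [Fintype.sum_prod_type]
    refine Finset.sum_congr rfl fun y _ => Finset.sum_congr rfl fun r _ => ?_
    exact conjBy_entry _ _ _ _
  rw [h0]
  have hb : ∀ b : Bool, ∑ y : Fin d → Bool,
        ∑ r : (Fin n × Fin l → Bool) × (Fin n × Fin l → Bool), ∑ c : Unit → Bool,
        ∑ c' : Unit → Bool,
        star (if c () = b ∧ x = y then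
          ∑ w, swapTestsMeas n l b r (u, w) * amp (tensorPow n (v y)) w else 0) * M c c' *
        (if c' () = b ∧ x' = y then
          ∑ w, swapTestsMeas n l b r (u', w) * amp (tensorPow n (v y)) w else 0) =
      if x = x' then M (fun _ => b) (fun _ => b) *
        (if b then (if u = u' then 1 else 0) - testsEntry n (v x) u u' else
          testsEntry n (v x) u u') else 0 := by
    intro b
    rw [Finset.sum_eq_single x]
    · by_cases hx : x = x'
      · subst hx
        have hr : ∀ r : (Fin n × Fin l → Bool) × (Fin n × Fin l → Bool), ∑ c : Unit → Bool,
            ∑ c' : Unit → Bool, star (if c () = b ∧ x = x then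
              ∑ w, swapTestsMeas n l b r (u, w) * amp (tensorPow n (v x)) w else 0) * M c c' *
            (if c' () = b ∧ x = x then
              ∑ w, swapTestsMeas n l b r (u', w) * amp (tensorPow n (v x)) w else 0) =
            M (fun _ => b) (fun _ => b) * ∑ w, ∑ w', star (amp (tensorPow n (v x)) w) *
              (star (swapTestsMeas n l b r (u, w)) * swapTestsMeas n l b r (u', w')) *
              amp (tensorPow n (v x)) w' := by
          intro r
          rw [Finset.sum_eq_single (fun _ => b), Finset.sum_eq_single (fun _ => b)]
          · simp only [and_self, if_true, star_sum, star_mul']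
            rw [mul_right_comm, Finset.sum_mul_sum, mul_comm]
            congr 1
            refine Finset.sum_congr rfl fun w _ => Finset.sum_congr rfl fun w' _ => ?_
            ring
          · intro c _ hc
            have : c () ≠ b := fun hcb => hc (funext fun _ => hcb)
            simp [this]
          · simp
          · intro c _ hc
            have : c () ≠ b := fun hcb => hc (funext fun _ => hcb)
            simp [this]
          · simp
        rw [Finset.sum_congr rfl fun r _ => hr r, ← Finset.mul_sum, if_pos rfl]
        congr 1
        rw [← sum_swapTestsMeas, Finset.sum_comm]
        refine Finset.sum_congr rfl fun w _ => ?_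
        rw [Finset.sum_comm]
        refine Finset.sum_congr rfl fun w' _ => ?_
        rw [← Finset.sum_mul, ← Finset.mul_sum]
        congr 2
        conv_rhs => rw [← swapTestsMeas_proj n l b, Matrix.mul_apply]
        rfl
      · rw [if_neg hx]
        have hx' : x' ≠ x := Ne.symm hx
        simp [hx']
    · intro y _ hy
      have hy' : x ≠ y := Ne.symm hy
      simp [hy']
    · simp
  simp only [hb, Fintype.sum_bool, if_true, Bool.false_eq_true, if_false]
  split_ifs <;> ring

/-- Starting with the flag 0 and returning it after all tests is decryption; the extra 1 in the size
is the wire of the flag. -/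
lemma Sim.dec (n : ℕ) :
    Sim (fun v : Fam d l => (decChannel n v).dual) (n * (d + 2 * l + 5) + 1) := by
  classical
  obtain ⟨T, hT, hTv⟩ := exists_flagMap d l n
  let k : (Fin d ⊕ Unit) ⊕ (Fin n × Fin l) → (Fin d ⊕ (Fin n × Fin l)) ⊕ Unit :=
    Sum.elim (Sum.elim (fun x => Sum.inl (Sum.inl x)) Sum.inr) (fun p => Sum.inl (Sum.inr p))
  have hk : Function.Injective k := by
    rintro ((a | a) | a) ((b | b) | b) h <;> simp_all [k]
  have hsim := ((Sim.prep (d := d) (l := l) (A := Fin d ⊕ (Fin n × Fin l))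
    (DensityOp.basis (fun _ : Unit => false))).comp (Sim.relabel ⟨k, hk⟩)).comp hT
  refine (hsim.mono (by simp; omega)).congr fun v M => ?_
  ext s t
  rw [← sumElim_comp s, ← sumElim_comp t, decChannel_dual_apply]
  simp only [LinearMap.comp_apply, liftOpL_apply]
  rw [slice_basis, liftOp_apply, if_pos]
  · have hcomp : ∀ (x : Fin d → Bool) (u : Fin n × Fin l → Bool) (f : Unit → Bool),
        (Sum.elim (Sum.elim x u) f : (Fin d ⊕ (Fin n × Fin l)) ⊕ Unit → Bool) ∘
          (⟨k, hk⟩ : (Fin d ⊕ Unit) ⊕ (Fin n × Fin l) ↪ (Fin d ⊕ (Fin n × Fin l)) ⊕ Unit) =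
        Sum.elim (Sum.elim x f) u := by
      intro x u f
      funext w
      rcases w with (w | w) | w <;> rfl
    rw [hcomp, hcomp, hTv]
    simp
  · rintro ((w | w) | w) hw
    · exact absurd ⟨Sum.inl (Sum.inl w), rfl⟩ hw
    · exact absurd ⟨Sum.inr w, rfl⟩ hw
    · exact absurd ⟨Sum.inl (Sum.inr w), rfl⟩ hw

end DecryptionOracle

/-! ### The oracles of the game for an arbitrary state family, and their simulation. -/

section Game

variable {A C W : Type} [Fintype A] [DecidableEq A] [Fintype C] [DecidableEq C]
  [Fintype W] [DecidableEq W] {lam d l : ℕ}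

/-! ### The oracles of the game for an arbitrary state family -/

/-- The scheme with the state family of the decryption key replaced by `v`. -/
def famScheme (n : ℕ) (ψ : (Fin lam → Bool) → Fam d l) (v : Fam d l) : QPKE :=
  { prfsScheme n ψ with
    qpkGen := fun _ => publicKey n v
    dec := fun _ => decChannel n v }

/-- The public key oracle for the state family `v`. -/
def pkChannel (n : ℕ) (ψ : (Fin lam → Bool) → Fam d l) (v : Fam d l) :
    Channel Empty (Fin d ⊕ (Fin n × Fin l)) :=
  (famScheme n ψ v).qpkOracle (fun _ : Fin lam => false)

/-- The encryption oracle for the state family `v`. -/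
def encChannel (n : ℕ) (ψ : (Fin lam → Bool) → Fam d l) (v : Fam d l) (a : A) :
    Channel A (Fin d ⊕ (Fin n × Fin l)) :=
  (famScheme n ψ v).encOracle (fun _ : Fin lam => false) a

/-- The oracles before the challenge, for the state family `v`. -/
def gameOracles₁ (n : ℕ) (ψ : (Fin lam → Bool) → Fam d l) (v : Fam d l) :
    ∀ q : (prfsScheme n ψ).interface₁.Q,
      Channel ((prfsScheme n ψ).interface₁.inp q) ((prfsScheme n ψ).interface₁.out q)
  | .qpk => pkChannel n ψ v
  | .enc => encChannel n ψ v (A := Unit) ()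
  | .dec => decChannel n v

/-- The oracles after the challenge, for the state family `v`. -/
def gameOracles₂ (n : ℕ) (ψ : (Fin lam → Bool) → Fam d l) (v : Fam d l) :
    ∀ q : (prfsScheme n ψ).interface₂.Q,
      Channel ((prfsScheme n ψ).interface₂.inp q) ((prfsScheme n ψ).interface₂.out q)
  | .qpk => pkChannel n ψ v
  | .enc => encChannel n ψ v (A := Unit) ()

lemma oracles₁_eq (n : ℕ) (ψ : (Fin lam → Bool) → Fam d l) (dk : Fin lam → Bool) :
    (prfsScheme n ψ).oracles₁ dk = gameOracles₁ n ψ (ψ dk) := by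
  funext q
  cases q <;> rfl

lemma oracles₂_eq (n : ℕ) (ψ : (Fin lam → Bool) → Fam d l) (dk : Fin lam → Bool) :
    (prfsScheme n ψ).oracles₂ dk = gameOracles₂ n ψ (ψ dk) := by
  funext q
  cases q <;> rfl

/-- The quadratic form of an observable at a vector. -/
def quad {α : Type} [Fintype α] (z : α → ℂ) : Matrix α α ℂ →ₗ[ℂ] ℂ where
  toFun M := ∑ s, ∑ t, star (z s) * M s t * z t
  map_add' X Y := by simp only [Matrix.add_apply, mul_add, add_mul, Finset.sum_add_distrib]
  map_smul' c X := by
    simp only [Matrix.smul_apply, smul_eq_mul, RingHom.id_apply, Finset.mul_sum]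
    refine Finset.sum_congr rfl fun s _ => Finset.sum_congr rfl fun t _ => ?_
    ring

lemma quad_apply {α : Type} [Fintype α] (z : α → ℂ) (M : Matrix α α ℂ) :
    quad z M = ∑ s, ∑ t, star (z s) * M s t * z t := rfl

lemma sqrt_inv_mul_self (m : ℕ) :
    (((Real.sqrt (2 ^ m))⁻¹ : ℝ) : ℂ) * (((Real.sqrt (2 ^ m))⁻¹ : ℝ) : ℂ) = (2 ^ m : ℂ)⁻¹ := by
  rw [← Complex.ofReal_mul, ← mul_inv, Real.mul_self_sqrt (by positivity)]
  push_cast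
  rfl

lemma amp_publicKey (n : ℕ) (v : Fam d l) (s : Fin d ⊕ (Fin n × Fin l) → Bool) :
    amp (publicKey n v) s = (((Real.sqrt (2 ^ d))⁻¹ : ℝ) : ℂ) *
      amp (tensorPow n (v (s ∘ Sum.inl))) (s ∘ Sum.inr) := rfl

/-- The public key is the uniform superposition of `x` sent through the isometry that attaches the
copies. -/
lemma quad_publicKey (n : ℕ) (v : Fam d l) (M : Op (Fin d ⊕ (Fin n × Fin l))) :
    quad (amp (publicKey n v)) M = pkFun n v M := by
  rw [quad_apply, pkFun_apply, sum_bits_sum]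
  refine Finset.sum_congr rfl fun x _ => ?_
  simp only [copiesMap_apply, Finset.mul_sum]
  conv_rhs => rw [Finset.sum_comm]
  refine Finset.sum_congr rfl fun u _ => ?_
  rw [sum_bits_sum]
  refine Finset.sum_congr rfl fun y _ => Finset.sum_congr rfl fun u' _ => ?_
  have h1 : ∀ (x : Fin d → Bool) u, amp (publicKey n v) (Sum.elim x u) =
      (((Real.sqrt (2 ^ d))⁻¹ : ℝ) : ℂ) * amp (tensorPow n (v x)) u := fun _ _ => rfl
  rw [h1, h1, star_mul', ← sqrt_inv_mul_self d, Complex.star_def, Complex.conj_ofReal]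
  ring

lemma pkChannel_dual (n : ℕ) (ψ : (Fin lam → Bool) → Fam d l) (v : Fam d l) :
    (pkChannel n ψ v).dual = prepMap (pkFun n v) := by
  ext1 M
  ext x y
  have h : (pkChannel n ψ v).dual M = conjBy ((pkChannel n ψ v).kraus ()) M := by
    rw [Channel.dual, LinearMap.sum_apply]
    exact Fintype.sum_unique (ι := Unit) _
  rw [h]
  exact (conjBy_entry _ _ _ _).trans (quad_publicKey n v M)

/-- The expectation value of an observable in an encryption of `1`. -/
def avgCt (n : ℕ) (ψ : (Fin lam → Bool) → Fam d l) : Op (Fin d ⊕ (Fin n × Fin l)) →ₗ[ℂ] ℂ :=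
  ∑ k, (2 ^ lam : ℂ)⁻¹ • ctFun n (ψ k)

lemma avgCt_one (n : ℕ) (ψ : (Fin lam → Bool) → Fam d l) : avgCt n ψ 1 = 1 := by
  simp [avgCt, LinearMap.sum_apply, ctFun_one]

lemma quad_block (n : ℕ) (g : Fam d l) (z : ℂ) (x : Fin d → Bool)
    (M : Op (Fin d ⊕ (Fin n × Fin l))) :
    quad (fun c => if c ∘ Sum.inl = x then z * amp (tensorPow n (g x)) (c ∘ Sum.inr) else 0) M =
      star z * z * copiesMap n g M x x := by
  rw [quad_apply, copiesMap_apply, sum_bits_sum, Finset.sum_eq_single x]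
  · simp only [Finset.mul_sum]
    refine Finset.sum_congr rfl fun u _ => ?_
    rw [sum_bits_sum, Finset.sum_eq_single x]
    · refine Finset.sum_congr rfl fun u' _ => ?_
      simp only [Sum.elim_comp_inl, Sum.elim_comp_inr, if_true, star_mul']
      ring
    · intro y _ hy
      simp [hy]
    · simp
  · intro y _ hy
    simp [hy]
  · simp

lemma encZero_quad (n : ℕ) (v : Fam d l) (M : Op (Fin d ⊕ (Fin n × Fin l))) :
    ∑ i : Fin d → Bool, quad (((encZero (Fin d) (Fin n × Fin l)).kraus i).mulVec
      (amp (publicKey n v))) M = ctFun n v M := by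
  rw [ctFun_apply]
  refine Finset.sum_congr rfl fun x _ => ?_
  have h : ((encZero (Fin d) (Fin n × Fin l)).kraus x).mulVec (amp (publicKey n v)) =
      fun c => if c ∘ Sum.inl = x then (((Real.sqrt (2 ^ d))⁻¹ : ℝ) : ℂ) *
        amp (tensorPow n (v x)) (c ∘ Sum.inr) else 0 := by
    funext c
    change (Matrix.diagonal _).mulVec _ c = _
    rw [Matrix.mulVec_diagonal, amp_publicKey]
    split_ifs with h
    · rw [one_mul, h]
    · rw [zero_mul]
  rw [h, quad_block, Complex.star_def, Complex.conj_ofReal, sqrt_inv_mul_self]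

/-- The right-hand side does not involve `v`: the residual state of the public key is discarded, and
of the key only the uniform distribution of `x` survives. Hence the oracle's encryptions of 1 are
the same in all hybrids. -/
lemma encOne_quad (n : ℕ) (ψ : (Fin lam → Bool) → Fam d l) (v : Fam d l)
    (M : Op (Fin d ⊕ (Fin n × Fin l))) :
    ∑ i : (Fin lam → Bool) × ((Fin d → Bool) × (Fin n × Fin l → Bool)),
      quad (((encOne n ψ).kraus i).mulVec (amp (publicKey n v))) M = avgCt n ψ M := by
  have h : ∀ k x u, ((encOne n ψ).kraus (k, (x, u))).mulVec (amp (publicKey n v)) =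
      fun c => if c ∘ Sum.inl = x then ((((Real.sqrt (2 ^ lam))⁻¹ : ℝ) : ℂ) *
        ((((Real.sqrt (2 ^ d))⁻¹ : ℝ) : ℂ) * amp (tensorPow n (v x)) u)) *
        amp (tensorPow n (ψ k x)) (c ∘ Sum.inr) else 0 := by
    intro k x u
    funext c
    change ∑ t, (if c ∘ Sum.inl = x ∧ t ∘ Sum.inl = x ∧ t ∘ Sum.inr = u then
      (((Real.sqrt (2 ^ lam))⁻¹ : ℝ) : ℂ) * amp (tensorPow n (ψ k x)) (c ∘ Sum.inr) else 0) *
      amp (publicKey n v) t = _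
    rw [Finset.sum_eq_single (Sum.elim x u)]
    · have hk : amp (publicKey n v) (Sum.elim x u) = (((Real.sqrt (2 ^ d))⁻¹ : ℝ) : ℂ) *
        amp (tensorPow n (v x)) u := rfl
      rw [hk]
      simp only [Sum.elim_comp_inl, Sum.elim_comp_inr, and_true]
      split_ifs <;> ring
    · intro t _ ht
      rw [if_neg, zero_mul]
      rintro ⟨-, h1, h2⟩
      refine ht ?_
      rw [← h1, ← h2, sumElim_comp]
    · simp
  rw [avgCt, LinearMap.sum_apply, Fintype.sum_prod_type]
  refine Finset.sum_congr rfl fun k _ => ?_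
  rw [LinearMap.smul_apply, ctFun_apply, smul_eq_mul, Finset.mul_sum, Fintype.sum_prod_type]
  refine Finset.sum_congr rfl fun x _ => ?_
  simp only [h, quad_block]
  rw [← Finset.sum_mul]
  have h2 := sum_scaled_amp (tensorPow n (v x)) d
  have h3 : ∀ u, star ((((Real.sqrt (2 ^ lam))⁻¹ : ℝ) : ℂ) *
      ((((Real.sqrt (2 ^ d))⁻¹ : ℝ) : ℂ) * amp (tensorPow n (v x)) u)) *
      ((((Real.sqrt (2 ^ lam))⁻¹ : ℝ) : ℂ) *
      ((((Real.sqrt (2 ^ d))⁻¹ : ℝ) : ℂ) * amp (tensorPow n (v x)) u)) =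
      (2 ^ lam : ℂ)⁻¹ * (star ((((Real.sqrt (2 ^ d))⁻¹ : ℝ) : ℂ) * amp (tensorPow n (v x)) u) *
      ((((Real.sqrt (2 ^ d))⁻¹ : ℝ) : ℂ) * amp (tensorPow n (v x)) u)) := by
    intro u
    rw [← sqrt_inv_mul_self lam, star_mul' (((Real.sqrt (2 ^ lam))⁻¹ : ℝ) : ℂ)]
    simp only [Complex.star_def, Complex.conj_ofReal]
    ring
  rw [Finset.sum_congr rfl fun u _ => h3 u, ← Finset.mul_sum, h2]
  push_cast
  ring

/-- Encryption amounts to measuring the message and preparing one of two states. All later arguments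
use it in this form, which is linear in both functionals. -/
lemma encChannel_dual (n : ℕ) (ψ : (Fin lam → Bool) → Fam d l) (v : Fam d l) (a : A) :
    (encChannel n ψ v a).dual = selPrep a (ctFun n v) (avgCt n ψ) := by
  ext1 M
  ext m m'
  let S := famScheme n ψ v
  have h0 : (encChannel n ψ v a).dual M m m' = ∑ m₀ : A → Bool, ∑ i : (S.enc (m₀ a)).ι,
      ∑ c, ∑ c', star (if m = m₀ then ((S.enc (m₀ a)).kraus i).mulVec (amp (publicKey n v)) c else 0) *
        M c c' * (if m' = m₀ then ((S.enc (m₀ a)).kraus i).mulVec (amp (publicKey n v)) c' else 0) := by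
    rw [Channel.dual, LinearMap.sum_apply, Matrix.sum_apply]
    refine Eq.trans ?_ (Fintype.sum_sigma (fun i : (m₀ : A → Bool) × (S.enc (m₀ a)).ι =>
      ∑ c, ∑ c', star (if m = i.1 then ((S.enc (i.1 a)).kraus i.2).mulVec (amp (publicKey n v)) c
        else 0) * M c c' *
        (if m' = i.1 then ((S.enc (i.1 a)).kraus i.2).mulVec (amp (publicKey n v)) c' else 0)))
    exact Finset.sum_congr rfl fun i _ => conjBy_entry _ _ _ _
  rw [h0, Finset.sum_eq_single m]
  · rw [selPrep_apply]
    by_cases h : m = m'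
    · subst h
      rw [Matrix.diagonal_apply_eq]
      simp only [if_true]
      generalize m a = b
      cases b
      · exact encZero_quad n v M
      · exact encOne_quad n ψ v M
    · rw [Matrix.diagonal_apply_ne _ h]
      simp [Ne.symm h]
  · intro m₀ _ hm
    simp [Ne.symm hm]
  · simp

lemma quad_vecMulVec_nonneg {α : Type} [Fintype α] (z w : α → ℂ) :
    0 ≤ quad z (Matrix.vecMulVec w (star w)) := by
  have : quad z (Matrix.vecMulVec w (star w)) = star (∑ s, star (w s) * z s) * ∑ s, star (w s) * z s := by
    rw [star_sum, Finset.sum_mul_sum, quad_apply]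
    refine Finset.sum_congr rfl fun s _ => Finset.sum_congr rfl fun t _ => ?_
    rw [Matrix.vecMulVec_apply, star_mul', star_star, Pi.star_apply]
    ring
  rw [this]
  exact star_mul_self_nonneg _

lemma copiesMap_diag (n : ℕ) (v : Fam d l) (x : Fin d → Bool) (M : Op (Fin d ⊕ (Fin n × Fin l))) :
    copiesMap n v M x x = quad (fun c => if c ∘ Sum.inl = x then
      amp (tensorPow n (v x)) (c ∘ Sum.inr) else 0) M := by
  have := quad_block n v 1 x M
  simp only [one_mul, star_one] at this
  exact this.symm

lemma two_pow_inv_nonneg (m : ℕ) : (0 : ℂ) ≤ (2 ^ m : ℂ)⁻¹ := by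
  rw [show (2 ^ m : ℂ)⁻¹ = (((2 ^ m : ℝ)⁻¹ : ℝ) : ℂ) by push_cast; rfl]
  exact_mod_cast (by positivity : (0 : ℝ) ≤ (2 ^ m : ℝ)⁻¹)

lemma ctFun_vecMulVec_nonneg (n : ℕ) (v : Fam d l) (w : (Fin d ⊕ (Fin n × Fin l) → Bool) → ℂ) :
    0 ≤ ctFun n v (Matrix.vecMulVec w (star w)) := by
  rw [ctFun_apply]
  refine Finset.sum_nonneg fun x _ => mul_nonneg (two_pow_inv_nonneg d) ?_
  rw [copiesMap_diag]
  exact quad_vecMulVec_nonneg _ _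

lemma avgCt_vecMulVec_nonneg (n : ℕ) (ψ : (Fin lam → Bool) → Fam d l)
    (w : (Fin d ⊕ (Fin n × Fin l) → Bool) → ℂ) :
    0 ≤ avgCt n ψ (Matrix.vecMulVec w (star w)) := by
  rw [avgCt, LinearMap.sum_apply]
  refine Finset.sum_nonneg fun x _ => ?_
  rw [LinearMap.smul_apply, smul_eq_mul]
  exact mul_nonneg (two_pow_inv_nonneg lam) (ctFun_vecMulVec_nonneg n _ w)

lemma pkFun_one (n : ℕ) (v : Fam d l) : pkFun n v 1 = 1 := by
  rw [pkFun_apply, copiesMap_one]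
  simp [Matrix.one_apply]

lemma pkFun_vecMulVec_nonneg (n : ℕ) (v : Fam d l) (w : (Fin d ⊕ (Fin n × Fin l) → Bool) → ℂ) :
    0 ≤ pkFun n v (Matrix.vecMulVec w (star w)) := by
  rw [← quad_publicKey]
  exact quad_vecMulVec_nonneg _ _

/-- A bound on the size of the circuits simulating one oracle query. -/
def querySize (d l n : ℕ) : ℕ := (n + 1) * (10 * (d + l + 1)) + n * l

lemma card_ct (d l n : ℕ) : Fintype.card (Fin d ⊕ (Fin n × Fin l)) = d + n * l := by simp

/-- For a fixed family, possibly one that cannot be generated efficiently, the ciphertext is an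
ancilla state and requires no query. -/
lemma Sim.ct_const (n : ℕ) (w : Fam d l) :
    Sim (fun _ : Fam d l => prepMap (ctFun n w)) (d + n * l) :=
  (Sim.const _ (ctFun_one n w) (ctFun_vecMulVec_nonneg n w)).mono (card_ct d l n).le

lemma Sim.avgCt (n : ℕ) (ψ : (Fin lam → Bool) → Fam d l) :
    Sim (fun _ : Fam d l => prepMap (avgCt n ψ)) (d + n * l) :=
  (Sim.const _ (avgCt_one n ψ) (avgCt_vecMulVec_nonneg n ψ)).mono (card_ct d l n).le

lemma Sim.enc (n : ℕ) (ψ : (Fin lam → Bool) → Fam d l) (a : A) :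
    Sim (fun v => selPrep a (ctFun n v) (QCrypto.avgCt n ψ)) (querySize d l n) := by
  refine (Sim.select a (Sim.ct n) (Sim.avgCt n ψ) (ctFun_one n) (fun _ => avgCt_one n ψ)).mono ?_
  rw [card_ct, querySize]
  ring_nf
  nlinarith [Nat.zero_le (n * l)]

lemma Sim.oracles₁ (n : ℕ) (ψ : (Fin lam → Bool) → Fam d l)
    (q : (prfsScheme n ψ).interface₁.Q) :
    Sim (fun v => (gameOracles₁ n ψ v q).dual) (querySize d l n) := by
  cases q with
  | qpk =>
    refine Sim.congr (T := fun v => (pkChannel n ψ v).dual) ?_ fun v M => rfl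
    simp only [pkChannel_dual]
    refine (Sim.pk n).mono ?_
    rw [querySize]
    nlinarith [Nat.zero_le (n * l)]
  | enc =>
    refine Sim.congr (T := fun v => (encChannel n ψ v (A := Unit) ()).dual) ?_ fun v M => rfl
    simp only [encChannel_dual]
    exact Sim.enc n ψ ()
  | dec =>
    refine Sim.congr (T := fun v => (decChannel n v).dual) ?_ fun v M => rfl
    refine (Sim.dec n).mono ?_
    rw [querySize]
    nlinarith [Nat.zero_le (n * l)]

lemma Sim.oracles₂ (n : ℕ) (ψ : (Fin lam → Bool) → Fam d l)
    (q : (prfsScheme n ψ).interface₂.Q) :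
    Sim (fun v => (gameOracles₂ n ψ v q).dual) (querySize d l n) := by
  cases q with
  | qpk => exact Sim.oracles₁ n ψ Query₁.qpk
  | enc => exact Sim.oracles₁ n ψ Query₁.enc

/-- Without decryption, every answer is a fixed state or a choice between two fixed states, and such
states can be advice. The family `w` is arbitrary, so this serves for Haar states; the oracle of the
distinguisher remains unused here. -/
lemma Sim.oracles₂_const (n : ℕ) (ψ : (Fin lam → Bool) → Fam d l) (w : Fam d l)
    (q : (prfsScheme n ψ).interface₂.Q) :
    Sim (fun _ : Fam d l => (gameOracles₂ n ψ w q).dual) (querySize d l n) := by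
  cases q with
  | qpk =>
    refine Sim.congr (T := fun _ => (pkChannel n ψ w).dual) ?_ fun v M => rfl
    simp only [pkChannel_dual]
    refine (Sim.const _ (pkFun_one n w) (pkFun_vecMulVec_nonneg n w)).mono ?_
    rw [card_ct, querySize]
    nlinarith [Nat.zero_le (n * l)]
  | enc =>
    refine Sim.congr (T := fun _ => (encChannel n ψ w (A := Unit) ()).dual) ?_ fun v M => rfl
    simp only [encChannel_dual]
    refine (Sim.select () (Sim.ct_const n w) (Sim.avgCt n ψ) (fun _ => ctFun_one n w)
      (fun _ => avgCt_one n ψ)).mono ?_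
    rw [card_ct, querySize]
    nlinarith [Nat.zero_le (n * l)]

end Game

/-! ### Positive functionals and the comparison of circuits with different oracles. -/

section Positivity

variable {A B C W : Type} [Fintype A] [DecidableEq A] [Fintype B] [DecidableEq B]
  [Fintype C] [DecidableEq C] [Fintype W] [DecidableEq W] {d l : ℕ}

/-! ### Positivity -/

/-- Completely positive maps: those with a Kraus representation. -/
def CP {α β : Type} [Fintype α] [Fintype β] (T : Matrix β β ℂ →ₗ[ℂ] Matrix α α ℂ) : Prop :=
  ∃ (ι : Type) (_ : Fintype ι) (K : ι → Matrix β α ℂ), T = ∑ i, conjBy (K i)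

lemma posSemidef_conjBy {α β : Type} [Fintype α] [Fintype β] (K : Matrix β α ℂ)
    {M : Matrix β β ℂ} (hM : M.PosSemidef) : (conjBy K M).PosSemidef :=
  hM.conjTranspose_mul_mul_same K

lemma CP.posSemidef {α β : Type} [Fintype α] [Fintype β] {T : Matrix β β ℂ →ₗ[ℂ] Matrix α α ℂ}
    (hT : CP T) {M : Matrix β β ℂ} (hM : M.PosSemidef) : (T M).PosSemidef := by
  obtain ⟨ι, _, K, rfl⟩ := hT
  rw [LinearMap.sum_apply]
  exact Matrix.posSemidef_sum _ fun i _ => posSemidef_conjBy _ hM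

lemma CP.conjBy {α β : Type} [Fintype α] [Fintype β] (K : Matrix β α ℂ) : CP (conjBy K) :=
  ⟨Unit, inferInstance, fun _ => K, by rw [Fintype.sum_unique]⟩

lemma CP.id {α : Type} [Fintype α] [DecidableEq α] :
    CP (LinearMap.id : Matrix α α ℂ →ₗ[ℂ] Matrix α α ℂ) := by
  have : (LinearMap.id : Matrix α α ℂ →ₗ[ℂ] Matrix α α ℂ) = QCrypto.conjBy 1 := by
    ext1 M
    simp [conjBy_apply]
  rw [this]
  exact CP.conjBy _

lemma CP.comp {α β γ : Type} [Fintype α] [Fintype β] [Fintype γ]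
    {T : Matrix β β ℂ →ₗ[ℂ] Matrix α α ℂ} {S : Matrix γ γ ℂ →ₗ[ℂ] Matrix β β ℂ}
    (hT : CP T) (hS : CP S) : CP (T ∘ₗ S) := by
  obtain ⟨ι, _, K, rfl⟩ := hT
  obtain ⟨κ, _, L, rfl⟩ := hS
  refine ⟨ι × κ, inferInstance, fun p => L p.2 * K p.1, ?_⟩
  ext1 M
  rw [LinearMap.comp_apply, LinearMap.sum_apply, LinearMap.sum_apply, LinearMap.sum_apply,
    Fintype.sum_prod_type]
  refine Finset.sum_congr rfl fun i _ => ?_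
  rw [map_sum]
  refine Finset.sum_congr rfl fun j _ => ?_
  simp only [conjBy_apply, Matrix.conjTranspose_mul, Matrix.mul_assoc]

lemma CP.localQuery {T : Op B →ₗ[ℂ] Op A} (hT : CP T) (e : A ⊕ B ↪ W) :
    CP (localQuery e T) := by
  obtain ⟨ι, _, K, rfl⟩ := hT
  refine ⟨ι × (B → Bool), inferInstance, fun p => liftOp e (qKraus (K p.1) p.2), ?_⟩
  rw [localQuery_sum, Fintype.sum_prod_type]
  exact Finset.sum_congr rfl fun i _ => (sum_conjBy_qKraus e (K i)).symm

lemma Channel.cp_dual (Φ : Channel A B) : CP Φ.dual := ⟨Φ.ι, Φ.fintypeι, Φ.kraus, rfl⟩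

lemma localQuery_one_apply (e : A ⊕ B ↪ W) (T : Op B →ₗ[ℂ] Op A) (s t : W → Bool) :
    localQuery e T 1 s t = if s ∘ e ∘ Sum.inr = t ∘ e ∘ Sum.inr ∧
      (∀ w, w ∉ Set.range e → s w = t w) then T 1 (s ∘ e ∘ Sum.inl) (t ∘ e ∘ Sum.inl) else 0 := by
  classical
  rw [localQuery_apply]
  have hsub : (1 : Op W).submatrix (fun c => Function.extend e (Sum.elim (fun _ => false) c) s)
      (fun c => Function.extend e (Sum.elim (fun _ => false) c) t) =
      if ∀ w, w ∉ Set.range e → s w = t w then (1 : Op B) else 0 := by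
    ext c c'
    have hiff : Function.extend e (Sum.elim (fun _ => false) c) s =
        Function.extend e (Sum.elim (fun _ => false) c') t ↔
        (∀ w, w ∉ Set.range e → s w = t w) ∧ c = c' := by
      constructor
      · intro h
        constructor
        · intro w hw
          have := congrFun h w
          rwa [Function.extend_apply' _ _ _ hw, Function.extend_apply' _ _ _ hw] at this
        · funext b
          have := congrFun h (e (Sum.inr b))
          rwa [e.injective.extend_apply, e.injective.extend_apply] at this
      · rintro ⟨h, rfl⟩
        funext w
        by_cases hw : w ∈ Set.range e
        · obtain ⟨y, rfl⟩ := hw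
          rw [e.injective.extend_apply, e.injective.extend_apply]
        · rw [Function.extend_apply' _ _ _ hw, Function.extend_apply' _ _ _ hw]
          exact h w hw
    rw [Matrix.submatrix_apply, Matrix.one_apply]
    simp only [hiff]
    by_cases h : ∀ w, w ∉ Set.range e → s w = t w
    · rw [if_pos h, Matrix.one_apply]
      exact if_congr (and_iff_right h) rfl rfl
    · rw [if_neg h, if_neg (fun hh => h hh.1)]
      rfl
  rw [hsub]
  by_cases h : ∀ w, w ∉ Set.range e → s w = t w
  · rw [if_pos h]
    exact if_congr (and_iff_left h).symm rfl rfl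
  · rw [if_neg h, map_zero]
    refine Eq.trans ?_ (if_neg (fun hh => h hh.2)).symm
    split_ifs <;> rfl

/-- The weight of a query depends on the queried map only through its value at 1. -/
lemma localQuery_one_congr (e : A ⊕ B ↪ W) {T T' : Op B →ₗ[ℂ] Op A} (h : T 1 = T' 1) :
    localQuery e T 1 = localQuery e T' 1 := by
  ext s t
  rw [localQuery_one_apply, localQuery_one_apply, h]

lemma localQuery_one (e : A ⊕ B ↪ W) {T : Op B →ₗ[ℂ] Op A} {r : ℂ} (h : T 1 = r • 1) :
    localQuery e T 1 = r • (1 : Op W) := by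
  classical
  ext s t
  rw [localQuery_one_apply, h, Matrix.smul_apply, Matrix.smul_apply, Matrix.one_apply,
    Matrix.one_apply]
  have hiff : s = t ↔ (s ∘ e ∘ Sum.inr = t ∘ e ∘ Sum.inr ∧ ∀ w, w ∉ Set.range e → s w = t w) ∧
      s ∘ e ∘ Sum.inl = t ∘ e ∘ Sum.inl := by
    constructor
    · rintro rfl; simp
    · rintro ⟨⟨h1, h2⟩, h3⟩
      funext w
      by_cases hw : w ∈ Set.range e
      · obtain ⟨y | y, rfl⟩ := hw
        · exact congrFun h3 y
        · exact congrFun h1 y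
      · exact h2 w hw
  by_cases h1 : s ∘ e ∘ Sum.inr = t ∘ e ∘ Sum.inr ∧ ∀ w, w ∉ Set.range e → s w = t w
  · rw [if_pos h1]
    congr 1
    exact if_congr (by rw [hiff]; exact (and_iff_right h1).symm) rfl rfl
  · rw [if_neg h1, if_neg (fun hh => h1 (hiff.1 hh).1), smul_zero]

lemma Instr.cp_dual {I : Interface} (O : ∀ q, Channel (I.inp q) (I.out q)) (c : Instr I W) :
    CP (c.dual O) := by
  cases c with
  | gate g => exact CP.conjBy _
  | query q e => exact (O q).cp_dual.localQuery e

lemma liftOp_one {V : Type} [Fintype V] [DecidableEq V] (f : V ↪ W) : liftOp f (1 : Op V) = 1 := by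
  classical
  ext s t
  rw [liftOp_apply, Matrix.one_apply, Matrix.one_apply]
  by_cases h : s = t
  · subst h; simp
  · rw [if_neg h]
    split_ifs with h1 h2
    · exfalso
      refine h (funext fun w => ?_)
      by_cases hw : w ∈ Set.range f
      · obtain ⟨y, rfl⟩ := hw
        exact congrFun h2 y
      · exact h1 w hw
    · rfl
    · rfl

lemma Instr.dual_one {I : Interface} (O : ∀ q, Channel (I.inp q) (I.out q)) (c : Instr I W) :
    c.dual O 1 = 1 := by
  cases c with
  | gate g =>
    rw [Instr.dual, Gate.op, conjBy_liftOp, ← liftOp_one g.wires, loc_liftOp, conjBy_apply,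
      Matrix.mul_one]
    congr 1
    exact Matrix.mem_unitaryGroup_iff'.1 g.unitary.2
  | query q e =>
    have := localQuery_one e (r := 1) (T := (O q).dual) (by rw [Channel.dual_one, one_smul])
    rw [one_smul] at this
    exact this

lemma progDual_one {I : Interface} (O : ∀ q, Channel (I.inp q) (I.out q)) (P : List (Instr I W)) :
    progDual O P 1 = 1 := by
  induction P with
  | nil => rfl
  | cons c P ih => rw [progDual, LinearMap.comp_apply, ih, Instr.dual_one]

lemma cp_progDual {I : Interface} (O : ∀ q, Channel (I.inp q) (I.out q)) (P : List (Instr I W)) :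
    CP (progDual O P) := by
  induction P with
  | nil => exact CP.id
  | cons c P ih => exact (c.cp_dual O).comp ih

/-- Observables between `0` and `1`. -/
def Effect {α : Type} [Fintype α] [DecidableEq α] (M : Matrix α α ℂ) : Prop :=
  M.PosSemidef ∧ (1 - M).PosSemidef

/-- Positive functionals of norm at most one. -/
structure SubState {α : Type} [Fintype α] [DecidableEq α] (ω : Matrix α α ℂ →ₗ[ℂ] ℂ) : Prop where
  nonneg : ∀ M : Matrix α α ℂ, M.PosSemidef → 0 ≤ (ω M).re
  one_le : (ω 1).re ≤ 1

/-- Completely positive subunital maps. -/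
structure SubUnital {α β : Type} [Fintype α] [DecidableEq α] [Fintype β] [DecidableEq β]
    (T : Matrix β β ℂ →ₗ[ℂ] Matrix α α ℂ) : Prop where
  cp : CP T
  one_sub : (1 - T 1).PosSemidef

lemma SubUnital.of_one {α β : Type} [Fintype α] [DecidableEq α] [Fintype β] [DecidableEq β]
    {T : Matrix β β ℂ →ₗ[ℂ] Matrix α α ℂ} (h : CP T) (h1 : T 1 = 1) : SubUnital T :=
  ⟨h, by rw [h1, sub_self]; exact Matrix.PosSemidef.zero⟩

lemma SubUnital.effect {α β : Type} [Fintype α] [DecidableEq α] [Fintype β] [DecidableEq β]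
    {T : Matrix β β ℂ →ₗ[ℂ] Matrix α α ℂ} (h : SubUnital T) {M : Matrix β β ℂ} (hM : Effect M) :
    Effect (T M) := by
  refine ⟨h.cp.posSemidef hM.1, ?_⟩
  have : 1 - T M = (1 - T 1) + T (1 - M) := by rw [map_sub]; abel
  rw [this]
  exact h.one_sub.add (h.cp.posSemidef hM.2)

lemma SubState.comp {α β : Type} [Fintype α] [DecidableEq α] [Fintype β] [DecidableEq β]
    {ω : Matrix α α ℂ →ₗ[ℂ] ℂ} (hω : SubState ω) {T : Matrix β β ℂ →ₗ[ℂ] Matrix α α ℂ}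
    (h : SubUnital T) : SubState (ω ∘ₗ T) where
  nonneg M hM := hω.nonneg _ (h.cp.posSemidef hM)
  one_le := by
    have := hω.nonneg _ h.one_sub
    rw [map_sub, Complex.sub_re] at this
    rw [LinearMap.comp_apply]
    linarith [hω.one_le]

lemma SubState.le_of_effect {α β : Type} [Fintype α] [DecidableEq α] [Fintype β] [DecidableEq β]
    {ω : Matrix α α ℂ →ₗ[ℂ] ℂ} (hω : SubState ω) {T : Matrix β β ℂ →ₗ[ℂ] Matrix α α ℂ} (h : CP T)
    {M : Matrix β β ℂ} (hM : Effect M) : (ω (T M)).re ≤ (ω (T 1)).re := by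
  have := hω.nonneg _ (h.posSemidef hM.2)
  rw [map_sub, map_sub, Complex.sub_re] at this
  linarith

/-- Writing `M` as `star K * K` and rotating the trace gives the trace of `K * ρ * star K`. -/
lemma trace_mul_nonneg {α : Type} [Fintype α] [DecidableEq α] {ρ M : Matrix α α ℂ}
    (hρ : ρ.PosSemidef) (hM : M.PosSemidef) : 0 ≤ (ρ * M).trace.re := by
  open scoped MatrixOrder in
  obtain ⟨K, rfl⟩ := CStarAlgebra.nonneg_iff_eq_star_mul_self.mp hM.nonneg
  rw [Matrix.star_eq_conjTranspose]
  rw [← Matrix.mul_assoc, Matrix.trace_mul_comm, ← Matrix.mul_assoc]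
  have := (hρ.mul_mul_conjTranspose_same K).trace_nonneg
  exact (Complex.le_def.1 this).1

/-- The expectation value functional of a density operator. -/
def DensityOp.expect (ρ : DensityOp W) : Op W →ₗ[ℂ] ℂ where
  toFun M := (ρ.mat * M).trace
  map_add' X Y := by rw [Matrix.mul_add, Matrix.trace_add]
  map_smul' c X := by rw [Matrix.mul_smul, Matrix.trace_smul, RingHom.id_apply]

lemma DensityOp.expect_one (ρ : DensityOp W) : ρ.expect 1 = 1 := by
  change (ρ.mat * 1).trace = 1
  rw [Matrix.mul_one, ρ.trace_eq_one]

lemma DensityOp.subState (ρ : DensityOp W) : SubState ρ.expect where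
  nonneg M hM := trace_mul_nonneg ρ.posSemidef hM
  one_le := by rw [ρ.expect_one]; simp

lemma effect_wireProj (w : W) (b : Bool) : Effect (wireProj w b) := by
  have h : ∀ b : Bool, (wireProj w b).PosSemidef := fun b =>
    Matrix.PosSemidef.diagonal fun s => by
      dsimp only
      split_ifs
      · exact zero_le_one
      · exact le_rfl
  refine ⟨h b, ?_⟩
  have h1 := wireProj_add w
  cases b
  · rw [← h1, add_sub_cancel_left]; exact h true
  · rw [← h1, add_sub_cancel_right]; exact h false

/-! ### Comparison of oracles -/

/-- Two circuits that differ in their oracles: the errors of the single steps add up. -/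
lemma sum_progDual_sub_le {X : Type} [Fintype X] {I : Interface}
    (O : ∀ q, Channel (I.inp q) (I.out q)) (O' : X → ∀ q, Channel (I.inp q) (I.out q)) (κ : ℝ)
    (hstep : ∀ (c : Instr I W) (ω : Op W →ₗ[ℂ] ℂ), SubState ω → ∀ E : X → Op W,
      (∀ x, Effect (E x)) → ∑ x, |(ω (c.dual O (E x))).re - (ω (c.dual (O' x) (E x))).re| ≤ κ)
    (P : List (Instr I W)) (ω : Op W →ₗ[ℂ] ℂ) (hω : SubState ω) (E : X → Op W)
    (hE : ∀ x, Effect (E x)) :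
    ∑ x, |(ω (progDual O P (E x))).re - (ω (progDual (O' x) P (E x))).re| ≤ P.length * κ := by
  induction P generalizing ω with
  | nil => simp [progDual]
  | cons c P ih =>
    -- The steps already executed use the common oracles `O`, so the functional is the same for all
    -- `x`; only the later observable depends on `x`. This is what allows a bound on the sum over
    -- `x` instead of one for each `x`.
    have h1 := ih (ω ∘ₗ c.dual O) (hω.comp (SubUnital.of_one (c.cp_dual O) (c.dual_one O)))
    have h2 := hstep c ω hω (fun x => progDual (O' x) P (E x)) fun x =>
      (SubUnital.of_one (cp_progDual _ _) (progDual_one _ _)).effect (hE x)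
    calc _ ≤ ∑ x, (|((ω ∘ₗ c.dual O) (progDual O P (E x))).re -
            ((ω ∘ₗ c.dual O) (progDual (O' x) P (E x))).re| +
          |(ω (c.dual O (progDual (O' x) P (E x)))).re -
            (ω (c.dual (O' x) (progDual (O' x) P (E x)))).re|) :=
          Finset.sum_le_sum fun x _ => abs_sub_le _ _ _
      _ ≤ P.length * κ + κ := by
          rw [Finset.sum_add_distrib]
          exact add_le_add h1 h2
      _ = _ := by rw [List.length_cons]; push_cast; ring

/-- Channels whose adjoints differ by completely positive maps `E`, `E'` of equal weight. -/
lemma abs_localQuery_sub_le (e : A ⊕ B ↪ W) {T T' E E' : Op B →ₗ[ℂ] Op A} (h : T - T' = E - E')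
    (hE : CP E) (hE' : CP E') (h1 : E 1 = E' 1) {ω : Op W →ₗ[ℂ] ℂ} (hω : SubState ω) {M : Op W}
    (hM : Effect M) :
    |(ω (localQuery e T M)).re - (ω (localQuery e T' M)).re| ≤ (ω (localQuery e E 1)).re := by
  have hd : localQuery e T M - localQuery e T' M = localQuery e E M - localQuery e E' M := by
    have h2 : ∀ S S' : Op B →ₗ[ℂ] Op A,
        localQuery e S M - localQuery e S' M = localQuery e (S - S') M := by
      intro S S'
      have : S - S' = S + (-1 : ℂ) • S' := by module
      rw [this, localQuery_add, localQuery_smul, LinearMap.add_apply, LinearMap.smul_apply]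
      module
    rw [h2, h2, h]
  have hre : (ω (localQuery e T M)).re - (ω (localQuery e T' M)).re =
      (ω (localQuery e E M)).re - (ω (localQuery e E' M)).re := by
    rw [← Complex.sub_re, ← map_sub, hd, map_sub, Complex.sub_re]
  rw [hre, abs_le]
  -- The values of `E` and `E'` at an effect both lie between 0 and their common value at 1, so
  -- their difference is at most that value.
  have a1 := hω.le_of_effect (hE.localQuery e) hM
  have a2 := hω.le_of_effect (hE'.localQuery e) hM
  rw [← localQuery_one_congr e h1] at a2
  have a3 := hω.nonneg _ ((hE.localQuery e).posSemidef hM.1)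
  have a4 := hω.nonneg _ ((hE'.localQuery e).posSemidef hM.1)
  constructor <;> linarith

/-- The operator form of `2ab ≤ t a² + b² / t`: the difference of the two sides is the conjugate of
`M` by `√t X - Y / √t`. -/
lemma conjBy_add_le {α β : Type} [Fintype α] [Fintype β] (X Y : Matrix β α ℂ) {M : Matrix β β ℂ}
    (hM : M.PosSemidef) {t : ℝ} (ht : 0 < t) :
    (((1 + t : ℝ) : ℂ) • conjBy X M + ((1 + t⁻¹ : ℝ) : ℂ) • conjBy Y M -
      conjBy (X + Y) M).PosSemidef := by
  have h := posSemidef_conjBy (((Real.sqrt t : ℝ) : ℂ) • X - (((Real.sqrt t)⁻¹ : ℝ) : ℂ) • Y) hM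
  have hs : ((Real.sqrt t : ℝ) : ℂ) * ((Real.sqrt t : ℝ) : ℂ) = (t : ℂ) := by
    rw [← Complex.ofReal_mul, Real.mul_self_sqrt ht.le]
  have hsi : (((Real.sqrt t)⁻¹ : ℝ) : ℂ) * (((Real.sqrt t)⁻¹ : ℝ) : ℂ) = ((t⁻¹ : ℝ) : ℂ) := by
    rw [← Complex.ofReal_mul, ← mul_inv, Real.mul_self_sqrt ht.le]
  have hm : ((Real.sqrt t : ℝ) : ℂ) * (((Real.sqrt t)⁻¹ : ℝ) : ℂ) = 1 := by
    rw [← Complex.ofReal_mul, mul_inv_cancel₀ (Real.sqrt_pos.2 ht).ne', Complex.ofReal_one]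
  convert h using 1
  simp only [conjBy_apply, Matrix.conjTranspose_sub, Matrix.conjTranspose_add,
    Matrix.conjTranspose_smul, Complex.star_def, Complex.conj_ofReal, Matrix.sub_mul,
    Matrix.mul_sub, Matrix.add_mul, Matrix.mul_add, Matrix.smul_mul, Matrix.mul_smul, smul_sub,
    smul_smul, hs, hsi, hm, mul_comm _ ((Real.sqrt t : ℝ) : ℂ), one_smul, Complex.ofReal_add,
    Complex.ofReal_one, add_smul]
  abel

lemma liftOp_qKraus_add (e : A ⊕ B ↪ W) (K L : Matrix (B → Bool) (A → Bool) ℂ) (b : B → Bool) :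
    liftOp e (qKraus (K + L) b) = liftOp e (qKraus K b) + liftOp e (qKraus L b) := by
  rw [← liftOpL_apply, ← liftOpL_apply, ← liftOpL_apply, ← map_add]
  congr 1
  ext s t
  simp only [qKraus, Matrix.of_apply, Matrix.add_apply]
  split_ifs <;> simp

/-- Channels with one Kraus operator each, which are close in norm. -/
lemma localQuery_conjBy_le (e : A ⊕ B ↪ W) (K L : Matrix (B → Bool) (A → Bool) ℂ) {r t : ℝ}
    (hr : 0 ≤ r) (ht : 0 < t) (hK : conjBy K 1 = 1) (hL : conjBy L 1 = (r : ℂ) • 1)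
    {ω : Op W →ₗ[ℂ] ℂ} (hω : SubState ω) {M : Op W} (hM : Effect M) :
    (ω (localQuery e (conjBy (K + L)) M)).re ≤
      (ω (localQuery e (conjBy K) M)).re + (t + (1 + t⁻¹) * r) := by
  have h1 : (((1 + t : ℝ) : ℂ) • localQuery e (conjBy K) M +
      ((1 + t⁻¹ : ℝ) : ℂ) • localQuery e (conjBy L) M -
      localQuery e (conjBy (K + L)) M).PosSemidef := by
    have : ((1 + t : ℝ) : ℂ) • localQuery e (conjBy K) M +
        ((1 + t⁻¹ : ℝ) : ℂ) • localQuery e (conjBy L) M - localQuery e (conjBy (K + L)) M =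
        ∑ b, (((1 + t : ℝ) : ℂ) • conjBy (liftOp e (qKraus K b)) M +
          ((1 + t⁻¹ : ℝ) : ℂ) • conjBy (liftOp e (qKraus L b)) M -
          conjBy (liftOp e (qKraus K b) + liftOp e (qKraus L b)) M) := by
      simp only [← sum_conjBy_qKraus, LinearMap.sum_apply, Finset.sum_sub_distrib,
        Finset.sum_add_distrib, Finset.smul_sum, liftOp_qKraus_add]
    rw [this]
    exact Matrix.posSemidef_sum _ fun b _ => conjBy_add_le _ _ hM.1 ht
  have h2 := hω.nonneg _ h1
  rw [map_sub, map_add, map_smul, map_smul, Complex.sub_re, Complex.add_re, smul_eq_mul,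
    smul_eq_mul, Complex.re_ofReal_mul, Complex.re_ofReal_mul] at h2
  have h3 := hω.le_of_effect ((CP.conjBy K).localQuery e) hM
  have h4 := hω.le_of_effect ((CP.conjBy L).localQuery e) hM
  rw [localQuery_one e (r := 1) (by rw [hK, one_smul]), one_smul] at h3
  rw [localQuery_one e hL, map_smul, smul_eq_mul, Complex.re_ofReal_mul] at h4
  have h5 := hω.one_le
  have h6 : 0 < t⁻¹ := inv_pos.2 ht
  have h7 : r * (ω 1).re ≤ r := by nlinarith
  have h8 : (1 + t⁻¹) * (ω (localQuery e (conjBy L) M)).re ≤ (1 + t⁻¹) * r :=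
    mul_le_mul_of_nonneg_left (h4.trans h7) (by positivity)
  have h9 : t * (ω (localQuery e (conjBy K) M)).re ≤ t := by nlinarith
  linarith

end Positivity

/-! ### How much an adversary notices when one state of the family is replaced. -/

section Statistical

variable {A C W : Type} [Fintype A] [DecidableEq A] [Fintype C] [DecidableEq C]
  [Fintype W] [DecidableEq W] {lam d l : ℕ}

/-! ### Changing one state of the family -/

/-- The amplitude of one basis state in a uniform superposition of `2 ^ d` ones. -/
def uniformAmp (d : ℕ) : ℝ := (Real.sqrt (2 ^ d))⁻¹

lemma uniformAmp_pos (d : ℕ) : 0 < uniformAmp d := by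
  unfold uniformAmp; positivity

lemma uniformAmp_le_one (d : ℕ) : uniformAmp d ≤ 1 := by
  unfold uniformAmp
  exact inv_le_one_of_one_le₀ (Real.one_le_sqrt.2 (one_le_pow₀ (by norm_num)))

lemma uniformAmp_mul_self (d : ℕ) : uniformAmp d * uniformAmp d = (2 ^ d : ℝ)⁻¹ := by
  unfold uniformAmp
  rw [← mul_inv, Real.mul_self_sqrt (by positivity)]

/-- Used to absorb the loss 1 of a decryption query into the common bound for all steps. -/
lemma two_pow_mul_uniformAmp (d : ℕ) : 1 ≤ (2 ^ d : ℝ) * uniformAmp d := by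
  have h1 := uniformAmp_mul_self d
  have h2 := uniformAmp_pos d
  have h3 := uniformAmp_le_one d
  have h4 : (2 ^ d : ℝ) * (uniformAmp d * uniformAmp d) = 1 := by
    rw [h1]; exact mul_inv_cancel₀ (by positivity)
  have h5 : (0 : ℝ) < 2 ^ d * uniformAmp d := by positivity
  nlinarith

lemma quad_one {α : Type} [Fintype α] [DecidableEq α] (z : α → ℂ) :
    quad z 1 = ∑ s, star (z s) * z s := by
  rw [quad_apply]
  refine Finset.sum_congr rfl fun s _ => ?_
  rw [Finset.sum_eq_single s]
  · simp
  · intro t _ ht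
    simp [Matrix.one_apply_ne (Ne.symm ht)]
  · simp

/-- The expectation value of an observable in the state `|x⟩|g⟩^{⊗n}`. -/
def slotFun (n : ℕ) (x : Fin d → Bool) (g : PureState (Fin l)) :
    Op (Fin d ⊕ (Fin n × Fin l)) →ₗ[ℂ] ℂ :=
  quad fun c => if c ∘ Sum.inl = x then amp (tensorPow n g) (c ∘ Sum.inr) else 0

lemma slotFun_one (n : ℕ) (x : Fin d → Bool) (g : PureState (Fin l)) : slotFun n x g 1 = 1 := by
  have h := copiesMap_diag n (fun _ : Fin d → Bool => g) x 1
  rw [copiesMap_one, Matrix.one_apply_eq] at h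
  exact h.symm

/-- The ciphertext is an even mixture of `2 ^ d` slots, each involving a single state of the family.
-/
lemma ctFun_eq_sum (n : ℕ) (v : Fam d l) :
    ctFun n v = (2 ^ d : ℂ)⁻¹ • ∑ x, slotFun n x (v x) := by
  ext1 M
  rw [ctFun_apply, LinearMap.smul_apply, LinearMap.sum_apply, smul_eq_mul, Finset.mul_sum]
  refine Finset.sum_congr rfl fun x _ => ?_
  rw [copiesMap_diag]
  rfl

lemma cp_selPrep_quad (a : A) (z z' : (C → Bool) → ℂ) : CP (selPrep a (quad z) (quad z')) := by
  refine ⟨A → Bool, inferInstance, fun m₀ => Matrix.of fun c m =>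
    if m = m₀ then (if m₀ a then z' c else z c) else 0, ?_⟩
  ext1 M
  ext m m'
  rw [LinearMap.sum_apply, Matrix.sum_apply, Finset.sum_eq_single m]
  · rw [conjBy_entry, selPrep_apply]
    simp only [Matrix.of_apply, if_true]
    by_cases h : m = m'
    · subst h
      rw [Matrix.diagonal_apply_eq]
      simp only [if_true]
      split_ifs <;> rfl
    · rw [Matrix.diagonal_apply_ne _ h]
      simp [Ne.symm h]
  · intro m₀ _ hm
    rw [conjBy_entry]
    simp [Ne.symm hm]
  · simp

lemma quad_zero {α : Type} [Fintype α] : quad (0 : α → ℂ) = 0 := by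
  ext1 M
  simp [quad_apply]

lemma cp_selPrep_slot_zero (n : ℕ) (a : A) (x : Fin d → Bool) (g : PureState (Fin l)) :
    CP (selPrep a (slotFun n x g) 0) := by
  rw [← quad_zero]
  exact cp_selPrep_quad _ _ _

lemma cp_selPrep_zero_slot (n : ℕ) (a : A) (x : Fin d → Bool) (g : PureState (Fin l)) :
    CP (selPrep a 0 (slotFun n x g)) := by
  rw [← quad_zero]
  exact cp_selPrep_quad _ _ _

lemma selPrep_slot_one (n : ℕ) (a : A) (x : Fin d → Bool) (g : PureState (Fin l)) :
    selPrep a (slotFun n x g) 0 1 + selPrep a 0 (slotFun n x g) 1 = 1 := by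
  rw [selPrep_apply, selPrep_apply, Matrix.diagonal_add, slotFun_one]
  refine Eq.trans (congrArg _ (funext fun m => ?_)) Matrix.diagonal_one
  split_ifs <;> simp

/-- Preparation of the slot restricted to the event that the message is 0. It loses weight, and the
complementary event restores unitality; hence subnormalised maps and functionals are used
throughout. -/
lemma subUnital_localQuery_slot (n : ℕ) (a : A) (x : Fin d → Bool) (g : PureState (Fin l))
    (e : A ⊕ (Fin d ⊕ (Fin n × Fin l)) ↪ W) :
    SubUnital (localQuery e (selPrep a (slotFun n x g) 0)) := by
  refine ⟨(cp_selPrep_slot_zero n a x g).localQuery e, ?_⟩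
  have h := localQuery_one e (r := 1)
    (T := selPrep a (slotFun n x g) 0 + selPrep a 0 (slotFun n x g))
    (by rw [LinearMap.add_apply, selPrep_slot_one, one_smul])
  rw [localQuery_add, LinearMap.add_apply, one_smul] at h
  rw [sub_eq_of_eq_add' h.symm]
  exact ((cp_selPrep_zero_slot n a x g).localQuery e).posSemidef Matrix.PosSemidef.one

lemma CP.smul {α β : Type} [Fintype α] [Fintype β] {T : Matrix β β ℂ →ₗ[ℂ] Matrix α α ℂ}
    (hT : CP T) {r : ℝ} (hr : 0 ≤ r) : CP ((r : ℂ) • T) := by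
  obtain ⟨ι, _, K, rfl⟩ := hT
  refine ⟨ι, inferInstance, fun i => ((Real.sqrt r : ℝ) : ℂ) • K i, ?_⟩
  ext1 M
  rw [LinearMap.smul_apply, LinearMap.sum_apply, LinearMap.sum_apply, Finset.smul_sum]
  refine Finset.sum_congr rfl fun i _ => ?_
  rw [conjBy_apply, conjBy_apply, Matrix.conjTranspose_smul, Complex.star_def,
    Complex.conj_ofReal, Matrix.smul_mul, Matrix.smul_mul, Matrix.mul_smul, smul_smul,
    ← Complex.ofReal_mul, Real.mul_self_sqrt hr]

lemma prepMap_pkFun (n : ℕ) (v : Fam d l) :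
    prepMap (pkFun n v) = conjBy (Matrix.of fun s (_ : Empty → Bool) => amp (publicKey n v) s) := by
  ext1 M
  ext x y
  have h := quad_publicKey n v M
  rw [quad_apply] at h
  rw [conjBy_entry]
  exact h.symm

lemma sum_norm_amp_sq {V : Type} [Fintype V] [DecidableEq V] (v : PureState V) :
    ∑ s, ‖amp v s‖ ^ 2 = 1 := by
  have h := sum_amp v
  have h2 : ∀ s, star (amp v s) * amp v s = ((‖amp v s‖ ^ 2 : ℝ) : ℂ) := fun s => by
    rw [Complex.star_def, mul_comm, Complex.mul_conj, Complex.normSq_eq_norm_sq]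
  rw [Finset.sum_congr rfl fun s _ => h2 s, ← Complex.ofReal_sum] at h
  exact_mod_cast h

/-- The two public keys differ only in the block of `x`, of norm `uniformAmp d` in each; the factor
4 is from `|a - b|² ≤ 2|a|² + 2|b|²`. -/
lemma sum_norm_publicKey_sub_sq_le (n : ℕ) {v v' : Fam d l} {x : Fin d → Bool}
    (h : ∀ y, y ≠ x → v y = v' y) :
    ∑ s, ‖amp (publicKey n v') s - amp (publicKey n v) s‖ ^ 2 ≤
      4 * (uniformAmp d * uniformAmp d) := by
  rw [sum_bits_sum, Finset.sum_eq_single x]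
  · have h1 : ∀ (v : Fam d l) u, amp (publicKey n v) (Sum.elim x u) =
        (uniformAmp d : ℂ) * amp (tensorPow n (v x)) u := fun _ _ => rfl
    have h2 : ∀ u, ‖amp (publicKey n v') (Sum.elim x u) - amp (publicKey n v) (Sum.elim x u)‖ ^ 2 ≤
        (uniformAmp d * uniformAmp d) * (2 * ‖amp (tensorPow n (v' x)) u‖ ^ 2 +
          2 * ‖amp (tensorPow n (v x)) u‖ ^ 2) := by
      intro u
      rw [h1, h1, ← mul_sub, norm_mul, mul_pow, Complex.norm_real, Real.norm_eq_abs, sq_abs, sq]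
      refine mul_le_mul_of_nonneg_left ?_ (mul_self_nonneg _)
      have h3 := norm_sub_le (amp (tensorPow n (v' x)) u) (amp (tensorPow n (v x)) u)
      have h4 := norm_nonneg (amp (tensorPow n (v' x)) u - amp (tensorPow n (v x)) u)
      nlinarith [sq_nonneg (‖amp (tensorPow n (v' x)) u‖ - ‖amp (tensorPow n (v x)) u‖)]
    refine (Finset.sum_le_sum fun u _ => h2 u).trans ?_
    rw [← Finset.mul_sum, Finset.sum_add_distrib, ← Finset.mul_sum, ← Finset.mul_sum,
      sum_norm_amp_sq, sum_norm_amp_sq]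
    linarith
  · intro y _ hy
    refine Finset.sum_eq_zero fun u _ => ?_
    have h1 : ∀ (v : Fam d l) u, amp (publicKey n v) (Sum.elim y u) =
        (uniformAmp d : ℂ) * amp (tensorPow n (v y)) u := fun _ _ => rfl
    rw [h1, h1, h y hy, sub_self, norm_zero]
    simp
  · simp

lemma localQuery_pk_le (n : ℕ) {v v' : Fam d l} {x : Fin d → Bool} (h : ∀ y, y ≠ x → v y = v' y)
    (e : Empty ⊕ (Fin d ⊕ (Fin n × Fin l)) ↪ W) {ω : Op W →ₗ[ℂ] ℂ} (hω : SubState ω) {M : Op W}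
    (hM : Effect M) :
    (ω (localQuery e (prepMap (pkFun n v')) M)).re ≤
      (ω (localQuery e (prepMap (pkFun n v)) M)).re + 9 * uniformAmp d := by
  let L : Matrix (Fin d ⊕ (Fin n × Fin l) → Bool) (Empty → Bool) ℂ :=
    Matrix.of fun s _ => amp (publicKey n v') s - amp (publicKey n v) s
  have hadd : (Matrix.of fun s (_ : Empty → Bool) => amp (publicKey n v') s) =
      (Matrix.of fun s (_ : Empty → Bool) => amp (publicKey n v) s) + L := by
    ext s y
    simp [L]
  have hK : conjBy (Matrix.of fun s (_ : Empty → Bool) => amp (publicKey n v) s) 1 = 1 := by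
    rw [← prepMap_pkFun]
    ext y y'
    obtain rfl : y = y' := Subsingleton.elim _ _
    rw [Matrix.one_apply_eq]
    exact pkFun_one n v
  have hL : conjBy L 1 =
      ((∑ s, ‖amp (publicKey n v') s - amp (publicKey n v) s‖ ^ 2 : ℝ) : ℂ) • 1 := by
    ext y y'
    obtain rfl : y = y' := Subsingleton.elim _ _
    rw [Matrix.smul_apply, Matrix.one_apply_eq, smul_eq_mul, mul_one, Complex.ofReal_sum]
    refine (conjBy_entry _ _ _ _).trans ((quad_one _).trans ?_)
    refine Finset.sum_congr rfl fun s _ => ?_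
    rw [Complex.star_def, mul_comm, Complex.mul_conj, Complex.normSq_eq_norm_sq]
    rfl
  -- The parameter `t` is taken to be `a = uniformAmp d`, so that the error is at most `a + (1 +
  -- a⁻¹) * 4a² = 5a + 4a²`, which is at most `9a` because `a ≤ 1`.
  have hb := localQuery_conjBy_le e _ L (Finset.sum_nonneg fun _ _ => sq_nonneg _)
    (uniformAmp_pos d) hK hL hω hM
  rw [← hadd, ← prepMap_pkFun, ← prepMap_pkFun] at hb
  refine hb.trans (add_le_add_right ?_ _)
  have h1 := sum_norm_publicKey_sub_sq_le n h
  have h2 := uniformAmp_pos d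
  have h3 := uniformAmp_le_one d
  have h4 : (1 + (uniformAmp d)⁻¹) * (∑ s, ‖amp (publicKey n v') s - amp (publicKey n v) s‖ ^ 2) ≤
      (1 + (uniformAmp d)⁻¹) * (4 * (uniformAmp d * uniformAmp d)) :=
    mul_le_mul_of_nonneg_left h1 (by positivity)
  have h5 : (1 + (uniformAmp d)⁻¹) * (4 * (uniformAmp d * uniformAmp d)) =
      4 * (uniformAmp d * uniformAmp d) + 4 * uniformAmp d := by
    field_simp
  nlinarith

lemma abs_localQuery_pk_sub_le (n : ℕ) {v v' : Fam d l} {x : Fin d → Bool}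
    (h : ∀ y, y ≠ x → v y = v' y) (e : Empty ⊕ (Fin d ⊕ (Fin n × Fin l)) ↪ W)
    {ω : Op W →ₗ[ℂ] ℂ} (hω : SubState ω) {M : Op W} (hM : Effect M) :
    |(ω (localQuery e (prepMap (pkFun n v)) M)).re -
      (ω (localQuery e (prepMap (pkFun n v')) M)).re| ≤ 9 * uniformAmp d := by
  have h1 := localQuery_pk_le n h e hω hM
  have h2 := localQuery_pk_le n (fun y hy => (h y hy).symm) e hω hM
  rw [abs_le]
  constructor <;> linarith

lemma abs_localQuery_enc_sub_le (n : ℕ) {v v' : Fam d l} {x : Fin d → Bool}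
    (h : ∀ y, y ≠ x → v y = v' y) (a : A) (χ : Op (Fin d ⊕ (Fin n × Fin l)) →ₗ[ℂ] ℂ)
    (e : A ⊕ (Fin d ⊕ (Fin n × Fin l)) ↪ W)
    {ω : Op W →ₗ[ℂ] ℂ} (hω : SubState ω) {M : Op W} (hM : Effect M) :
    |(ω (localQuery e (selPrep a (ctFun n v) χ) M)).re -
      (ω (localQuery e (selPrep a (ctFun n v') χ) M)).re| ≤ 9 * uniformAmp d := by
  have hnn : (0 : ℝ) ≤ (2 ^ d : ℝ)⁻¹ := by positivity
  have hc : (((2 ^ d : ℝ)⁻¹ : ℝ) : ℂ) = (2 ^ d : ℂ)⁻¹ := by push_cast; rfl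
  -- Only the slot `x` changes, and it has weight `2 ^ (-d)`, the square of `uniformAmp d`;
  -- encryptions of 1 do not change at all.
  have hdiff : selPrep a (ctFun n v) χ - selPrep a (ctFun n v') χ =
      (((2 ^ d : ℝ)⁻¹ : ℝ) : ℂ) • selPrep a (slotFun n x (v x)) 0 -
      (((2 ^ d : ℝ)⁻¹ : ℝ) : ℂ) • selPrep a (slotFun n x (v' x)) 0 := by
    have hct : ∀ N, ctFun n v N - ctFun n v' N =
        (2 ^ d : ℂ)⁻¹ * (slotFun n x (v x) N - slotFun n x (v' x) N) := by
      intro N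
      simp only [ctFun_eq_sum, LinearMap.smul_apply, LinearMap.sum_apply, smul_eq_mul]
      rw [← mul_sub, ← Finset.sum_sub_distrib, Finset.sum_eq_single x]
      · intro y _ hy
        rw [h y hy, sub_self]
      · simp
    ext1 N
    simp only [LinearMap.sub_apply, LinearMap.smul_apply, selPrep_apply, hc]
    ext m m'
    by_cases hm : m = m'
    · subst hm
      simp only [Matrix.sub_apply, Matrix.smul_apply, Matrix.diagonal_apply_eq, smul_eq_mul]
      split_ifs
      · simp
      · rw [hct, mul_sub]
    · simp [Matrix.diagonal_apply_ne _ hm]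
  have h1 := abs_localQuery_sub_le e hdiff ((cp_selPrep_slot_zero n a x (v x)).smul hnn)
    ((cp_selPrep_slot_zero n a x (v' x)).smul hnn)
    (by simp only [LinearMap.smul_apply, selPrep_apply, slotFun_one]) hω hM
  refine h1.trans ?_
  rw [localQuery_smul, LinearMap.smul_apply, map_smul, smul_eq_mul, Complex.re_ofReal_mul]
  have h2 := (hω.comp (subUnital_localQuery_slot n a x (v x) e)).one_le
  rw [LinearMap.comp_apply] at h2
  have h3 := mul_le_mul_of_nonneg_left h2 hnn
  rw [mul_one] at h3
  rw [← uniformAmp_mul_self] at h3 ⊢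
  have h4 := uniformAmp_pos d
  have h5 := uniformAmp_le_one d
  nlinarith

/-- The projector on the ciphertexts with classical part `x`. -/
def slotProj (n l : ℕ) (x : Fin d → Bool) : Op (Fin d ⊕ (Fin n × Fin l)) :=
  Matrix.diagonal fun c => if c ∘ Sum.inl = x then 1 else 0

lemma conjBy_slotProj_apply (n l : ℕ) (x : Fin d → Bool) (M : Op (Fin d ⊕ (Fin n × Fin l)))
    (c c' : Fin d ⊕ (Fin n × Fin l) → Bool) : conjBy (slotProj n l x) M c c' =
      if c ∘ Sum.inl = x ∧ c' ∘ Sum.inl = x then M c c' else 0 := by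
  rw [conjBy_apply, slotProj, Matrix.diagonal_conjTranspose, Matrix.mul_diagonal,
    Matrix.diagonal_mul]
  by_cases h1 : c ∘ Sum.inl = x <;> by_cases h2 : c' ∘ Sum.inl = x <;> simp [h1, h2]

/-- No bound for a single `x` is possible, as the query may be aimed at it. But decryption measures
`x`, so altering the state at `x` matters only on the part of the query with classical part `x`, and
the weights of these parts sum to at most 1. -/
lemma sum_localQuery_dec_sub_le (n : ℕ) (v : Fam d l) (v' : (Fin d → Bool) → Fam d l)
    (h : ∀ x y, y ≠ x → v y = v' x y) (e : (Fin d ⊕ (Fin n × Fin l)) ⊕ Unit ↪ W)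
    {ω : Op W →ₗ[ℂ] ℂ} (hω : SubState ω) (M : (Fin d → Bool) → Op W) (hM : ∀ x, Effect (M x)) :
    ∑ x, |(ω (localQuery e (decChannel n v).dual (M x))).re -
      (ω (localQuery e (decChannel n (v' x)).dual (M x))).re| ≤ 1 := by
  -- The two channels agree outside block `x`, so cutting both down to it by `slotProj` leaves their
  -- difference unchanged.
  have hdiff : ∀ x, (decChannel n v).dual - (decChannel n (v' x)).dual =
      conjBy (slotProj n l x) ∘ₗ (decChannel n v).dual -
      conjBy (slotProj n l x) ∘ₗ (decChannel n (v' x)).dual := by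
    intro x
    ext1 N
    ext c c'
    simp only [LinearMap.sub_apply, LinearMap.comp_apply, Matrix.sub_apply, conjBy_slotProj_apply]
    rw [← sumElim_comp c, ← sumElim_comp c']
    simp only [decChannel_dual_apply, Sum.elim_comp_inl]
    by_cases h1 : c ∘ Sum.inl = c' ∘ Sum.inl
    · by_cases h2 : c ∘ Sum.inl = x
      · have h3 : c' ∘ Sum.inl = x := h1 ▸ h2
        simp only [h2, h3, and_self, if_true]
      · simp only [h2, false_and, if_false, h x _ h2, sub_self]
    · simp only [h1, if_false, ite_self]
  have hone : ∀ x, (conjBy (slotProj n l x) ∘ₗ (decChannel n v).dual) 1 =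
      (conjBy (slotProj n l x) ∘ₗ (decChannel n (v' x)).dual) 1 := by
    intro x
    rw [LinearMap.comp_apply, LinearMap.comp_apply, Channel.dual_one, Channel.dual_one]
  have hstep : ∀ x, _ := fun x => abs_localQuery_sub_le e (hdiff x)
    ((CP.conjBy _).comp (decChannel n v).cp_dual) ((CP.conjBy _).comp (decChannel n (v' x)).cp_dual)
    (hone x) hω (hM x)
  refine (Finset.sum_le_sum fun x _ => hstep x).trans ?_
  rw [← Complex.re_sum, ← map_sum]
  have hsum : ∑ x, localQuery e (conjBy (slotProj n l x) ∘ₗ (decChannel n v).dual) 1 = 1 := by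
    rw [← LinearMap.sum_apply, ← localQuery_sum]
    have := localQuery_one e (r := 1)
      (T := ∑ x, conjBy (slotProj n l x) ∘ₗ (decChannel n v).dual) (by
        ext c c'
        rw [LinearMap.sum_apply, Matrix.sum_apply, one_smul]
        simp only [LinearMap.comp_apply, Channel.dual_one, conjBy_slotProj_apply]
        rw [Finset.sum_eq_single (c ∘ Sum.inl)]
        · by_cases h1 : c = c'
          · subst h1; simp
          · simp [Matrix.one_apply_ne h1]
        · intro y _ hy
          rw [if_neg (fun hh => hy hh.1.symm)]
        · simp)
    rwa [one_smul] at this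
  rw [hsum]
  exact hω.one_le

/-- The probability loss of one step of a circuit. -/
lemma sum_instr₁_sub_le (n : ℕ) (ψ : (Fin lam → Bool) → Fam d l) (v : Fam d l)
    (v' : (Fin d → Bool) → Fam d l) (h : ∀ x y, y ≠ x → v y = v' x y)
    (c : Instr (prfsScheme n ψ).interface₁ W) (ω : Op W →ₗ[ℂ] ℂ) (hω : SubState ω)
    (M : (Fin d → Bool) → Op W) (hM : ∀ x, Effect (M x)) :
    ∑ x, |(ω (c.dual (gameOracles₁ n ψ v) (M x))).re -
      (ω (c.dual (gameOracles₁ n ψ (v' x)) (M x))).re| ≤ 2 ^ d * (9 * uniformAmp d) := by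
  have hconst : ∀ f : (Fin d → Bool) → ℝ, (∀ x, f x ≤ 9 * uniformAmp d) →
      ∑ x, f x ≤ 2 ^ d * (9 * uniformAmp d) := fun f hf =>
    (Finset.sum_le_sum fun x _ => hf x).trans (by simp)
  -- Public keys and encryptions are bounded for each `x` separately, which gives the factor `2 ^
  -- d`; a decryption costs 1 in total and is covered by the same bound.
  have h0 := two_pow_mul_uniformAmp d
  cases c with
  | gate g =>
    simp only [Instr.dual, sub_self, abs_zero, Finset.sum_const_zero]
    linarith
  | query q e =>
    cases q with
    | qpk =>
      refine hconst _ fun x => ?_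
      have := abs_localQuery_pk_sub_le n (h x) e hω (hM x)
      rw [← pkChannel_dual n ψ, ← pkChannel_dual n ψ] at this
      exact this
    | enc =>
      refine hconst _ fun x => ?_
      have := abs_localQuery_enc_sub_le n (h x) () (avgCt n ψ) e hω (hM x)
      rw [← encChannel_dual n ψ, ← encChannel_dual n ψ] at this
      exact this
    | dec =>
      have := sum_localQuery_dec_sub_le n v v' h e hω M hM
      refine le_trans this ?_
      linarith

lemma instr₂_sub_le (n : ℕ) (ψ : (Fin lam → Bool) → Fam d l) {v v' : Fam d l} {x : Fin d → Bool}
    (h : ∀ y, y ≠ x → v y = v' y)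
    (c : Instr (prfsScheme n ψ).interface₂ W) (ω : Op W →ₗ[ℂ] ℂ) (hω : SubState ω)
    {M : Op W} (hM : Effect M) :
    |(ω (c.dual (gameOracles₂ n ψ v) M)).re -
      (ω (c.dual (gameOracles₂ n ψ v') M)).re| ≤ 9 * uniformAmp d := by
  have h0 := uniformAmp_pos d
  cases c with
  | gate g =>
    simp only [Instr.dual, sub_self, abs_zero]
    linarith
  | query q e =>
    cases q with
    | qpk =>
      have := abs_localQuery_pk_sub_le n h e hω hM
      rw [← pkChannel_dual n ψ, ← pkChannel_dual n ψ] at this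
      exact this
    | enc =>
      have := abs_localQuery_enc_sub_le n h () (avgCt n ψ) e hω hM
      rw [← encChannel_dual n ψ, ← encChannel_dual n ψ] at this
      exact this

/-- After the challenge the adversary knows `x`, so a bound for every single `x` is needed. It
exists because there is no decryption in this phase. -/
lemma progDual₂_sub_le (n : ℕ) (ψ : (Fin lam → Bool) → Fam d l) {v v' : Fam d l}
    {x : Fin d → Bool} (h : ∀ y, y ≠ x → v y = v' y)
    (P : List (Instr (prfsScheme n ψ).interface₂ W)) (ω : Op W →ₗ[ℂ] ℂ) (hω : SubState ω)
    {M : Op W} (hM : Effect M) :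
    |(ω (progDual (gameOracles₂ n ψ v) P M)).re -
      (ω (progDual (gameOracles₂ n ψ v') P M)).re| ≤ P.length * (9 * uniformAmp d) := by
  have := sum_progDual_sub_le (X := Unit) (gameOracles₂ n ψ v) (fun _ => gameOracles₂ n ψ v')
    (9 * uniformAmp d) (fun c ω hω E hE => by
      rw [Fintype.sum_unique]
      exact instr₂_sub_le n ψ h c ω hω (hE _)) P ω hω (fun _ => M) (fun _ => hM)
  rwa [Fintype.sum_unique] at this

/-- The expectation value of an observable after both phases of the game, where the challenge
register is prepared by `Λ`. -/
def gameDual (n : ℕ) (ψ : (Fin lam → Bool) → Fam d l) (v : Fam d l)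
    (P₁ : List (Instr (prfsScheme n ψ).interface₁ W)) (Λ : Op W →ₗ[ℂ] Op W)
    (P₂ : List (Instr (prfsScheme n ψ).interface₂ W)) : Op W →ₗ[ℂ] Op W :=
  progDual (gameOracles₁ n ψ v) P₁ ∘ₗ Λ ∘ₗ progDual (gameOracles₂ n ψ v) P₂

/-- The states of the family which are not used by the challenge can be changed. -/
lemma sum_gameDual_sub_le (n : ℕ) (ψ : (Fin lam → Bool) → Fam d l) (v : Fam d l)
    (v' : (Fin d → Bool) → Fam d l) (h : ∀ x y, y ≠ x → v y = v' x y)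
    (P₁ : List (Instr (prfsScheme n ψ).interface₁ W)) (Λ : (Fin d → Bool) → Op W →ₗ[ℂ] Op W)
    (hΛ : ∀ x, SubUnital (Λ x)) (P₂ : List (Instr (prfsScheme n ψ).interface₂ W))
    {ω : Op W →ₗ[ℂ] ℂ} (hω : SubState ω) {M : Op W} (hM : Effect M) :
    ∑ x, |(ω (gameDual n ψ v P₁ (Λ x) P₂ M)).re - (ω (gameDual n ψ (v' x) P₁ (Λ x) P₂ M)).re| ≤
      2 ^ d * ((P₁.length + P₂.length) * (9 * uniformAmp d)) := by
  -- First phase: the functional is run with `v` and does not know `x`. Challenge and second phase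
  -- do depend on `x`, but they are part of the observable.
  have h1 := sum_progDual_sub_le (gameOracles₁ n ψ v) (fun x => gameOracles₁ n ψ (v' x)) _
    (sum_instr₁_sub_le n ψ v v' h) P₁ ω hω
    (fun x => Λ x (progDual (gameOracles₂ n ψ (v' x)) P₂ M)) fun x => (hΛ x).effect
      ((SubUnital.of_one (cp_progDual _ _) (progDual_one _ _)).effect hM)
  -- Second phase: the challenge for `x` has been delivered, and the family is altered for this `x`
  -- alone.
  have h2 : ∀ x, |((ω ∘ₗ progDual (gameOracles₁ n ψ v) P₁ ∘ₗ Λ x)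
        (progDual (gameOracles₂ n ψ v) P₂ M)).re -
      ((ω ∘ₗ progDual (gameOracles₁ n ψ v) P₁ ∘ₗ Λ x)
        (progDual (gameOracles₂ n ψ (v' x)) P₂ M)).re| ≤ P₂.length * (9 * uniformAmp d) := fun x =>
    progDual₂_sub_le n ψ (h x) P₂ _
      ((hω.comp (SubUnital.of_one (cp_progDual _ _) (progDual_one _ _))).comp (hΛ x)) hM
  calc _ ≤ ∑ x, (P₂.length * (9 * uniformAmp d) +
        |(ω (progDual (gameOracles₁ n ψ v) P₁ (Λ x (progDual (gameOracles₂ n ψ (v' x)) P₂ M)))).re -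
        (ω (progDual (gameOracles₁ n ψ (v' x)) P₁
          (Λ x (progDual (gameOracles₂ n ψ (v' x)) P₂ M)))).re|) :=
        Finset.sum_le_sum fun x _ => (abs_sub_le _ _ _).trans (add_le_add_left (h2 x) _)
    _ ≤ 2 ^ d * (P₂.length * (9 * uniformAmp d)) + P₁.length * (2 ^ d * (9 * uniformAmp d)) := by
        rw [Finset.sum_add_distrib]
        exact add_le_add (by simp) h1
    _ = _ := by ring

end Statistical

/-! ### Independent Haar families: exchange symmetry and integrability. -/

section Haar

open MeasureTheory

variable {A B W : Type} [Fintype A] [DecidableEq A] [Fintype B] [DecidableEq B]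
  [Fintype W] [DecidableEq W] {lam d l : ℕ}

/-! ### The Haar measure on state families -/

instance (W : Type) [Fintype W] [DecidableEq W] : IsProbabilityMeasure (haarState W) := by
  have : Nontrivial (EuclideanSpace ℂ (W → Bool)) :=
    inferInstanceAs (Nontrivial (PiLp 2 fun _ : W → Bool => ℂ))
  refine ⟨?_⟩
  rw [haarState, Measure.smul_apply, smul_eq_mul]
  refine ENNReal.inv_mul_cancel ?_ (measure_ne_top _ _)
  rw [Ne, Measure.measure_univ_eq_zero]
  exact Measure.toSphere_ne_zero _

/-- The distribution of families of independent Haar random states. -/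
def haarFam (d l : ℕ) : Measure (Fam d l) := Measure.pi fun _ => haarState (Fin l)

instance (d l : ℕ) : IsProbabilityMeasure (haarFam d l) :=
  inferInstanceAs (IsProbabilityMeasure (Measure.pi fun _ : Fin d → Bool => haarState (Fin l)))

/-- Families form a compact space, a product of spheres, so integrability reduces to continuity. -/
lemma integrable_of_continuous {X : Type} [TopologicalSpace X] [CompactSpace X]
    [MeasurableSpace X] [OpensMeasurableSpace X] (μ : Measure X) [IsFiniteMeasure μ] {f : X → ℝ}
    (hf : Continuous f) : Integrable f μ :=
  hf.integrable_of_hasCompactSupport (HasCompactSupport.of_compactSpace f)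

/-- Exchange the states at `x` of two families. -/
def swapAt (x : Fin d → Bool) (p : Fam d l × Fam d l) : Fam d l × Fam d l :=
  (Function.update p.1 x (p.2 x), Function.update p.2 x (p.1 x))

lemma continuous_swapAt (x : Fin d → Bool) : Continuous (swapAt (l := l) x) :=
  (continuous_fst.update x ((continuous_apply x).comp continuous_snd)).prodMk
    (continuous_snd.update x ((continuous_apply x).comp continuous_fst))

/-- Seen as a family of independent pairs of identically distributed states, the pair of families
keeps its law when one of these pairs is flipped. -/
lemma measurePreserving_swapAt (x : Fin d → Bool) :
    MeasurePreserving (swapAt (l := l) x) ((haarFam d l).prod (haarFam d l))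
      ((haarFam d l).prod (haarFam d l)) := by
  have h1 := measurePreserving_arrowProdEquivProdArrow (PureState (Fin l)) (PureState (Fin l))
    (Fin d → Bool) (fun _ => haarState (Fin l)) (fun _ => haarState (Fin l))
  have h2 : MeasurePreserving
      (fun (a : (Fin d → Bool) → PureState (Fin l) × PureState (Fin l)) i =>
        (if i = x then Prod.swap else id) (a i))
      (Measure.pi fun _ => (haarState (Fin l)).prod (haarState (Fin l)))
      (Measure.pi fun _ => (haarState (Fin l)).prod (haarState (Fin l))) := by
    refine measurePreserving_pi _ _ (f := fun i => if i = x then Prod.swap else id) fun i => ?_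
    split_ifs
    · exact Measure.measurePreserving_swap
    · exact MeasurePreserving.id _
  have h3 := (h1.comp h2).comp (h1.symm _)
  refine Eq.subst (motive := fun f => MeasurePreserving f ((haarFam d l).prod (haarFam d l))
    ((haarFam d l).prod (haarFam d l))) (funext fun p => ?_) h3
  refine Prod.ext ?_ ?_
  · funext i
    change ((if i = x then Prod.swap else id) (p.1 i, p.2 i)).1 = Function.update p.1 x (p.2 x) i
    by_cases h : i = x
    · subst h; simp
    · simp [h]
  · funext i
    change ((if i = x then Prod.swap else id) (p.1 i, p.2 i)).2 = Function.update p.2 x (p.1 x) i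
    by_cases h : i = x
    · subst h; simp
    · simp [h]

lemma integral_swapAt (x : Fin d → Bool) {f : Fam d l × Fam d l → ℝ} (hf : Continuous f) :
    ∫ p, f (swapAt x p) ∂(haarFam d l).prod (haarFam d l) =
      ∫ p, f p ∂(haarFam d l).prod (haarFam d l) := by
  have h := measurePreserving_swapAt (l := l) x
  conv_rhs => rw [← h.map_eq]
  exact (integral_map h.measurable.aemeasurable
    (hf.measurable.aestronglyMeasurable)).symm

/-! ### Continuity -/

variable {X : Type} [TopologicalSpace X]

/-- Continuous families of linear maps between observables. -/
def ContFam {α β : Type} (T : X → Matrix β β ℂ →ₗ[ℂ] Matrix α α ℂ) : Prop :=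
  ∀ M : X → Matrix β β ℂ, Continuous M → Continuous fun p => T p (M p)

lemma ContFam.const {α β : Type} [Fintype α] [Fintype β]
    (T : Matrix β β ℂ →ₗ[ℂ] Matrix α α ℂ) : ContFam fun _ : X => T :=
  fun _ hM => (LinearMap.continuous_of_finiteDimensional T).comp hM

lemma ContFam.comp {α β γ : Type} {T : X → Matrix β β ℂ →ₗ[ℂ] Matrix α α ℂ}
    {S : X → Matrix γ γ ℂ →ₗ[ℂ] Matrix β β ℂ} (hT : ContFam T) (hS : ContFam S) :
    ContFam fun p => T p ∘ₗ S p :=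
  fun _ hM => hT _ (hS _ hM)

lemma ContFam.localQuery {T : X → Op B →ₗ[ℂ] Op A} (hT : ContFam T) (e : A ⊕ B ↪ W) :
    ContFam fun p => localQuery e (T p) := by
  intro M hM
  refine continuous_matrix fun s t => ?_
  simp only [localQuery_apply]
  by_cases h : s ∘ e ∘ Sum.inr = t ∘ e ∘ Sum.inr
  · simp only [h, if_true]
    exact (hT _ (hM.matrix_submatrix _ _)).matrix_elem _ _
  · simp only [h, if_false]
    exact continuous_const

lemma continuous_amp {V : Type} [Fintype V] [DecidableEq V] (s : V → Bool) :
    Continuous fun v : PureState V => amp v s :=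
  ((PiLp.continuous_apply 2 (fun _ : V → Bool => ℂ) s).comp continuous_subtype_val :)

lemma continuous_amp_tensorPow (n : ℕ) (u : Fin n × Fin l → Bool) :
    Continuous fun g : PureState (Fin l) => amp (tensorPow n g) u := by
  change Continuous fun g : PureState (Fin l) => ∏ i, amp g fun j => u (i, j)
  exact continuous_finsetProd _ fun _ _ => continuous_amp _

lemma continuous_quad {α : Type} [Fintype α] {z : X → α → ℂ} (hz : ∀ s, Continuous fun p => z p s)
    {M : X → Matrix α α ℂ} (hM : Continuous M) : Continuous fun p => quad (z p) (M p) := by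
  simp only [quad_apply]
  exact continuous_finsetSum _ fun s _ => continuous_finsetSum _ fun t _ =>
    (((hz s).star).mul (hM.matrix_elem s t)).mul (hz t)

lemma continuous_slotFun (n : ℕ) (x : Fin d → Bool) {g : X → PureState (Fin l)}
    (hg : Continuous g) {M : X → Op (Fin d ⊕ (Fin n × Fin l))} (hM : Continuous M) :
    Continuous fun p => slotFun n x (g p) (M p) := by
  refine continuous_quad (fun s => ?_) hM
  by_cases h : s ∘ Sum.inl = x
  · simp only [h, if_true]
    exact (continuous_amp_tensorPow n _).comp hg
  · simp only [h, if_false]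
    exact continuous_const

lemma continuous_ctFun (n : ℕ) {v : X → Fam d l} (hv : Continuous v)
    {M : X → Op (Fin d ⊕ (Fin n × Fin l))} (hM : Continuous M) :
    Continuous fun p => ctFun n (v p) (M p) := by
  simp only [ctFun_eq_sum, LinearMap.smul_apply, LinearMap.sum_apply, smul_eq_mul]
  exact continuous_const.mul (continuous_finsetSum _ fun x _ =>
    continuous_slotFun n x ((continuous_apply x).comp hv) hM)

lemma contFam_selPrep (a : A) {χ₀ χ₁ : X → Op B →ₗ[ℂ] ℂ}
    (h₀ : ∀ M : X → Op B, Continuous M → Continuous fun p => χ₀ p (M p))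
    (h₁ : ∀ M : X → Op B, Continuous M → Continuous fun p => χ₁ p (M p)) :
    ContFam fun p => selPrep a (χ₀ p) (χ₁ p) := by
  intro M hM
  simp only [selPrep_apply]
  refine Continuous.matrix_diagonal (continuous_pi fun m => ?_)
  by_cases h : m a
  · simp only [h, if_true]
    exact h₁ M hM
  · simp only [h]
    exact h₀ M hM

lemma continuous_functional {α : Type} [Fintype α] (χ : Matrix α α ℂ →ₗ[ℂ] ℂ)
    {M : X → Matrix α α ℂ} (hM : Continuous M) : Continuous fun p => χ (M p) :=
  (LinearMap.continuous_of_finiteDimensional χ).comp hM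

lemma contFam_enc (n : ℕ) (ψ : (Fin lam → Bool) → Fam d l) {v : X → Fam d l} (hv : Continuous v)
    (a : A) : ContFam fun p => (encChannel n ψ (v p) a).dual := by
  simp only [encChannel_dual]
  exact contFam_selPrep a (fun _ hM => continuous_ctFun n hv hM)
    (fun _ hM => continuous_functional _ hM)

lemma contFam_pk (n : ℕ) (ψ : (Fin lam → Bool) → Fam d l) {v : X → Fam d l} (hv : Continuous v) :
    ContFam fun p => (pkChannel n ψ (v p)).dual := by
  simp only [pkChannel_dual]
  intro M hM
  refine continuous_matrix fun s t => ?_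
  change Continuous fun p => pkFun n (v p) (M p)
  simp only [← quad_publicKey]
  refine continuous_quad (fun s => ?_) hM
  simp only [amp_publicKey]
  exact continuous_const.mul ((continuous_amp_tensorPow n _).comp ((continuous_apply _).comp hv))

lemma contFam_dec (n : ℕ) {v : X → Fam d l} (hv : Continuous v) :
    ContFam fun p => (decChannel n (v p)).dual := by
  intro M hM
  refine continuous_matrix fun s t => ?_
  rw [← sumElim_comp s, ← sumElim_comp t]
  simp only [decChannel_dual_apply]
  have ht : ∀ u u' : Fin n × Fin l → Bool,
      Continuous fun p => testsEntry n (v p (s ∘ Sum.inl)) u u' := by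
    intro u u'
    simp only [testsEntry, testEntry]
    have : ∀ u, Continuous fun p => amp (v p (s ∘ Sum.inl)) u := fun u =>
      (continuous_amp u).comp ((continuous_apply _).comp hv)
    fun_prop
  by_cases h : s ∘ Sum.inl = t ∘ Sum.inl
  · simp only [h, if_true]
    rw [h] at ht
    exact ((ht _ _).mul (hM.matrix_elem _ _)).add
      ((continuous_const.sub (ht _ _)).mul (hM.matrix_elem _ _))
  · simp only [h, if_false]
    exact continuous_const

lemma contFam_progDual {I : Interface} {O : X → ∀ q, Channel (I.inp q) (I.out q)}
    (h : ∀ q, ContFam fun p => (O p q).dual) (P : List (Instr I W)) :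
    ContFam fun p => progDual (O p) P := by
  induction P with
  | nil => exact ContFam.const LinearMap.id
  | cons c P ih =>
    refine ContFam.comp (T := fun p => c.dual (O p)) ?_ ih
    cases c with
    | gate g => exact ContFam.const _
    | query q e => exact (h q).localQuery e

/-- Entries of all oracle maps are polynomials in the amplitudes and their conjugates; this makes
the integrals over Haar families in the hybrids meaningful. -/
lemma contFam_gameDual (n : ℕ) (ψ : (Fin lam → Bool) → Fam d l) {v : X → Fam d l}
    (hv : Continuous v) (P₁ : List (Instr (prfsScheme n ψ).interface₁ W))
    {Λ : X → Op W →ₗ[ℂ] Op W} (hΛ : ContFam Λ)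
    (P₂ : List (Instr (prfsScheme n ψ).interface₂ W)) :
    ContFam fun p => gameDual n ψ (v p) P₁ (Λ p) P₂ := by
  have h₁ : ∀ q, ContFam fun p => (gameOracles₁ n ψ (v p) q).dual := by
    intro q
    cases q with
    | qpk => exact contFam_pk n ψ hv
    | enc => exact contFam_enc n ψ hv (A := Unit) ()
    | dec => exact contFam_dec n hv
  have h₂ : ∀ q, ContFam fun p => (gameOracles₂ n ψ (v p) q).dual := by
    intro q
    cases q with
    | qpk => exact contFam_pk n ψ hv
    | enc => exact contFam_enc n ψ hv (A := Unit) ()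
  exact (contFam_progDual h₁ P₁).comp (hΛ.comp (contFam_progDual h₂ P₂))

end Haar

/-! ### The hybrid games and the two reductions to pseudorandomness. -/

section Hybrids

open MeasureTheory

variable {W : Type} [Fintype W] [DecidableEq W] {lam d l n : ℕ} {ψ : (Fin lam → Bool) → Fam d l}

/-! ### The game as a function of the state family and of the challenge -/

lemma Instr.posSemidef_run {I : Interface} (O : ∀ q, Channel (I.inp q) (I.out q)) (c : Instr I W)
    {ρ : Op W} (hρ : ρ.PosSemidef) : (c.run O ρ).PosSemidef := by
  cases c with
  | gate g => exact hρ.mul_mul_conjTranspose_same _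
  | query q e =>
    exact Matrix.posSemidef_sum _ fun i _ => Matrix.posSemidef_sum _ fun b _ =>
      hρ.mul_mul_conjTranspose_same _

lemma posSemidef_runProg {I : Interface} (O : ∀ q, Channel (I.inp q) (I.out q))
    (P : List (Instr I W)) {ρ : Op W} (hρ : ρ.PosSemidef) : (runProg O P ρ).PosSemidef := by
  induction P generalizing ρ with
  | nil => exact hρ
  | cons c P ih => exact ih (c.posSemidef_run O hρ)

/-- The state of a memory after the execution of an oracle circuit. -/
def DensityOp.run {I : Interface} (O : ∀ q, Channel (I.inp q) (I.out q)) (P : List (Instr I W))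
    (ρ : DensityOp W) : DensityOp W where
  mat := runProg O P ρ.mat
  posSemidef := posSemidef_runProg O P ρ.posSemidef
  trace_eq_one := by
    have h := trace_runProg O P ρ.mat 1
    rwa [progDual_one, Matrix.mul_one, Matrix.mul_one, ρ.trace_eq_one] at h

/-- The wires of the challenge. -/
def CCA1Adversary.chalWires (A : CCA1Adversary (prfsScheme n ψ)) :
    Bool ⊕ (Fin d ⊕ (Fin n × Fin l)) ↪ Fin A.N := A.chal

/-- The expectation value of the output, if the oracles are given by the state family `v` and the
challenge is prepared by the process with adjoint `T`. -/
def CCA1Adversary.valueLin (A : CCA1Adversary (prfsScheme n ψ)) (v : Fam d l) :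
    (Op (Fin d ⊕ (Fin n × Fin l)) →ₗ[ℂ] Op Bool) →ₗ[ℂ] ℂ where
  toFun T := A.init.expect (gameDual n ψ v A.prog₁ (localQuery A.chalWires T) A.prog₂
    (wireProj A.out true))
  map_add' T T' := by
    simp only [gameDual, LinearMap.comp_apply, localQuery_add, LinearMap.add_apply, map_add]
  map_smul' c T := by
    simp only [gameDual, LinearMap.comp_apply, localQuery_smul, LinearMap.smul_apply, map_smul,
      RingHom.id_apply]

/-- The probability of the output `1`, if the oracles are given by the state family `v` and the
challenge register is prepared as described by `χ₀` or `χ₁`, according to the `b`-th message. -/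
def CCA1Adversary.value (A : CCA1Adversary (prfsScheme n ψ)) (b : Bool) (v : Fam d l)
    (χ₀ χ₁ : Op (Fin d ⊕ (Fin n × Fin l)) →ₗ[ℂ] ℂ) : ℝ :=
  (A.valueLin v (selPrep b χ₀ χ₁)).re

lemma gameDual_one (v : Fam d l) (P₁ : List (Instr (prfsScheme n ψ).interface₁ W))
    {Λ : Op W →ₗ[ℂ] Op W} (hΛ : Λ 1 = 1) (P₂ : List (Instr (prfsScheme n ψ).interface₂ W)) :
    gameDual n ψ v P₁ Λ P₂ 1 = 1 := by
  rw [gameDual, LinearMap.comp_apply, LinearMap.comp_apply, progDual_one, hΛ, progDual_one]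

lemma CCA1Adversary.trace_finalState (A : CCA1Adversary (prfsScheme n ψ)) (dk : Fin lam → Bool)
    (b : Bool) (M : Op (Fin A.N)) :
    (A.finalState dk b * M).trace = A.init.expect (gameDual n ψ (ψ dk) A.prog₁
      (localQuery A.chalWires (selPrep b (ctFun n (ψ dk)) (avgCt n ψ))) A.prog₂ M) := by
  have h := ((trace_runProg ((prfsScheme n ψ).oracles₂ dk) A.prog₂ _ M).trans
    (((prfsScheme n ψ).encOracle dk b).trace_query A.chal _ _)).trans
    (trace_runProg ((prfsScheme n ψ).oracles₁ dk) A.prog₁ A.init.mat _)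
  refine h.trans ?_
  rw [oracles₁_eq, oracles₂_eq, ← encChannel_dual]
  rfl

lemma CCA1Adversary.measProb_true (A : CCA1Adversary (prfsScheme n ψ)) (dk : Fin lam → Bool)
    (b : Bool) : measProb (A.finalState dk b) A.out true =
      A.value b (ψ dk) (ctFun n (ψ dk)) (avgCt n ψ) := by
  rw [measProb_eq, A.trace_finalState]
  rfl

/-- The total probability of the two outputs is 1 because the game is unital; thus winning for both
bits is expressed by the output 1 alone. -/
lemma CCA1Adversary.measProb_false (A : CCA1Adversary (prfsScheme n ψ)) (dk : Fin lam → Bool)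
    (b : Bool) : measProb (A.finalState dk b) A.out false =
      1 - A.value b (ψ dk) (ctFun n (ψ dk)) (avgCt n ψ) := by
  have h1 := A.trace_finalState dk b 1
  rw [gameDual_one, A.init.expect_one] at h1
  · rw [← A.measProb_true, measProb_eq, measProb_eq, eq_sub_iff_add_eq, ← Complex.add_re,
      ← Matrix.trace_add, ← Matrix.mul_add, wireProj_add, h1, Complex.one_re]
  · have := localQuery_one A.chalWires (r := 1)
      (T := selPrep b (ctFun n (ψ dk)) (avgCt n ψ))
      (by rw [← encChannel_dual, Channel.dual_one, one_smul])
    rwa [one_smul] at this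

lemma CCA1Adversary.winProb_eq (A : CCA1Adversary (prfsScheme n ψ)) :
    A.winProb = 1 / 2 + 1 / 2 *
      (∑ dk, (2 ^ lam : ℝ)⁻¹ * A.value true (ψ dk) (ctFun n (ψ dk)) (avgCt n ψ) -
        ∑ dk, (2 ^ lam : ℝ)⁻¹ * A.value false (ψ dk) (ctFun n (ψ dk)) (avgCt n ψ)) := by
  have hgen : ∀ dk : Fin lam → Bool, ((prfsScheme n ψ).gen dk).toReal = (2 ^ lam : ℝ)⁻¹ := by
    intro dk
    change (PMF.uniformOfFintype (Fin lam → Bool) dk).toReal = _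
    rw [PMF.uniformOfFintype_apply]
    simp
  have h1 : A.winProb = ∑ dk : Fin lam → Bool, (2 ^ lam : ℝ)⁻¹ * (1 / 2 + 1 / 2 *
      (A.value true (ψ dk) (ctFun n (ψ dk)) (avgCt n ψ) -
        A.value false (ψ dk) (ctFun n (ψ dk)) (avgCt n ψ))) := by
    have h2 : ∀ dk : Fin lam → Bool, ((prfsScheme n ψ).gen dk).toReal *
        ∑ b : Bool, (1 / 2) * measProb (A.finalState dk b) A.out b = (2 ^ lam : ℝ)⁻¹ *
        (1 / 2 + 1 / 2 * (A.value true (ψ dk) (ctFun n (ψ dk)) (avgCt n ψ) -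
          A.value false (ψ dk) (ctFun n (ψ dk)) (avgCt n ψ))) := by
      intro dk
      rw [hgen dk, Fintype.sum_bool, A.measProb_true dk true, A.measProb_false dk false]
      ring
    exact Finset.sum_congr rfl fun dk _ => h2 dk
  rw [h1]
  simp only [mul_add, Finset.sum_add_distrib, mul_sub, Finset.sum_sub_distrib]
  have h2 : ∑ _ : Fin lam → Bool, (2 ^ lam : ℝ)⁻¹ * (1 / 2) = 1 / 2 := by simp
  rw [h2, Finset.mul_sum, Finset.mul_sum]
  congr 2 <;> exact Finset.sum_congr rfl fun _ _ => by ring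

lemma card_inp₁_le (n : ℕ) (ψ : (Fin lam → Bool) → Fam d l) (q : (prfsScheme n ψ).interface₁.Q) :
    Fintype.card ((prfsScheme n ψ).interface₁.inp q) ≤ querySize d l n := by
  rw [querySize]
  cases q with
  | qpk => exact Nat.zero_le _
  | enc =>
    change Fintype.card Unit ≤ _
    rw [Fintype.card_unit]
    nlinarith
  | dec =>
    change Fintype.card (Fin d ⊕ (Fin n × Fin l)) ≤ _
    rw [card_ct]
    nlinarith

lemma card_inp₂_le (n : ℕ) (ψ : (Fin lam → Bool) → Fam d l) (q : (prfsScheme n ψ).interface₂.Q) :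
    Fintype.card ((prfsScheme n ψ).interface₂.inp q) ≤ querySize d l n := by
  cases q with
  | qpk => exact card_inp₁_le n ψ Query₁.qpk
  | enc => exact card_inp₁_le n ψ Query₁.enc

/-- A bound on the size of the distinguishers built from an adversary of size `s`. -/
def reductionSize (d l n s : ℕ) : ℕ := s * (2 * querySize d l n + 1) + querySize d l n + 2

/-- Distinguish the states of the decryption key from random ones. -/
lemma CCA1Adversary.exists_distinguisher_key (A : CCA1Adversary (prfsScheme n ψ)) (b : Bool) :
    ∃ D : Distinguisher d l, D.size ≤ reductionSize d l n A.size ∧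
      ∀ v, D.acceptProb v = A.value b v (ctFun n v) (avgCt n ψ) := by
  have h := (Sim.progDual (Sim.oracles₁ n ψ) (card_inp₁_le n ψ) A.prog₁).comp
    (((Sim.enc n ψ b).localQuery A.chalWires).comp
      (Sim.progDual (Sim.oracles₂ n ψ) (card_inp₂_le n ψ) A.prog₂))
  obtain ⟨D, hD, h2⟩ := h.exists_distinguisher A.init A.out
  -- The challenge is one more query whose input register has the two message wires, hence the
  -- summand `querySize d l n + 2` in the bound.
  refine ⟨D, hD.trans ?_, h2⟩
  rw [reductionSize, CCA1Adversary.size, Fintype.card_bool]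
  nlinarith [Nat.zero_le (A.N * querySize d l n)]

/-- Distinguish the states in an encryption of `1` from random ones, for given oracles. -/
lemma CCA1Adversary.exists_distinguisher_challenge (A : CCA1Adversary (prfsScheme n ψ)) (b : Bool)
    (v : Fam d l) : ∃ D : Distinguisher d l, D.size ≤ reductionSize d l n A.size ∧
      ∀ w, D.acceptProb w = A.value b v (ctFun n v) (ctFun n w) := by
  -- The oracle serves only the challenge for message 1. All that depends on the fixed family `v` is
  -- advice: the ciphertext of 0, the answers of the second phase, and the memory after the first
  -- phase.
  have h := ((Sim.select b (Sim.ct_const n v) (Sim.ct n) (fun _ => ctFun_one n v)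
    (ctFun_one n)).localQuery A.chalWires).comp
      (Sim.progDual (Sim.oracles₂_const n ψ v) (card_inp₂_le n ψ) A.prog₂)
  obtain ⟨D, hD, h2⟩ := h.exists_distinguisher (A.init.run (gameOracles₁ n ψ v) A.prog₁) A.out
  refine ⟨D, hD.trans ?_, fun w => ?_⟩
  · rw [reductionSize, CCA1Adversary.size, Fintype.card_bool, card_ct]
    have h3 : d + n * l + (d + n * (d + l + 1)) + (d + n * l) ≤ querySize d l n := by
      rw [querySize]
      nlinarith [Nat.zero_le (n * l), Nat.zero_le (n * d)]
    nlinarith [Nat.zero_le (A.N * querySize d l n), Nat.zero_le (A.prog₁.length * querySize d l n)]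
  · rw [h2 w]
    exact congrArg Complex.re (trace_runProg _ _ _ _)

lemma CCA1Adversary.continuous_value {X : Type} [TopologicalSpace X]
    (A : CCA1Adversary (prfsScheme n ψ)) (b : Bool) {v : X → Fam d l} (hv : Continuous v)
    {χ₀ χ₁ : X → Op (Fin d ⊕ (Fin n × Fin l)) →ₗ[ℂ] ℂ}
    (h₀ : ∀ M : X → Op (Fin d ⊕ (Fin n × Fin l)), Continuous M → Continuous fun p => χ₀ p (M p))
    (h₁ : ∀ M : X → Op (Fin d ⊕ (Fin n × Fin l)), Continuous M → Continuous fun p => χ₁ p (M p)) :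
    Continuous fun p => A.value b (v p) (χ₀ p) (χ₁ p) :=
  Complex.continuous_re.comp (continuous_functional A.init.expect
    (contFam_gameDual n ψ hv A.prog₁ ((contFam_selPrep b h₀ h₁).localQuery A.chalWires) A.prog₂ _
      continuous_const))

/-- The game is linear in the challenge, so a random key in the challenge becomes an average of
games, the form in which pseudorandomness applies. -/
lemma CCA1Adversary.value_avgCt (A : CCA1Adversary (prfsScheme n ψ)) (b : Bool) (v : Fam d l)
    (χ : Op (Fin d ⊕ (Fin n × Fin l)) →ₗ[ℂ] ℂ) :
    A.value b v χ (avgCt n ψ) = ∑ k, (2 ^ lam : ℝ)⁻¹ * A.value b v χ (ctFun n (ψ k)) := by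
  have h : selPrep b χ (avgCt n ψ) =
      ∑ k, (((2 ^ lam : ℝ)⁻¹ : ℝ) : ℂ) • selPrep b χ (ctFun n (ψ k)) := by
    ext1 M
    ext m m'
    simp only [LinearMap.sum_apply, Matrix.sum_apply, LinearMap.smul_apply, Matrix.smul_apply,
      selPrep_apply]
    by_cases hm : m = m'
    · subst hm
      simp only [Matrix.diagonal_apply_eq]
      split_ifs
      · simp [avgCt, LinearMap.sum_apply]
      · simp
    · simp [Matrix.diagonal_apply_ne _ hm]
  rw [CCA1Adversary.value, h, map_sum, Complex.re_sum]
  refine Finset.sum_congr rfl fun k _ => ?_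
  rw [map_smul, smul_eq_mul, Complex.re_ofReal_mul]
  rfl

/-- Separates the event that the chosen message is 1 from the challenges at the single points `x`,
so that one state can be exchanged at a time. -/
lemma CCA1Adversary.value_ctFun (A : CCA1Adversary (prfsScheme n ψ)) (b : Bool) (v w : Fam d l)
    (χ : Op (Fin d ⊕ (Fin n × Fin l)) →ₗ[ℂ] ℂ) :
    A.value b v (ctFun n w) χ = A.value b v 0 χ +
      (2 ^ d : ℝ)⁻¹ * ∑ x, A.value b v (slotFun n x (w x)) 0 := by
  have h : selPrep b (ctFun n w) χ = selPrep b 0 χ +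
      (((2 ^ d : ℝ)⁻¹ : ℝ) : ℂ) • ∑ x, selPrep b (slotFun n x (w x)) 0 := by
    ext1 M
    ext m m'
    simp only [LinearMap.add_apply, LinearMap.sum_apply, Matrix.sum_apply, LinearMap.smul_apply,
      Matrix.smul_apply, Matrix.add_apply, selPrep_apply, ctFun_eq_sum]
    by_cases hm : m = m'
    · subst hm
      simp only [Matrix.diagonal_apply_eq]
      split_ifs <;> simp
    · simp [Matrix.diagonal_apply_ne _ hm]
  rw [CCA1Adversary.value, h, map_add, map_smul, map_sum, smul_eq_mul, Complex.add_re,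
    Complex.re_ofReal_mul, Complex.re_sum]
  rfl

/-! ### The hybrids -/

/-- A random encryption of `1` may use a random family of states. -/
lemma CCA1Adversary.exists_distinguisher_avgCt (A : CCA1Adversary (prfsScheme n ψ)) (b : Bool) :
    ∃ D : Distinguisher d l, D.size ≤ reductionSize d l n A.size ∧
      |∫ v, A.value b v (ctFun n v) (avgCt n ψ) ∂haarFam d l -
        ∫ p, A.value b p.1 (ctFun n p.1) (ctFun n p.2) ∂(haarFam d l).prod (haarFam d l)| ≤
      |(∑ k, (2 ^ lam : ℝ)⁻¹ * D.acceptProb (ψ k)) - ∫ w, D.acceptProb w ∂haarFam d l| := by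
  have hi₁ : Integrable (fun v => A.value b v (ctFun n v) (avgCt n ψ)) (haarFam d l) :=
    integrable_of_continuous _ (A.continuous_value b continuous_id
      (fun _ hM => continuous_ctFun n continuous_id hM) (fun _ hM => continuous_functional _ hM))
  have hi₂ : Integrable (fun p : Fam d l × Fam d l =>
      A.value b p.1 (ctFun n p.1) (ctFun n p.2)) ((haarFam d l).prod (haarFam d l)) :=
    integrable_of_continuous _ (A.continuous_value b continuous_fst
      (fun _ hM => continuous_ctFun n continuous_fst hM)
      (fun _ hM => continuous_ctFun n continuous_snd hM))
  have hi₃ := hi₁.sub hi₂.integral_prod_left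
  -- Some family `v` does at least as well as the average; it is hard-wired as non-uniform advice.
  obtain ⟨v, hv⟩ := exists_integral_le hi₃.abs
  obtain ⟨D, hD, h⟩ := A.exists_distinguisher_challenge b v
  refine ⟨D, hD, ?_⟩
  rw [integral_prod _ hi₂, ← integral_sub hi₁ hi₂.integral_prod_left]
  refine (abs_integral_le_integral_abs).trans (hv.trans (le_of_eq ?_))
  simp only [h, Pi.sub_apply, A.value_avgCt]

/-- The challenge may use a random family of states which is independent of the oracles. -/
lemma CCA1Adversary.abs_integral_value_sub_le (A : CCA1Adversary (prfsScheme n ψ)) (b : Bool) :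
    |∫ p, A.value b p.1 (ctFun n p.1) (ctFun n p.2) ∂(haarFam d l).prod (haarFam d l) -
      ∫ p, A.value b p.1 (ctFun n p.2) (ctFun n p.2) ∂(haarFam d l).prod (haarFam d l)| ≤
      A.size * (9 * uniformAmp d) := by
  set μ := (haarFam d l).prod (haarFam d l) with hμ
  have hG : ∀ (x : Fin d → Bool) {v : Fam d l × Fam d l → Fam d l}
      {g : Fam d l × Fam d l → PureState (Fin l)}, Continuous v → Continuous g →
      Continuous fun p => A.value b (v p) (slotFun n x (g p)) 0 := fun x _ _ hv hg =>
    A.continuous_value b hv (fun _ hM => continuous_slotFun n x hg hM)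
      (fun _ _ => continuous_const)
  have hc₁ : ∀ x : Fin d → Bool, Continuous fun p : Fam d l × Fam d l =>
      A.value b p.1 (slotFun n x (p.1 x)) 0 := fun x =>
    hG x continuous_fst ((continuous_apply x).comp continuous_fst)
  have hc₂ : ∀ x : Fin d → Bool, Continuous fun p : Fam d l × Fam d l =>
      A.value b p.1 (slotFun n x (p.2 x)) 0 := fun x =>
    hG x continuous_fst ((continuous_apply x).comp continuous_snd)
  have hc₃ : ∀ x : Fin d → Bool, Continuous fun p : Fam d l × Fam d l =>
      A.value b (swapAt x p).1 (slotFun n x (p.1 x)) 0 := fun x =>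
    hG x (continuous_fst.comp (continuous_swapAt x)) ((continuous_apply x).comp continuous_fst)
  -- Renaming `p.1 x` and `p.2 x` moves the change from the challenge to the oracles: the challenge
  -- keeps the state `p.1 x`, while the oracles have `p.2 x` at this one point.
  have hswap : ∀ x, ∫ p, A.value b p.1 (slotFun n x (p.2 x)) 0 ∂μ =
      ∫ p, A.value b (swapAt x p).1 (slotFun n x (p.1 x)) 0 ∂μ := by
    intro x
    rw [hμ, ← integral_swapAt x (hc₂ x)]
    refine integral_congr_ae (Filter.Eventually.of_forall fun p => ?_)
    simp [swapAt]
  have hdiff : ∫ p, A.value b p.1 (ctFun n p.1) (ctFun n p.2) ∂μ -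
      ∫ p, A.value b p.1 (ctFun n p.2) (ctFun n p.2) ∂μ =
      ∫ p, (2 ^ d : ℝ)⁻¹ * ∑ x, (A.value b p.1 (slotFun n x (p.1 x)) 0 -
        A.value b (swapAt x p).1 (slotFun n x (p.1 x)) 0) ∂μ := by
    have hb : Integrable (fun p : Fam d l × Fam d l => A.value b p.1 0 (ctFun n p.2)) μ :=
      integrable_of_continuous _ (A.continuous_value b continuous_fst
        (fun _ _ => continuous_const) (fun _ hM => continuous_ctFun n continuous_snd hM))
    have h₁ := fun x => integrable_of_continuous μ (hc₁ x)
    have h₂ := fun x => integrable_of_continuous μ (hc₂ x)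
    have h₃ := fun x => integrable_of_continuous μ (hc₃ x)
    simp only [A.value_ctFun b _ _ (ctFun n _)]
    rw [integral_add hb ((integrable_finsetSum _ fun x _ => h₁ x).const_mul _),
      integral_add hb ((integrable_finsetSum _ fun x _ => h₂ x).const_mul _),
      add_sub_add_left_eq_sub, integral_const_mul, integral_const_mul, integral_const_mul,
      integral_finsetSum _ fun x _ => h₁ x, integral_finsetSum _ fun x _ => h₂ x,
      integral_finsetSum _ (f := fun x p => A.value b p.1 (slotFun n x (p.1 x)) 0 -
        A.value b (swapAt x p).1 (slotFun n x (p.1 x)) 0) fun x _ => (h₁ x).sub (h₃ x), ← mul_sub, ← Finset.sum_sub_distrib]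
    congr 1
    refine Finset.sum_congr rfl fun x _ => ?_
    rw [hswap, ← integral_sub (h₁ x) (h₃ x)]
  rw [hdiff]
  have hbound : ∀ p : Fam d l × Fam d l,
      ‖(2 ^ d : ℝ)⁻¹ * ∑ x, (A.value b p.1 (slotFun n x (p.1 x)) 0 -
        A.value b (swapAt x p).1 (slotFun n x (p.1 x)) 0)‖ ≤ A.size * (9 * uniformAmp d) := by
    intro p
    -- The bound holds for every pair `p`, not only on average. The uniform weight of `x` in the
    -- challenge cancels the factor `2 ^ d`.
    have h := sum_gameDual_sub_le n ψ p.1 (fun x => (swapAt x p).1)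
      (fun x y hy => by simp [swapAt, hy]) A.prog₁
      (fun x => localQuery A.chalWires (selPrep b (slotFun n x (p.1 x)) 0))
      (fun x => subUnital_localQuery_slot n b x (p.1 x) A.chalWires) A.prog₂ A.init.subState
      (effect_wireProj A.out true)
    rw [norm_mul, norm_inv, norm_pow, Real.norm_ofNat, Real.norm_eq_abs]
    have h2 := (Finset.abs_sum_le_sum_abs _ _).trans h
    have h3 := mul_le_mul_of_nonneg_left h2 (by positivity : (0 : ℝ) ≤ (2 ^ d : ℝ)⁻¹)
    refine le_trans h3 ?_
    rw [← mul_assoc, inv_mul_cancel₀ (by positivity), one_mul]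
    refine mul_le_mul_of_nonneg_right ?_ (by have := uniformAmp_pos d; positivity)
    rw [CCA1Adversary.size]
    push_cast
    have := Nat.cast_nonneg (α := ℝ) A.N
    linarith
  have := norm_integral_le_of_norm_le_const (μ := μ) (Filter.Eventually.of_forall hbound)
  simpa using this

/-- If both messages lead to the same challenge, neither the messages nor the bit have any
influence. -/
lemma CCA1Adversary.value_eq_of_same (A : CCA1Adversary (prfsScheme n ψ)) (v : Fam d l)
    (χ : Op (Fin d ⊕ (Fin n × Fin l)) →ₗ[ℂ] ℂ) : A.value true v χ χ = A.value false v χ χ := by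
  have h : ∀ b : Bool, selPrep b χ χ = selPrep false χ χ := by
    intro b
    ext1 M
    simp only [selPrep_apply, ite_self]
  rw [CCA1Adversary.value, CCA1Adversary.value, h]

/-- The advantage of a distinguisher against the family `ψ`. -/
def Distinguisher.advantage (D : Distinguisher d l) (ψ : (Fin lam → Bool) → Fam d l) : ℝ :=
  |(∑ k, (2 ^ lam : ℝ)⁻¹ * D.acceptProb (ψ k)) - ∫ v, D.acceptProb v ∂haarFam d l|

/-- The advantage of an adversary is bounded by those of four distinguishers. -/
lemma CCA1Adversary.exists_winProb_le (A : CCA1Adversary (prfsScheme n ψ)) :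
    ∃ D D' : Bool → Distinguisher d l, (∀ b, (D b).size ≤ reductionSize d l n A.size) ∧
      (∀ b, (D' b).size ≤ reductionSize d l n A.size) ∧
      A.winProb ≤ 1 / 2 + ((∑ b, ((D b).advantage ψ + (D' b).advantage ψ)) +
        A.size * (9 * uniformAmp d)) := by
  choose D hD h using A.exists_distinguisher_key
  choose D' hD' h' using A.exists_distinguisher_avgCt
  refine ⟨D, D', hD, hD', ?_⟩
  have h1 : ∀ b, |∑ dk, (2 ^ lam : ℝ)⁻¹ * A.value b (ψ dk) (ctFun n (ψ dk)) (avgCt n ψ) -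
      ∫ v, A.value b v (ctFun n v) (avgCt n ψ) ∂haarFam d l| = (D b).advantage ψ := by
    intro b
    simp only [Distinguisher.advantage, h]
  have h2 := A.abs_integral_value_sub_le true
  have h3 := A.abs_integral_value_sub_le false
  -- Both chains of hybrids, for `b` true and false, now end at the same game. The statistical loss
  -- occurs twice, and the factor 1/2 in `winProb_eq` compensates for it.
  simp only [A.value_eq_of_same] at h2
  have h4 := h' true
  have h5 := h' false
  have h6 := h1 true
  have h7 := h1 false
  have h8 : 0 ≤ (D true).advantage ψ := abs_nonneg _
  have h9 : 0 ≤ (D false).advantage ψ := abs_nonneg _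
  have h10 : 0 ≤ (D' true).advantage ψ := abs_nonneg _
  have h11 : 0 ≤ (D' false).advantage ψ := abs_nonneg _
  rw [A.winProb_eq, Fintype.sum_bool]
  change _ ≤ (D' true).advantage ψ at h4
  change _ ≤ (D' false).advantage ψ at h5
  have := abs_le.1 h2
  have := abs_le.1 h3
  have := abs_le.1 h4
  have := abs_le.1 h5
  have := abs_le.1 h6.le
  have := abs_le.1 h7.le
  linarith

end Hybrids

/-! ### Polynomial sizes and negligible losses. -/

section Asymptotic

open Filter Topology

/-! ### Asymptotics -/

lemma PolyBounded.mono {f g : ℕ → ℕ} (hg : PolyBounded g) (h : ∀ lam, f lam ≤ g lam) :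
    PolyBounded f := by
  obtain ⟨p, hp⟩ := hg
  exact ⟨p, fun lam => (h lam).trans (hp lam)⟩

lemma PolyBounded.const (c : ℕ) : PolyBounded fun _ => c :=
  ⟨Polynomial.C c, fun lam => by simp⟩

lemma PolyBounded.add {f g : ℕ → ℕ} (hf : PolyBounded f) (hg : PolyBounded g) :
    PolyBounded fun lam => f lam + g lam := by
  obtain ⟨p, hp⟩ := hf
  obtain ⟨q, hq⟩ := hg
  exact ⟨p + q, fun lam => by rw [Polynomial.eval_add]; exact add_le_add (hp lam) (hq lam)⟩

lemma PolyBounded.mul {f g : ℕ → ℕ} (hf : PolyBounded f) (hg : PolyBounded g) :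
    PolyBounded fun lam => f lam * g lam := by
  obtain ⟨p, hp⟩ := hf
  obtain ⟨q, hq⟩ := hg
  exact ⟨p * q, fun lam => by rw [Polynomial.eval_mul]; exact Nat.mul_le_mul (hp lam) (hq lam)⟩

/-- The generating circuit has wires for its input and its output, so its polynomial size bounds `d`
and `l`. -/
lemma EfficientlyGenerated.polyBounded {d l : ℕ → ℕ}
    {ψ : ∀ lam, (Fin lam → Bool) → (Fin (d lam) → Bool) → PureState (Fin (l lam))}
    (h : EfficientlyGenerated d l ψ) : PolyBounded d ∧ PolyBounded l := by
  obtain ⟨p, hp⟩ := h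
  constructor
  · refine ⟨p, fun lam => ?_⟩
    obtain ⟨a, C, h1, -⟩ := hp lam
    omega
  · refine ⟨p, fun lam => ?_⟩
    obtain ⟨a, C, h1, -⟩ := hp lam
    omega

lemma PolyBounded.reductionSize {d l n s : ℕ → ℕ} (hd : PolyBounded d) (hl : PolyBounded l)
    (hn : PolyBounded n) (hs : PolyBounded s) :
    PolyBounded fun lam => reductionSize (d lam) (l lam) (n lam) (s lam) := by
  have hq : PolyBounded fun lam => querySize (d lam) (l lam) (n lam) :=
    ((hn.add (.const 1)).mul ((PolyBounded.const 10).mul ((hd.add hl).add (.const 1)))).add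
      (hn.mul hl)
  exact ((hs.mul (((PolyBounded.const 2).mul hq).add (.const 1))).add hq).add (.const 2)

lemma uniformAmp_eq_exp (d : ℕ) : uniformAmp d = Real.exp (-(d * (Real.log 2 / 2))) := by
  have h1 := uniformAmp_mul_self d
  have h2 : Real.exp (-(d * (Real.log 2 / 2))) * Real.exp (-(d * (Real.log 2 / 2))) =
      (2 ^ d : ℝ)⁻¹ := by
    rw [← Real.exp_add, ← Real.exp_log (show (0 : ℝ) < (2 ^ d : ℝ)⁻¹ by positivity), Real.log_inv,
      Real.log_pow]
    congr 1
    ring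
  exact (mul_self_inj (uniformAmp_pos d).le (Real.exp_pos _).le).1 (h1.trans h2.symm)

/-- The quantity is `2^(-d/2)`, and `d = ω(log λ)` makes `2^(d/2)` eventually exceed every power of
`λ`. -/
lemma SuperLog.negligible {d : ℕ → ℕ} (hd : SuperLog d) :
    Negligible fun lam => uniformAmp (d lam) := by
  intro z
  have hlog : 0 < Real.log 2 / 2 := by
    have := Real.log_pos one_lt_two
    linarith
  have hz : (0 : ℝ) < z + 1 := by positivity
  -- The constant makes `λ^(z+1) ≤ 2^(d/2)` eventually; the additional power of `λ` leaves the bound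
  -- `1/λ`, which tends to 0.
  have h := hd.def (div_pos hlog hz)
  refine squeeze_zero' (Eventually.of_forall fun lam =>
    mul_nonneg (pow_nonneg (Nat.cast_nonneg _) _) (uniformAmp_pos _).le) ?_
    (tendsto_inv_atTop_zero.comp tendsto_natCast_atTop_atTop)
  filter_upwards [h, eventually_ge_atTop 1] with lam h1 h2
  have hpos : (0 : ℝ) < lam := by exact_mod_cast h2
  have h3 : (z + 1) * Real.log lam ≤ d lam * (Real.log 2 / 2) := by
    have h4 := (le_abs_self _).trans h1
    rw [Real.norm_of_nonneg (Nat.cast_nonneg _), div_mul_eq_mul_div, le_div_iff₀ hz] at h4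
    linarith
  have h5 : (lam : ℝ) ^ z * lam = Real.exp ((z + 1) * Real.log lam) := by
    rw [← pow_succ, mul_comm, Real.exp_mul, Real.exp_log hpos]
    exact_mod_cast (Real.rpow_natCast (lam : ℝ) (z + 1)).symm
  rw [Function.comp_apply, inv_eq_one_div, le_div_iff₀ hpos, mul_right_comm, h5,
    uniformAmp_eq_exp, ← Real.exp_add, Real.exp_le_one_iff]
  linarith

lemma Negligible.polyBounded_mul {s : ℕ → ℕ} (hs : PolyBounded s) {f : ℕ → ℝ}
    (hf : Negligible f) (h0 : ∀ lam, 0 ≤ f lam) : Negligible fun lam => s lam * f lam := by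
  obtain ⟨p, hp⟩ := hs
  have h1 := hf.polynomial_mul (p.map (Nat.castRingHom ℝ))
  refine fun z => squeeze_zero (fun lam => ?_) (fun lam => ?_) (h1 z)
  · exact mul_nonneg (pow_nonneg (Nat.cast_nonneg _) _)
      (mul_nonneg (Nat.cast_nonneg _) (h0 lam))
  · refine mul_le_mul_of_nonneg_left ?_ (pow_nonneg (Nat.cast_nonneg _) _)
    refine mul_le_mul_of_nonneg_right ?_ (h0 lam)
    rw [Polynomial.eval_natCast_map]
    exact Nat.cast_le.2 (hp lam)

end Asymptotic

end QCrypto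

end

theorem mainTheorem2 (d l n : ℕ → ℕ)
    (ψ : ∀ lam, (Fin lam → Bool) → (Fin (d lam) → Bool) → QCrypto.PureState (Fin (l lam)))
    (hψ : QCrypto.IsQAPRFS d l ψ) (hd : QCrypto.SuperLog d) (hn : QCrypto.PolyBounded n) :
    QCrypto.IsINDCCA1 (fun lam => QCrypto.prfsScheme (n lam) (ψ lam)) := by
  intro A hA
  obtain ⟨hdp, hlp⟩ := hψ.efficient.polyBounded
  have hsize := QCrypto.PolyBounded.reductionSize hdp hlp hn hA
  -- The distinguishers are chosen separately for each security parameter, as non-uniformity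
  -- permits. For each of the two bits there is one family of each kind, and all have polynomial
  -- size.
  choose D D' hD hD' h using fun lam => (A lam).exists_winProb_le
  choose ε hε hadv using fun b => hψ.pseudorandom (fun lam => D lam b)
    (hsize.mono fun lam => hD lam b)
  choose ε' hε' hadv' using fun b => hψ.pseudorandom (fun lam => D' lam b)
    (hsize.mono fun lam => hD' lam b)
  have hstat : QCrypto.Negligible fun lam =>
      ((A lam).size : ℝ) * (9 * QCrypto.uniformAmp (d lam)) :=
    QCrypto.Negligible.polyBounded_mul hA (hd.negligible.const_mul 9) fun lam =>
      mul_nonneg (by norm_num) (QCrypto.uniformAmp_pos _).le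
  refine ⟨fun lam => ((ε true lam + ε' true lam) + (ε false lam + ε' false lam)) +
      (A lam).size * (9 * QCrypto.uniformAmp (d lam)),
    (((hε true).add (hε' true)).add ((hε false).add (hε' false))).add hstat, fun lam => ?_⟩
  refine (h lam).trans ?_
  rw [Fintype.sum_bool]
  have h1 : ∀ b, (D lam b).advantage (ψ lam) ≤ ε b lam := fun b => hadv b lam
  have h2 : ∀ b, (D' lam b).advantage (ψ lam) ≤ ε' b lam := fun b => hadv' b lam
  linarith [h1 true, h1 false, h2 true, h2 false]
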